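/- Let $k$ be a field of characteristic zero, $\mathcal H$ a cocommutative Hopf algebra over $k$ (coproduct $\Delta(h)=h^{(1)}\otimes h^{(2)}$, counit $\varepsilon$, antipode $S$), and $M$ a stable anti-Yetter–Drinfeld (SAYD) module over $\mathcal H$, i.e. a right $\mathcal H$-module and left $\mathcal H$-comodule, with coaction $\varphi_M(m)=m^{(-1)}\otimes m^{(0)}$, such that $$(mh)^{(-1)}\otimes (mh)^{(0)}=S(h^{(3)})m^{(-1)}h^{(1)}\otimes m^{(0)}h^{(2)},\qquad m^{(0)}m^{(-1)}=m .$$ Let $\psi:M\to M\otimes M$, $\psi(m)=m_{(1)}\otimes m_{(2)}$, be a linear map which is compatible with the coactions and the actions: $$(\Delta\otimes\psi)\circ\varphi_M=\varphi_{M\otimes M}\circ\psi,\qquad \psi(mh)=\psi(m)\Delta(h),$$ where $\varphi_{M\otimes M}(m\otimes n)=(m^{(-1)}\otimes n^{(-1)})\otimes(m^{(0)}\otimes n^{(0)})$ and $(m\otimes n)(h\otimes h')=mh\otimes nh'$. **Notation.** Let $C=C(\mathcal H,M)$ be given by $C^n=M\otimes_{\mathcal H}\mathcal H^{\otimes (n+1)}$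 (diagonal action of $\mathcal H$ on $\mathcal H^{\otimes(n+1)}$), with cofaces $\delta_i:C^{n}\to C^{n+1}$ applying $\Delta$ to $h_i$ for $0\le i\le n$ and $$\delta_{n+1}(m\otimes_{\mathcal H} h_0\otimes\cdots\otimes h_n)=m^{(0)}\otimes_{\mathcal H} h_0^{(2)}\otimes h_1\otimes\cdots\otimes h_n\otimes m^{(-1)}h_0^{(1)},$$ codegeneracies $s_i:C^{n+1}\to C^n$ applying $\varepsilon$ to $h_{i+1}$ ($0\le i\le n$), and cyclic operators $$\tau_n(m\otimes_{\mathcal H} h_0\otimes\cdots\otimes h_n)=m^{(0)}\otimes_{\mathcal H} h_1\otimes\cdots\otimes h_n\otimes m^{(-1)}h_0 .$$ The diagonal $C\times C$ has $(C\times C)^n=C^n\otimes C^n$ with diagonal structure maps. For a cocyclic module $D$ let $\overline D^n=\bigcap_i\ker s_i\subseteq D^n$ be the normalized cochains, $b=\sum_i(-1)^i\delta_i$, and let $B=N s_{n-1}\tau_n(1-\lambda_n):D^n\to D^{n-1}$ be Connes' operator, with $\lambda_n=(-1)^n\tau_n$ and $N=\sum_{i=0}^{n-1}\lambda_{n-1}^i$.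 The periodic cyclic cohomology $HP^i(D)$, $i\in\mathbb Z/2$, is the cohomology of the $\mathbb Z/2$-graded complex $\bigoplus_n\overline D^{2n}\rightleftarrows\bigoplus_n\overline D^{2n+1}$ with differential $b+B$, and $HP^i(\mathcal H,M)=HP^i(C)$. Likewise $HP^i(C\otimes C)$ is the cohomology of the graded tensor product of the $\mathbb Z/2$-graded complex of $C$ with itself, whose differential is $d(x\otimes y)=dx\otimes y+(-1)^{|x|}x\otimes dy$, $d=b+B$. Let $\rho_n:C^n\to C^n\otimes C^n$ be $$\rho_n(m\otimes_{\mathcal H}h_0\otimes\cdots\otimes h_n)=(m_{(1)}\otimes_{\mathcal H}h_0^{(1)}\otimes\cdots\otimes h_n^{(1)})\otimes(m_{(2)}\otimes_{\mathcal H}h_0^{(2)}\otimes\cdots\otimes h_n^{(2)}),$$ and let $\rho$ also denote the map induced on the direct sums. Let $\widetilde{Sh}=sh+sh'$ where, on $(C\times C)^n$, $$sh=\sum_{i+j=n}\ \sum_{\sigma}\operatorname{sign}(\sigma)\,s_{\sigma(i+1)-1}\cdots s_{\sigma(n)-1}\otimes s_{\sigma(1)-1}\cdots s_{\sigma(i)-1}\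 \in\ \bigoplus_{i+j=n}\operatorname{Hom}\bigl((C\times C)^n,C^i\otimes C^j\bigr)$$ is the sum over all $(i,j)$-shuffles $\sigma$ of $\{1,\dots,n\}$, and $sh'$ is the cyclic shuffle map, with components $C^n\otimes C^n\to C^{i-1}\otimes C^{j-1}$, $i+j=n$, $i,j\ge1$, $$sh'_{i,j}=\sum\ (-1)^{i-1}(-1)^{p(i-1)+q(j-1)}\operatorname{sign}(\sigma)\; s_{i-p-1}\tau_i^{p+1}s_{\sigma(i+1)-1}\cdots s_{\sigma(n)-1}\otimes s_{j-q-1}\tau_j^{q+1}s_{\sigma(1)-1}\cdots s_{\sigma(i)-1},$$ summed over $0\le p<i$, $0\le q<j$ and all $(i,j)$-shuffles $\sigma$ with $\sigma(p+1)<\sigma(i+q+1)$. Finally let $$\nabla:\bigoplus_{i+j\equiv n\,(2)}HP^i(\mathcal H,M)\otimes HP^j(\mathcal H,M)\to HP^n(C\otimes C),\qquad [x]\otimes[y]\mapsto[x\otimes y].$$ **Theorem.** $C(\mathcal H,M)$ is a cocyclic module, $\rho:C\to C\times C$ is a map of cocyclic modules, the $\mathbb Z/2$-graded spaces above (for $C$,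 for $C\times C$ and for $C\otimes C$) are complexes, and $\rho$ and $\widetilde{Sh}$ induce maps of $\mathbb Z/2$-graded complexes from that of $C$ to that of $C\times C$, and from that of $C\times C$ to that of $C\otimes C$. For $n\in\mathbb Z/2$ the Künneth map $\nabla$ is an isomorphism. Consequently there is a unique family of linear maps $$\sqcup:HP^n(\mathcal H,M)\longrightarrow\bigoplus_{i+j\equiv n\,(2)}HP^i(\mathcal H,M)\otimes HP^j(\mathcal H,M),\qquad n=0,1,$$ with $\nabla\circ\sqcup=(\widetilde{Sh}\,\rho)^*$, i.e. $\sqcup=\nabla^{-1}(\widetilde{Sh}\,\rho)^*$ is a well-defined coproduct map on periodic Hopf cyclic cohomology. -/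

import Mathlib

open scoped TensorProduct RightActions DirectSum

set_option linter.unusedSectionVars false

noncomputable section

namespace HopfCyclic

/-! ### Cocyclic modules -/

universe u v w

/-- The data of a cocyclic `k`-module: spaces `C⁰, C¹, …`, cofaces `δ n i : Cⁿ → Cⁿ⁺¹`
(meaningful for `0 ≤ i ≤ n + 1`), codegeneracies `σ n i : Cⁿ⁺¹ → Cⁿ` (meaningful for `0 ≤ i ≤ n`)
and cyclic operators `τ n : Cⁿ → Cⁿ`. The identities are `CocyclicData.IsCocyclic`. -/
structure CocyclicData (k : Type u) [Field k] where
  obj : ℕ → Type w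
  [addCommGroup : ∀ n, AddCommGroup (obj n)]
  [module : ∀ n, Module k (obj n)]
  δ : ∀ n : ℕ, ℕ → (obj n →ₗ[k] obj (n + 1))
  σ : ∀ n : ℕ, ℕ → (obj (n + 1) →ₗ[k] obj n)
  τ : ∀ n : ℕ, obj n →ₗ[k] obj n

attribute [instance] CocyclicData.addCommGroup CocyclicData.module

namespace CocyclicData

variable {k : Type u} [Field k]

/-- The axioms of a cocyclic module. -/
structure IsCocyclic (C : CocyclicData.{u, w} k) : Prop where
  δ_δ : ∀ n i j, i < j → j ≤ n + 2 → C.δ (n + 1) j ∘ₗ C.δ n i = C.δ (n + 1) i ∘ₗ C.δ n (j - 1)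
  σ_σ : ∀ n i j, i ≤ j → j ≤ n → C.σ n j ∘ₗ C.σ (n + 1) i = C.σ n i ∘ₗ C.σ (n + 1) (j + 1)
  σ_δ_lt : ∀ n i j, i < j → j ≤ n + 1 →
    C.σ (n + 1) j ∘ₗ C.δ (n + 1) i = C.δ n i ∘ₗ C.σ n (j - 1)
  σ_δ_self : ∀ n j, j ≤ n → C.σ n j ∘ₗ C.δ n j = LinearMap.id
  σ_δ_succ : ∀ n j, j ≤ n → C.σ n j ∘ₗ C.δ n (j + 1) = LinearMap.id
  σ_δ_gt : ∀ n i j, j + 1 < i → i ≤ n + 2 →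
    C.σ (n + 1) j ∘ₗ C.δ (n + 1) i = C.δ n (i - 1) ∘ₗ C.σ n j
  τ_δ : ∀ n i, 1 ≤ i → i ≤ n + 1 → C.τ (n + 1) ∘ₗ C.δ n i = C.δ n (i - 1) ∘ₗ C.τ n
  τ_δ_zero : ∀ n, C.τ (n + 1) ∘ₗ C.δ n 0 = C.δ n (n + 1)
  τ_σ : ∀ n i, 1 ≤ i → i ≤ n → C.τ n ∘ₗ C.σ n i = C.σ n (i - 1) ∘ₗ C.τ (n + 1)
  τ_σ_zero : ∀ n, C.τ n ∘ₗ C.σ n 0 = C.σ n n ∘ₗ C.τ (n + 1) ∘ₗ C.τ (n + 1)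
  τ_pow : ∀ n, (C.τ n : Module.End k (C.obj n)) ^ (n + 1) = 1

/-- Maps of cocyclic modules. -/
structure IsHom (C D : CocyclicData.{u, w} k) (f : ∀ n, C.obj n →ₗ[k] D.obj n) : Prop where
  δ : ∀ n i, i ≤ n + 1 → f (n + 1) ∘ₗ C.δ n i = D.δ n i ∘ₗ f n
  σ : ∀ n i, i ≤ n → f n ∘ₗ C.σ n i = D.σ n i ∘ₗ f (n + 1)
  τ : ∀ n, f n ∘ₗ C.τ n = D.τ n ∘ₗ f n

/-- The diagonal `C × D`, with `(C × D)ⁿ = Cⁿ ⊗ Dⁿ` and diagonal structure maps. -/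
abbrev diag (C D : CocyclicData.{u, w} k) : CocyclicData.{u, w} k where
  obj n := C.obj n ⊗[k] D.obj n
  δ n i := TensorProduct.map (C.δ n i) (D.δ n i)
  σ n i := TensorProduct.map (C.σ n i) (D.σ n i)
  τ n := TensorProduct.map (C.τ n) (D.τ n)

/-- The total space `⨁ₙ Cⁿ`. -/
abbrev Tot (C : CocyclicData.{u, w} k) : Type w := ⨁ n, C.obj n

/-- The Hochschild coboundary `b = ∑ (-1)ⁱ δᵢ` on the total space. -/
def b (C : CocyclicData.{u, w} k) : Module.End k C.Tot :=
  DirectSum.toModule k ℕ C.Tot fun n =>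
    DirectSum.lof k ℕ C.obj (n + 1) ∘ₗ ∑ i ∈ Finset.range (n + 2), (-1 : k) ^ i • C.δ n i

/-- Connes' operator `B = N σ₋₁ (1 - λ)` on the total space, where on `Cⁿ` one has `λ = (-1)ⁿ τ`,
`N = 1 + λ + ⋯ + λⁿ`, and `σ₋₁ = σₙ τ : Cⁿ⁺¹ → Cⁿ` is the extra codegeneracy. -/
def B (C : CocyclicData.{u, w} k) : Module.End k C.Tot :=
  DirectSum.toModule k ℕ C.Tot fun m =>
    match m with
    | 0 => 0
    | n + 1 =>
      DirectSum.lof k ℕ C.obj n ∘ₗ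
        (∑ i ∈ Finset.range (n + 1), ((-1 : k) ^ n • (C.τ n : Module.End k (C.obj n))) ^ i) ∘ₗ
        C.σ n n ∘ₗ C.τ (n + 1) ∘ₗ (LinearMap.id - (-1 : k) ^ (n + 1) • C.τ (n + 1))

/-- The `a`-th codegeneracy of every degree, as one operator on the total space. -/
def s (C : CocyclicData.{u, w} k) (a : ℕ) : Module.End k C.Tot :=
  DirectSum.toModule k ℕ C.Tot fun m =>
    match m with
    | 0 => 0
    | n + 1 => DirectSum.lof k ℕ C.obj n ∘ₗ C.σ n a

/-- The cyclic operators of all degrees, as one operator on the total space. -/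
def t (C : CocyclicData.{u, w} k) : Module.End k C.Tot :=
  DirectSum.toModule k ℕ C.Tot fun n => DirectSum.lof k ℕ C.obj n ∘ₗ C.τ n

/-- The sign operator, `(-1)ⁿ` on `Cⁿ`. -/
def sgn (C : CocyclicData.{u, w} k) : Module.End k C.Tot :=
  DirectSum.toModule k ℕ C.Tot fun n => (-1 : k) ^ n • DirectSum.lof k ℕ C.obj n

/-- The normalized cochains of parity `i`: the sum of the spaces `⋂ₐ ker σₐ ⊆ Cⁿ` over all
`n ≡ i mod 2`. -/
def normalized (C : CocyclicData.{u, w} k) (i : ZMod 2) : Submodule k C.Tot where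
  carrier := {x | (∀ n : ℕ, (n : ZMod 2) ≠ i → x n = 0) ∧
    ∀ n a : ℕ, a ≤ n → C.σ n a (x (n + 1)) = 0}
  add_mem' {x y} hx hy := by
    refine ⟨fun n hn => ?_, fun n a ha => ?_⟩
    · rw [DirectSum.add_apply, hx.1 n hn, hy.1 n hn, add_zero]
    · rw [DirectSum.add_apply, map_add, hx.2 n a ha, hy.2 n a ha, add_zero]
  zero_mem' := ⟨fun n _ => DirectSum.zero_apply n, fun n a _ => by
    rw [DirectSum.zero_apply, map_zero]⟩
  smul_mem' c x hx := by
    refine ⟨fun n hn => ?_, fun n a ha => ?_⟩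
    · rw [DirectSum.smul_apply, hx.1 n hn, smul_zero]
    · rw [DirectSum.smul_apply, map_smul, hx.2 n a ha, smul_zero]

lemma sgn_apply (C : CocyclicData.{u, w} k) (x : C.Tot) (n : ℕ) :
    C.sgn x n = (-1 : k) ^ n • x n := by
  induction x using DirectSum.induction_on with
  | zero => simp
  | add x y hx hy => rw [map_add, DirectSum.add_apply, hx, hy, DirectSum.add_apply, smul_add]
  | of i x =>
    have h : C.sgn (DirectSum.of C.obj i x) = (-1 : k) ^ i • DirectSum.of C.obj i x := by
      unfold sgn
      rw [← DirectSum.lof_eq_of k, DirectSum.toModule_lof, LinearMap.smul_apply]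
    rw [h, DirectSum.smul_apply]
    by_cases hin : i = n
    · subst hin; rfl
    · rw [DirectSum.of_eq_of_ne _ _ _ (Ne.symm hin), smul_zero, smul_zero]

lemma sgn_of_mem (C : CocyclicData.{u, w} k) (i : ZMod 2) (x : C.Tot)
    (hx : x ∈ C.normalized i) : C.sgn x = (-1 : k) ^ i.val • x := by
  refine DirectSum.ext_component k fun n => ?_
  change C.sgn x n = ((-1 : k) ^ i.val • x) n
  rw [sgn_apply, DirectSum.smul_apply]
  by_cases hn : (n : ZMod 2) = i
  · rw [← hn, ZMod.val_natCast, ← neg_one_pow_eq_pow_mod_two]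
  · rw [hx.1 n hn, smul_zero, smul_zero]

end CocyclicData

/-! ### Supercomplexes -/

/-- The data of a `ℤ/2`-graded complex: `N 0` and `N 1` are the even and the odd part, given as
subspaces of a space `V` that carries the differential `d` and a grading operator `sgn`. The
conditions on `d` are `SuperData.IsSupercomplex`. -/
structure SuperData (k : Type u) [Field k] where
  V : Type w
  [addCommGroup : AddCommGroup V]
  [module : Module k V]
  N : ZMod 2 → Submodule k V
  d : Module.End k V
  sgn : Module.End k V
  sgn_of_mem : ∀ i, ∀ x ∈ N i, sgn x = (-1 : k) ^ i.val • x

attribute [instance] SuperData.addCommGroup SuperData.module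

namespace SuperData

variable {k : Type u} [Field k]

/-- The differential is odd and squares to zero, i.e. `(N 0 ⇄ N 1, d)` is a supercomplex. -/
def IsSupercomplex (K : SuperData.{u, w} k) : Prop :=
  ∀ i, ∀ x ∈ K.N i, K.d x ∈ K.N (i + 1) ∧ K.d (K.d x) = 0

/-- Cocycles of parity `i`. -/
def Z (K : SuperData.{u, w} k) (i : ZMod 2) : Submodule k K.V := K.N i ⊓ LinearMap.ker K.d

/-- Coboundaries of parity `i`, i.e. the image of the part of parity `i + 1 = i - 1`. -/
def Bd (K : SuperData.{u, w} k) (i : ZMod 2) : Submodule k (K.Z i) :=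
  ((K.N (i + 1)).map K.d).comap (K.Z i).subtype

/-- The cohomology of parity `i`. -/
abbrev Coh (K : SuperData.{u, w} k) (i : ZMod 2) : Type w := K.Z i ⧸ K.Bd i

/-- `f` restricts to a map of supercomplexes. -/
def IsMap (K L : SuperData.{u, w} k) (f : K.V →ₗ[k] L.V) : Prop :=
  ∀ i, ∀ x ∈ K.N i, f x ∈ L.N i ∧ f (K.d x) = L.d (f x)

lemma IsMap.comp {K L P : SuperData.{u, w} k} {g : L.V →ₗ[k] P.V} {f : K.V →ₗ[k] L.V}
    (hg : IsMap L P g) (hf : IsMap K L f) : IsMap K P (g ∘ₗ f) := fun i x hx =>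
  ⟨(hg i _ (hf i x hx).1).1, by
    rw [LinearMap.comp_apply, LinearMap.comp_apply, (hf i x hx).2, (hg i _ (hf i x hx).1).2]⟩

lemma IsMap.mem_Z {K L : SuperData.{u, w} k} {f : K.V →ₗ[k] L.V} (hf : IsMap K L f) (i : ZMod 2) :
    ∀ x ∈ K.Z i, f x ∈ L.Z i := fun x hx =>
  ⟨(hf i x hx.1).1, LinearMap.mem_ker.2 <| by
    rw [← (hf i x hx.1).2, LinearMap.mem_ker.1 hx.2, map_zero]⟩

/-- The map `f^*` induced on cohomology, `[x] ↦ [f x]`. -/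
def IsMap.cohMap {K L : SuperData.{u, w} k} {f : K.V →ₗ[k] L.V} (hf : IsMap K L f) (i : ZMod 2) :
    K.Coh i →ₗ[k] L.Coh i :=
  Submodule.mapQ (K.Bd i) (L.Bd i) (f.restrict (hf.mem_Z i)) (by
    rintro x ⟨y, hy, hyx⟩
    exact ⟨f y, (hf _ y hy).1, by rw [← (hf _ y hy).2, hyx]; rfl⟩)

/-- The tensor product of supercomplexes: the part of parity `n` is the sum of the images of
`N i ⊗ N j`, `i + j = n`, and `d (x ⊗ y) = d x ⊗ y + (-1)^|x| x ⊗ d y`. -/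
abbrev tensor (K L : SuperData.{u, w} k) : SuperData.{u, w} k where
  V := K.V ⊗[k] L.V
  N n := ⨆ p : {p : ZMod 2 × ZMod 2 // p.1 + p.2 = n},
    LinearMap.range (TensorProduct.mapIncl (K.N p.1.1) (L.N p.1.2))
  d := TensorProduct.map K.d LinearMap.id + TensorProduct.map K.sgn L.d
  sgn := TensorProduct.map K.sgn L.sgn
  sgn_of_mem n x hx := by
    induction hx using Submodule.iSup_induction' with
    | zero => simp
    | add x y _ _ hx hy => rw [map_add, hx, hy, smul_add]
    | mem p x hx =>
      obtain ⟨z, rfl⟩ := hx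
      obtain ⟨⟨i, j⟩, rfl⟩ := p
      induction z using TensorProduct.induction_on with
      | zero => simp
      | add x y hx hy => rw [map_add, map_add, hx, hy, smul_add]
      | tmul x y =>
        have e : (-1 : k) ^ i.val * (-1 : k) ^ j.val = (-1 : k) ^ (i + j).val := by
          rw [ZMod.val_add, ← neg_one_pow_eq_pow_mod_two, pow_add]
        rw [TensorProduct.mapIncl, TensorProduct.map_tmul, TensorProduct.map_tmul,
          Submodule.subtype_apply, Submodule.subtype_apply, K.sgn_of_mem i x x.2,
          L.sgn_of_mem j y y.2, TensorProduct.smul_tmul_smul, e]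

lemma tmul_mem_N (K L : SuperData.{u, w} k) {i j : ZMod 2} {x : K.V} {y : L.V}
    (hx : x ∈ K.N i) (hy : y ∈ L.N j) {n : ZMod 2} (h : i + j = n) :
    (x ⊗ₜ[k] y : K.V ⊗[k] L.V) ∈ (K.tensor L).N n :=
  Submodule.mem_iSup_of_mem (⟨(i, j), h⟩ : {p : ZMod 2 × ZMod 2 // p.1 + p.2 = n})
    ⟨(⟨x, hx⟩ : K.N i) ⊗ₜ[k] (⟨y, hy⟩ : L.N j), rfl⟩

lemma tensor_d_tmul (K L : SuperData.{u, w} k) (x : K.V) (y : L.V) :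
    (K.tensor L).d (x ⊗ₜ[k] y : K.V ⊗[k] L.V) = K.d x ⊗ₜ[k] y + K.sgn x ⊗ₜ[k] L.d y := rfl

lemma tmul_mem_Z (K L : SuperData.{u, w} k) {i j : ZMod 2} {x : K.V} {y : L.V}
    (hx : x ∈ K.Z i) (hy : y ∈ L.Z j) {n : ZMod 2} (h : i + j = n) :
    (x ⊗ₜ[k] y : K.V ⊗[k] L.V) ∈ (K.tensor L).Z n := by
  refine ⟨tmul_mem_N K L hx.1 hy.1 h, LinearMap.mem_ker.2 ?_⟩
  rw [tensor_d_tmul, LinearMap.mem_ker.1 hx.2, LinearMap.mem_ker.1 hy.2,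
    TensorProduct.zero_tmul, TensorProduct.tmul_zero, add_zero]

/-- `x ↦ (y ↦ [x ⊗ y])` on cocycles. -/
def nablaZ (K L : SuperData.{u, w} k) (i j n : ZMod 2) (h : i + j = n) :
    K.Z i →ₗ[k] L.Z j →ₗ[k] (K.tensor L).Coh n :=
  LinearMap.mk₂ k (fun x y => Submodule.Quotient.mk
      ⟨(x : K.V) ⊗ₜ[k] (y : L.V), tmul_mem_Z K L x.2 y.2 h⟩)
    (fun x x' y => by
      rw [← Submodule.Quotient.mk_add]; congr 1
      exact Subtype.ext (TensorProduct.add_tmul _ _ _))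
    (fun c x y => by
      rw [← Submodule.Quotient.mk_smul]; congr 1)
    (fun x y y' => by
      rw [← Submodule.Quotient.mk_add]; congr 1
      exact Subtype.ext (TensorProduct.tmul_add _ _ _))
    (fun c x y => by
      rw [← Submodule.Quotient.mk_smul]; congr 1
      exact Subtype.ext (TensorProduct.tmul_smul _ _ _))

/-- The component `Hⁱ(K) ⊗ Hʲ(L) → Hⁿ(K ⊗ L)`, `[x] ⊗ [y] ↦ [x ⊗ y]`, of the Künneth map,
where `i + j = n`. -/
def nablaComponent (K L : SuperData.{u, w} k) (i j n : ZMod 2) (h : i + j = n) :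
    K.Coh i ⊗[k] L.Coh j →ₗ[k] (K.tensor L).Coh n :=
  TensorProduct.lift <|
    (K.Bd i).liftQ
      (LinearMap.flip <| (L.Bd j).liftQ (nablaZ K L i j n h).flip (by
        rintro y ⟨y', hy', hy⟩
        refine LinearMap.ext fun x => ?_
        refine (Submodule.Quotient.mk_eq_zero _).2 ?_
        have h2 : i + (j + 1) = n + 1 := by rw [← h, add_assoc]
        refine ⟨(-1 : k) ^ i.val • ((x : K.V) ⊗ₜ[k] y' : K.V ⊗[k] L.V),
          Submodule.smul_mem _ _ (tmul_mem_N K L x.2.1 hy' h2), ?_⟩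
        rw [map_smul, tensor_d_tmul, LinearMap.mem_ker.1 x.2.2, TensorProduct.zero_tmul, zero_add,
          K.sgn_of_mem i x x.2.1, hy, TensorProduct.smul_tmul', smul_smul, ← mul_pow,
          neg_one_mul, neg_neg, one_pow, one_smul]
        rfl))
      (by
        rintro x ⟨x', hx', hx⟩
        refine LinearMap.ext fun q => ?_
        obtain ⟨y, rfl⟩ := Submodule.Quotient.mk_surjective _ q
        refine (Submodule.Quotient.mk_eq_zero _).2 ?_
        have h2 : i + 1 + j = n + 1 := by rw [← h]; ring
        refine ⟨(x' ⊗ₜ[k] (y : L.V) : K.V ⊗[k] L.V), tmul_mem_N K L hx' y.2.1 h2, ?_⟩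
        rw [tensor_d_tmul, LinearMap.mem_ker.1 y.2.2, TensorProduct.tmul_zero, add_zero, hx]
        rfl)

/-- `⨁_{i + j ≡ n mod 2} Hⁱ(K) ⊗ Hʲ(L)`. -/
abbrev CohTensor (K L : SuperData.{u, w} k) (n : ZMod 2) : Type w :=
  ⨁ p : {p : ZMod 2 × ZMod 2 // p.1 + p.2 = n}, K.Coh p.1.1 ⊗[k] L.Coh p.1.2

/-- The Künneth map `∇ : ⨁_{i + j = n} Hⁱ(K) ⊗ Hʲ(L) → Hⁿ(K ⊗ L)`, `[x] ⊗ [y] ↦ [x ⊗ y]`. -/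
def nabla (K L : SuperData.{u, w} k) (n : ZMod 2) : K.CohTensor L n →ₗ[k] (K.tensor L).Coh n :=
  DirectSum.toModule k _ _ fun p => nablaComponent K L p.1.1 p.1.2 n p.2

end SuperData

namespace CocyclicData

variable {k : Type u} [Field k]

/-- The normalized periodic `(b, B)`-supercomplex
`⨁ₙ C̄²ⁿ ⇄ ⨁ₙ C̄²ⁿ⁺¹` with differential `b + B`. -/
abbrev periodic (C : CocyclicData.{u, w} k) : SuperData.{u, w} k where
  V := C.Tot
  N := C.normalized
  d := C.b + C.B
  sgn := C.sgn
  sgn_of_mem := C.sgn_of_mem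

/-- Periodic cyclic cohomology `HP⁰(C)`, `HP¹(C)`. -/
abbrev HP (C : CocyclicData.{u, w} k) (i : ZMod 2) : Type w := C.periodic.Coh i

/-- The map on total spaces induced by a family of maps `Cⁿ → Dⁿ`. -/
def totMap {C D : CocyclicData.{u, w} k} (f : ∀ n, C.obj n →ₗ[k] D.obj n) : C.Tot →ₗ[k] D.Tot :=
  DirectSum.toModule k ℕ D.Tot fun n => DirectSum.lof k ℕ D.obj n ∘ₗ f n

/-! ### Shuffles

Permutations act on `{0, …, n - 1}`, so that `σ(a)` here is `σ(a + 1) - 1` in the notation with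
permutations of `{1, …, n}`; the latter value minus one is also the index of a codegeneracy. -/

/-- `(i, n - i)`-shuffles. -/
def IsShuffle {n : ℕ} (i : ℕ) (μ : Equiv.Perm (Fin n)) : Prop :=
  (∀ a b : Fin n, a < b → b.val < i → μ a < μ b) ∧ ∀ a b : Fin n, a < b → i ≤ a.val → μ a < μ b

open Classical in
/-- The finite set of `(i, n - i)`-shuffles. -/
def shuffles (n i : ℕ) : Finset (Equiv.Perm (Fin n)) :=
  Finset.univ.filter fun μ => IsShuffle i μ

/-- `s_{μ(i+1)} ∘ ⋯ ∘ s_{μ(n)}`: removes the last `n - i` values of `μ`. -/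
def degenLast (C : CocyclicData.{u, w} k) {n : ℕ} (i : ℕ) (μ : Equiv.Perm (Fin n)) :
    Module.End k C.Tot :=
  (((List.finRange n).filter fun a => i ≤ a.val).map fun a => C.s (μ a).val).prod

/-- `s_{μ(1)} ∘ ⋯ ∘ s_{μ(i)}`: removes the first `i` values of `μ`. -/
def degenFirst (C : CocyclicData.{u, w} k) {n : ℕ} (i : ℕ) (μ : Equiv.Perm (Fin n)) :
    Module.End k C.Tot :=
  (((List.finRange n).filter fun a => a.val < i).map fun a => C.s (μ a).val).prod

/-- The shuffle map `sh = ∑_{i + j = n} ∑_μ sign(μ) s_{μ(i+1)} ⋯ s_{μ(n)} ⊗ s_{μ(1)} ⋯ s_{μ(i)}`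
in degree `n`. -/
def shTerm (C D : CocyclicData.{u, w} k) (n : ℕ) : Module.End k (C.Tot ⊗[k] D.Tot) :=
  ∑ i ∈ Finset.range (n + 1), ∑ μ ∈ shuffles n i,
    ((Equiv.Perm.sign μ : ℤ) : k) • TensorProduct.map (C.degenLast i μ) (D.degenFirst i μ)

open Classical in
/-- The cyclic shuffle map `sh'` in degree `n`. An `(i, j)`-cyclic shuffle, `i + j = n`, consists of
rotations by `p` steps of the first `i` and by `q` steps of the last `j` letters and an
`(i, j)`-shuffle `μ`, such that the first letter of the first (rotated) block comes before that of
the second one; with `a = p` and `c = i + q` this is the condition `μ a < μ c`. Its summand is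
`± s_{i-p-1} τ^{p+1} s_{μ(i+1)} ⋯ s_{μ(n)} ⊗ s_{j-q-1} τ^{q+1} s_{μ(1)} ⋯ s_{μ(i)}`, and its sign is
the product of the signs `(-1)^{p(i-1)}` and `(-1)^{q(j-1)}` of the rotations, `sign(μ)`, and
the Koszul sign `(-1)^{i-1}`. -/
def cshTerm (C D : CocyclicData.{u, w} k) (n : ℕ) : Module.End k (C.Tot ⊗[k] D.Tot) :=
  ∑ i ∈ Finset.range (n + 1), ∑ μ ∈ shuffles n i,
    ∑ a : Fin n, ∑ c : Fin n,
      if a.val < i ∧ i ≤ c.val ∧ μ a < μ c then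
        ((-1 : k) ^ (i - 1) * (-1 : k) ^ (a.val * (i - 1)) *
            (-1 : k) ^ ((c.val - i) * (n - i - 1)) * ((Equiv.Perm.sign μ : ℤ) : k)) •
          TensorProduct.map
            (C.s (i - a.val - 1) * C.t ^ (a.val + 1) * C.degenLast i μ)
            (D.s (n - i - (c.val - i) - 1) * D.t ^ (c.val - i + 1) * D.degenFirst i μ)
      else 0

/-- The map `S̃h = sh + sh'` from the total space of `C × D` to `(⨁ₚ Cᵖ) ⊗ (⨁_q D^q)`. -/
def Sh (C D : CocyclicData.{u, w} k) : (C.diag D).Tot →ₗ[k] C.Tot ⊗[k] D.Tot :=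
  DirectSum.toModule k ℕ _ fun n =>
    (shTerm C D n + cshTerm C D n) ∘ₗ
      TensorProduct.map (DirectSum.lof k ℕ C.obj n) (DirectSum.lof k ℕ D.obj n)

end CocyclicData


/-! ### Tensor powers of a Hopf algebra -/

section Hopf

variable (k : Type u) [Field k] (H : Type v) [Ring H] [HopfAlgebra k H]

open Coalgebra Bialgebra

/-- `TPow k H n = H ⊗ (H ⊗ (⋯ ⊗ H))`, with `n + 1` factors, with its tensor product algebra and
coalgebra structure. -/
def TPow : ℕ → BialgCat.{v} k
  | 0 => BialgCat.of k H
  | n + 1 => BialgCat.of k (H ⊗[k] TPow n)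

namespace TPow

variable {k H}

/-- The identification `H = H^{⊗ 1}`. -/
def one : H ≃ₐ[k] TPow k H 0 := AlgEquiv.refl (R := k) (A₁ := H)

/-- The identification `H ⊗ H^{⊗ (n + 1)} = H^{⊗ (n + 2)}`. -/
def cons (n : ℕ) : H ⊗[k] TPow k H n ≃ₐ[k] TPow k H (n + 1) :=
  AlgEquiv.refl (R := k) (A₁ := H ⊗[k] TPow k H n)

lemma ind {n : ℕ} {p : TPow k H (n + 1) → Prop} (x : TPow k H (n + 1)) (h0 : p 0)
    (hadd : ∀ x y, p x → p y → p (x + y)) (ht : ∀ h y, p (cons n (h ⊗ₜ[k] y))) : p x := by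
  obtain ⟨z, rfl⟩ := (cons n).surjective x
  induction z using TensorProduct.induction_on with
  | zero => rw [map_zero]; exact h0
  | add x y hx hy => rw [map_add]; exact hadd _ _ hx hy
  | tmul x y => exact ht x y

variable (k H)

/-- The iterated coproduct `H → H^{⊗ (n + 1)}`, `h ↦ h⁽¹⁾ ⊗ ⋯ ⊗ h⁽ⁿ⁺¹⁾`. -/
def diagonal : ∀ n, H →ₐ[k] TPow k H n
  | 0 => one.toAlgHom
  | n + 1 => (cons n).toAlgHom.comp
      ((Algebra.TensorProduct.map (AlgHom.id k H) (diagonal n)).comp (comulAlgHom k H))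

/-- `h₀ ⊗ ⋯ ⊗ hₙ ↦ h₀ ⊗ ⋯ ⊗ hᵢ⁽¹⁾ ⊗ hᵢ⁽²⁾ ⊗ ⋯ ⊗ hₙ`, for `0 ≤ i ≤ n`. -/
def comulAt : ∀ (n : ℕ) (_ : ℕ), TPow k H n →ₐ[k] TPow k H (n + 1)
  | 0, _ => (cons 0).toAlgHom.comp ((Algebra.TensorProduct.map (AlgHom.id k H) one.toAlgHom).comp
      ((comulAlgHom k H).comp one.symm.toAlgHom))
  | n + 1, 0 => (cons (n + 1)).toAlgHom.comp
      ((Algebra.TensorProduct.map (AlgHom.id k H) (cons n).toAlgHom).comp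
      ((Algebra.TensorProduct.assoc k k k H H (TPow k H n)).toAlgHom.comp
      ((Algebra.TensorProduct.map (comulAlgHom k H) (AlgHom.id k (TPow k H n))).comp
        (cons n).symm.toAlgHom)))
  | n + 1, i + 1 => (cons (n + 1)).toAlgHom.comp
      ((Algebra.TensorProduct.map (AlgHom.id k H) (comulAt n i)).comp (cons n).symm.toAlgHom)

/-- `h₀ ⊗ ⋯ ⊗ hₙ₊₁ ↦ h₀ ⊗ ⋯ ⊗ ε(hᵢ) ⊗ ⋯ ⊗ hₙ₊₁`, for `0 ≤ i ≤ n + 1`. -/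
def counitAt : ∀ (n : ℕ) (_ : ℕ), TPow k H (n + 1) →ₐ[k] TPow k H n
  | n, 0 => (Algebra.TensorProduct.lid k (TPow k H n)).toAlgHom.comp
      ((Algebra.TensorProduct.map (counitAlgHom k H) (AlgHom.id k (TPow k H n))).comp
        (cons n).symm.toAlgHom)
  | 0, _ + 1 => one.toAlgHom.comp ((Algebra.TensorProduct.rid k k H).toAlgHom.comp
      ((Algebra.TensorProduct.map (AlgHom.id k H)
        ((counitAlgHom k H).comp one.symm.toAlgHom)).comp (cons 0).symm.toAlgHom))
  | n + 1, i + 1 => (cons n).toAlgHom.comp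
      ((Algebra.TensorProduct.map (AlgHom.id k H) (counitAt n i)).comp
        (cons (n + 1)).symm.toAlgHom)

/-- `(h₀ ⊗ ⋯ ⊗ hₙ) ⊗ h ↦ h₀ ⊗ ⋯ ⊗ hₙ ⊗ h`. -/
def snoc : ∀ n, TPow k H n ⊗[k] H →ₐ[k] TPow k H (n + 1)
  | 0 => (cons 0).toAlgHom.comp
      (Algebra.TensorProduct.map one.symm.toAlgHom one.toAlgHom)
  | n + 1 => (cons (n + 1)).toAlgHom.comp
      ((Algebra.TensorProduct.map (AlgHom.id k H) (snoc n)).comp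
      ((Algebra.TensorProduct.assoc k k k H (TPow k H n) H).toAlgHom.comp
        (Algebra.TensorProduct.map (cons n).symm.toAlgHom (AlgHom.id k H))))

/-- `g ⊗ (h₀ ⊗ ⋯ ⊗ hₙ) ↦ h₁ ⊗ ⋯ ⊗ hₙ ⊗ g h₀`. -/
def twist : ∀ n, H ⊗[k] TPow k H n →ₗ[k] TPow k H n
  | 0 => one.toLinearMap ∘ₗ LinearMap.mul' k H ∘ₗ
      TensorProduct.map LinearMap.id one.symm.toLinearMap
  | n + 1 => (snoc k H n).toLinearMap ∘ₗ (TensorProduct.comm k H (TPow k H n)).toLinearMap ∘ₗ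
      TensorProduct.map (LinearMap.mul' k H) LinearMap.id ∘ₗ
      (TensorProduct.assoc k H H (TPow k H n)).symm.toLinearMap ∘ₗ
      TensorProduct.map LinearMap.id (cons n).symm.toLinearMap

variable {k H}

lemma diagonal_zero (h : H) : diagonal k H 0 h = one h := rfl

lemma diagonal_succ (n : ℕ) (h : H) : diagonal k H (n + 1) h =
    cons n (TensorProduct.map LinearMap.id (diagonal k H n).toLinearMap (comul (R := k) h)) := rfl

lemma snoc_cons (n : ℕ) (h : H) (x : TPow k H n) (g : H) :
    snoc k H (n + 1) (cons n (h ⊗ₜ[k] x) ⊗ₜ[k] g) = cons (n + 1) (h ⊗ₜ[k] snoc k H n (x ⊗ₜ[k] g)) :=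
  rfl

lemma twist_zero (g h : H) : twist k H 0 (g ⊗ₜ[k] one h) = one (g * h) := rfl

lemma twist_succ (n : ℕ) (g h : H) (x : TPow k H n) :
    twist k H (n + 1) (g ⊗ₜ[k] cons n (h ⊗ₜ[k] x)) = snoc k H n (x ⊗ₜ[k] (g * h)) := rfl

lemma comulAt_diagonal (n i : ℕ) (h : H) :
    comulAt k H n i (diagonal k H n h) = diagonal k H (n + 1) h := by
  induction n generalizing i h with
  | zero => rfl
  | succ n ih =>
    cases i with
    | zero =>
      have hc : ∀ z : H ⊗[k] H, comulAt k H (n + 1) 0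
          (cons n (TensorProduct.map LinearMap.id (diagonal k H n).toLinearMap z)) =
          cons (n + 1) (TensorProduct.map LinearMap.id ((cons n).toLinearMap ∘ₗ
            TensorProduct.map LinearMap.id (diagonal k H n).toLinearMap)
            (TensorProduct.assoc k H H H (comul.rTensor H z))) := by
        intro z
        induction z using TensorProduct.induction_on with
        | zero => simp
        | add x y hx hy => simp only [map_add, hx, hy]
        | tmul x y =>
          rw [LinearMap.rTensor_tmul]
          change cons (n + 1) (TensorProduct.map LinearMap.id (cons n).toLinearMap
            (TensorProduct.assoc k H H (TPow k H n) (comul (R := k) x ⊗ₜ[k] diagonal k H n y))) = _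
          generalize comul (R := k) x = w
          induction w using TensorProduct.induction_on with
          | zero => simp
          | add x y hx hy => simp only [map_add, hx, hy, TensorProduct.add_tmul]
          | tmul a b => rfl
      rw [diagonal_succ, hc, coassoc_apply, diagonal_succ (n + 1)]
      congr 1
      rw [LinearMap.lTensor, ← LinearMap.comp_apply, ← TensorProduct.map_comp]
      rfl
    | succ i =>
      rw [diagonal_succ (n + 1)]
      have hc : ∀ z : H ⊗[k] H, comulAt k H (n + 1) (i + 1)
          (cons n (TensorProduct.map LinearMap.id (diagonal k H n).toLinearMap z)) =
          cons (n + 1) (TensorProduct.map LinearMap.id (diagonal k H (n + 1)).toLinearMap z) := by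
        intro z
        induction z using TensorProduct.induction_on with
        | zero => simp
        | add x y hx hy => simp only [map_add, hx, hy]
        | tmul x y =>
          change cons (n + 1) (x ⊗ₜ[k] comulAt k H n i (diagonal k H n y)) = _
          rw [ih]; rfl
      exact hc _

lemma counitAt_diagonal (n i : ℕ) (h : H) :
    counitAt k H n i (diagonal k H (n + 1) h) = diagonal k H n h := by
  induction n generalizing i h with
  | zero =>
    cases i with
    | zero =>
      have hc : ∀ z : H ⊗[k] H, counitAt k H 0 0
          (cons 0 (TensorProduct.map LinearMap.id (diagonal k H 0).toLinearMap z)) =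
          one (TensorProduct.lid k H (counit.rTensor H z)) := by
        intro z
        induction z using TensorProduct.induction_on with
        | zero => simp
        | add x y hx hy => simp only [map_add, hx, hy]
        | tmul x y => rfl
      rw [diagonal_succ, hc, rTensor_counit_comul, TensorProduct.lid_tmul, one_smul]
      rfl
    | succ i =>
      have hc : ∀ z : H ⊗[k] H, counitAt k H 0 (i + 1)
          (cons 0 (TensorProduct.map LinearMap.id (diagonal k H 0).toLinearMap z)) =
          one (TensorProduct.rid k H (counit.lTensor H z)) := by
        intro z
        induction z using TensorProduct.induction_on with
        | zero => simp
        | add x y hx hy => simp only [map_add, hx, hy]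
        | tmul x y => rfl
      rw [diagonal_succ, hc, lTensor_counit_comul, TensorProduct.rid_tmul, one_smul]
      rfl
  | succ n ih =>
    cases i with
    | zero =>
      have hc : ∀ z : H ⊗[k] H, counitAt k H (n + 1) 0
          (cons (n + 1) (TensorProduct.map LinearMap.id (diagonal k H (n + 1)).toLinearMap z)) =
          diagonal k H (n + 1) (TensorProduct.lid k H (counit.rTensor H z)) := by
        intro z
        induction z using TensorProduct.induction_on with
        | zero => simp
        | add x y hx hy => simp only [map_add, hx, hy]
        | tmul x y =>
          rw [LinearMap.rTensor_tmul, TensorProduct.lid_tmul, map_smul]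
          rfl
      rw [diagonal_succ, hc, rTensor_counit_comul, TensorProduct.lid_tmul, one_smul]
    | succ i =>
      have hc : ∀ z : H ⊗[k] H, counitAt k H (n + 1) (i + 1)
          (cons (n + 1) (TensorProduct.map LinearMap.id (diagonal k H (n + 1)).toLinearMap z)) =
          cons n (TensorProduct.map LinearMap.id (diagonal k H n).toLinearMap z) := by
        intro z
        induction z using TensorProduct.induction_on with
        | zero => simp
        | add x y hx hy => simp only [map_add, hx, hy]
        | tmul x y =>
          change cons n (x ⊗ₜ[k] counitAt k H n i (diagonal k H (n + 1) y)) = _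
          rw [ih]; rfl
      rw [diagonal_succ (n + 1), hc, diagonal_succ]

lemma snoc_diagonal (n : ℕ) (h : H) : diagonal k H (n + 1) h =
    snoc k H n (TensorProduct.map (diagonal k H n).toLinearMap LinearMap.id
      (comul (R := k) h)) := by
  induction n generalizing h with
  | zero =>
    rw [diagonal_succ]
    generalize comul (R := k) h = z
    induction z using TensorProduct.induction_on with
    | zero => simp
    | add x y hx hy => simp only [map_add, hx, hy]
    | tmul x y => rfl
  | succ n ih =>
    have hc : ∀ z : H ⊗[k] H, snoc k H (n + 1)
        (TensorProduct.map (diagonal k H (n + 1)).toLinearMap LinearMap.id z) =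
        cons (n + 1) (TensorProduct.map LinearMap.id ((snoc k H n).toLinearMap ∘ₗ
          TensorProduct.map (diagonal k H n).toLinearMap LinearMap.id)
          (TensorProduct.assoc k H H H (comul.rTensor H z))) := by
      intro z
      induction z using TensorProduct.induction_on with
      | zero => simp
      | add x y hx hy => simp only [map_add, hx, hy]
      | tmul x y =>
        rw [LinearMap.rTensor_tmul, TensorProduct.map_tmul, AlgHom.toLinearMap_apply, diagonal_succ]
        generalize comul (R := k) x = w
        induction w using TensorProduct.induction_on with
        | zero => simp
        | add x y hx hy => simp only [map_add, hx, hy, TensorProduct.add_tmul]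
        | tmul a b => rfl
    rw [hc, coassoc_apply, diagonal_succ (n + 1)]
    congr 1
    have e : (diagonal k H (n + 1)).toLinearMap = ((snoc k H n).toLinearMap ∘ₗ
        TensorProduct.map (diagonal k H n).toLinearMap LinearMap.id) ∘ₗ comul :=
      LinearMap.ext ih
    refine Eq.symm ?_
    rw [e, LinearMap.lTensor, ← LinearMap.comp_apply, ← TensorProduct.map_comp]
    rfl

/-- `∑ (h⁽¹⁾ ⊗ ⋯ ⊗ h⁽ⁿ⁺²⁾) (x ⊗ S(h⁽ⁿ⁺³⁾) c) = (h⁽¹⁾ ⊗ ⋯ ⊗ h⁽ⁿ⁺¹⁾) x ⊗ c`. -/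
lemma sum_diagonal_mul_snoc (n : ℕ) (x : TPow k H n) (c h : H) :
    ∑ p ∈ (ℛ k h).index, diagonal k H (n + 1) ((ℛ k h).left p) *
      snoc k H n (x ⊗ₜ[k] (HopfAlgebra.antipode k ((ℛ k h).right p) * c)) =
    snoc k H n ((diagonal k H n h * x) ⊗ₜ[k] c) := by
  let G : H ⊗[k] (H ⊗[k] H) →ₗ[k] TPow k H (n + 1) :=
    (snoc k H n).toLinearMap ∘ₗ
      TensorProduct.map (LinearMap.mulRight k x ∘ₗ (diagonal k H n).toLinearMap)
        (LinearMap.mulRight k c ∘ₗ LinearMap.mul' k H ∘ₗ (HopfAlgebra.antipode k).lTensor H)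
  have h1 : ∀ a b : H, diagonal k H (n + 1) a *
      snoc k H n (x ⊗ₜ[k] (HopfAlgebra.antipode k b * c)) =
      G (TensorProduct.assoc k H H H (comul.rTensor H (a ⊗ₜ[k] b))) := by
    intro a b
    rw [snoc_diagonal, LinearMap.rTensor_tmul]
    generalize comul (R := k) a = w
    induction w using TensorProduct.induction_on with
    | zero => simp
    | add x y hx hy => simp only [map_add, TensorProduct.add_tmul, add_mul, hx, hy]
    | tmul p q =>
      rw [TensorProduct.map_tmul, ← map_mul, Algebra.TensorProduct.tmul_mul_tmul]
      simp [G, mul_assoc]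
  simp_rw [h1]
  rw [← map_sum, ← map_sum, ← map_sum, (ℛ k h).eq, coassoc_apply]
  have h2 : ∀ z : H ⊗[k] H, G (comul.lTensor H z) =
      snoc k H n (TensorProduct.map (LinearMap.mulRight k x ∘ₗ (diagonal k H n).toLinearMap)
        (LinearMap.mulRight k c ∘ₗ Algebra.linearMap k H) (counit.lTensor H z)) := by
    intro z
    induction z using TensorProduct.induction_on with
    | zero => simp
    | add x y hx hy => simp only [map_add, hx, hy]
    | tmul p q =>
      simp [G, LinearMap.lTensor_tmul]
  rw [h2, lTensor_counit_comul]
  simp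

lemma sum_diagonal_mul_twist (n : ℕ) (x : TPow k H n) (g h : H) :
    twist k H n (g ⊗ₜ[k] (diagonal k H n h * x)) =
      ∑ p ∈ (ℛ k h).index, ∑ q ∈ (ℛ k ((ℛ k h).right p)).index,
        diagonal k H n ((ℛ k ((ℛ k h).right p)).left q) * twist k H n
          ((HopfAlgebra.antipode k ((ℛ k ((ℛ k h).right p)).right q) * (g * (ℛ k h).left p)) ⊗ₜ[k]
            x) := by
  cases n with
  | zero =>
    obtain ⟨y, rfl⟩ := (one (k := k) (H := H)).surjective x
    simp only [diagonal_zero, ← map_mul, twist_zero]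
    simp only [← map_sum]
    congr 1
    have h1 : ∀ z c : H, ∑ q ∈ (ℛ k z).index,
        (ℛ k z).left q * (HopfAlgebra.antipode k ((ℛ k z).right q) * c) =
        counit (R := k) z • c := by
      intro z c
      simp only [← mul_assoc]
      rw [← Finset.sum_mul, HopfAlgebra.sum_mul_antipode_eq_smul, smul_mul_assoc, one_mul]
    simp only [mul_assoc, h1]
    have h2 : h = ∑ p ∈ (ℛ k h).index, counit (R := k) ((ℛ k h).right p) • (ℛ k h).left p := by
      have := congrArg (TensorProduct.rid k H) (sum_tmul_counit_eq (R := k) (ℛ k h))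
      simp only [map_sum, TensorProduct.rid_tmul, one_smul] at this
      exact this.symm
    conv_lhs => rw [h2]
    simp only [Finset.sum_mul, Finset.mul_sum, smul_mul_assoc, mul_smul_comm]
  | succ n =>
    induction x using ind with
    | h0 => simp
    | hadd x y hx hy =>
      simp only [mul_add, TensorProduct.tmul_add, map_add, hx, hy, Finset.sum_add_distrib]
    | ht h₀ y =>
      simp only [twist_succ, mul_assoc, sum_diagonal_mul_snoc]
      rw [diagonal_succ, ← map_mul]
      conv_lhs => rw [← (ℛ k h).eq]
      simp only [map_sum, Finset.sum_mul, TensorProduct.tmul_sum, TensorProduct.map_tmul,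
        Algebra.TensorProduct.tmul_mul_tmul, LinearMap.id_apply, AlgHom.toLinearMap_apply,
        twist_succ]

end TPow

/-! ### Stable anti-Yetter–Drinfeld modules -/

variable (M : Type w) [AddCommGroup M] [Module k M] [Module Hᵐᵒᵖ M] [IsScalarTower k Hᵐᵒᵖ M]

/-- The right action of `H` on `M`, as a linear map `h ↦ (m ↦ m h)`. -/
def ract : H →ₗ[k] Module.End k M where
  toFun h :=
    { toFun := fun m => m <• h
      map_add' := fun m m' => smul_add _ m m'
      map_smul' := fun c m => smul_comm _ c m }
  map_add' h h' := LinearMap.ext fun m => by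
    change MulOpposite.op (h + h') • m = _
    rw [MulOpposite.op_add, add_smul]; rfl
  map_smul' c h := LinearMap.ext fun m => by
    change MulOpposite.op (c • h) • m = _
    rw [MulOpposite.op_smul, smul_assoc]; rfl

lemma ract_apply (h : H) (m : M) : ract k H M h m = m <• h := rfl

/-- The linear map `a ⊗ (b ⊗ c) ↦ (g ⊗ m ↦ S(c) g a ⊗ m b)`. -/
def aydMap : H ⊗[k] (H ⊗[k] H) →ₗ[k] Module.End k (H ⊗[k] M) :=
  TensorProduct.lift <| LinearMap.mk₂ k
    (fun a z => TensorProduct.lift (LinearMap.mk₂ k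
      (fun b c => TensorProduct.map
        (LinearMap.mulLeft k (HopfAlgebra.antipode k c) ∘ₗ LinearMap.mulRight k a) (ract k H M b))
      (fun b b' c => by simp [TensorProduct.map_add_right])
      (fun r b c => by simp [TensorProduct.map_smul_right])
      (fun b c c' => by ext; simp [add_mul, TensorProduct.add_tmul])
      (fun r b c => by ext; simp [TensorProduct.smul_tmul'])) z)
    (fun a a' z => by
      induction z using TensorProduct.induction_on with
      | zero => simp
      | add x y hx hy => simp only [map_add, hx, hy]; abel
      | tmul b c => ext; simp [mul_add, TensorProduct.add_tmul])
    (fun r a z => by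
      induction z using TensorProduct.induction_on with
      | zero => simp
      | add x y hx hy => simp only [map_add, hx, hy, smul_add]
      | tmul b c => ext; simp [TensorProduct.smul_tmul'])
    (fun a z z' => by rw [map_add])
    (fun r a z => by rw [map_smul])

lemma aydMap_tmul (a b c g : H) (m : M) :
    aydMap k H M (a ⊗ₜ[k] (b ⊗ₜ[k] c)) (g ⊗ₜ[k] m) =
      (HopfAlgebra.antipode k c * (g * a)) ⊗ₜ[k] (m <• b) := rfl

/-- A stable anti-Yetter–Drinfeld structure on the right `H`-module `M`: a left coaction
`m ↦ m⁽⁻¹⁾ ⊗ m⁽⁰⁾` with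
`(m h)⁽⁻¹⁾ ⊗ (m h)⁽⁰⁾ = S(h⁽³⁾) m⁽⁻¹⁾ h⁽¹⁾ ⊗ m⁽⁰⁾ h⁽²⁾` and `m⁽⁰⁾ m⁽⁻¹⁾ = m`. -/
class SAYDModule where
  coact : M →ₗ[k] H ⊗[k] M
  coassoc : ∀ m, TensorProduct.assoc k H H M (comul.rTensor M (coact m)) =
    coact.lTensor H (coact m)
  counit : ∀ m, TensorProduct.lid k M (counit.rTensor M (coact m)) = m
  ayd : ∀ (m : M) (h : H), coact (m <• h) =
    aydMap k H M (comul.lTensor H (comul (R := k) h)) (coact m)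
  stable : ∀ m, TensorProduct.lift (ract k H M) (coact m) = m

/-! ### The cocyclic module `C(H, M)` -/

/-- The relations `m h ⊗ x = m ⊗ (h⁽¹⁾ ⊗ ⋯ ⊗ h⁽ⁿ⁺¹⁾) x` that define
`M ⊗_H H^{⊗ (n + 1)}`, where `H` acts diagonally on `H^{⊗ (n + 1)}`. -/
def balance (n : ℕ) : Submodule k (M ⊗[k] TPow k H n) :=
  Submodule.span k {z | ∃ (m : M) (h : H) (x : TPow k H n),
    z = (m <• h) ⊗ₜ[k] x - m ⊗ₜ[k] (TPow.diagonal k H n h * x)}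

/-- `Cⁿ(H, M) = M ⊗_H H^{⊗ (n + 1)}`. -/
abbrev Cochain (n : ℕ) : Type (max v w) := (M ⊗[k] TPow k H n) ⧸ balance k H M n

variable {k H M}

lemma mk_balance {n : ℕ} (m : M) (h : H) (x : TPow k H n) :
    (balance k H M n).mkQ ((m <• h) ⊗ₜ[k] x) =
      (balance k H M n).mkQ (m ⊗ₜ[k] (TPow.diagonal k H n h * x)) := by
  rw [← sub_eq_zero, ← map_sub]
  exact (Submodule.Quotient.mk_eq_zero _).2 (Submodule.subset_span ⟨m, h, x, rfl⟩)

lemma balance_le_ker {n : ℕ} {V : Type*} [AddCommGroup V] [Module k V]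
    (f : M ⊗[k] TPow k H n →ₗ[k] V)
    (hf : ∀ m h x, f ((m <• h) ⊗ₜ[k] x) = f (m ⊗ₜ[k] (TPow.diagonal k H n h * x))) :
    balance k H M n ≤ LinearMap.ker f := by
  refine Submodule.span_le.2 ?_
  rintro _ ⟨m, h, x, rfl⟩
  exact LinearMap.mem_ker.2 (by rw [map_sub, hf, sub_self])

/-- The map `m ⊗_H x ↦ m ⊗_H f x` for an algebra map `f` compatible with the diagonals. -/
def Cochain.map {n n' : ℕ} (f : TPow k H n →ₐ[k] TPow k H n')
    (hf : ∀ h, f (TPow.diagonal k H n h) = TPow.diagonal k H n' h) :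
    Cochain k H M n →ₗ[k] Cochain k H M n' :=
  (balance k H M n).liftQ
    ((balance k H M n').mkQ ∘ₗ TensorProduct.map LinearMap.id f.toLinearMap)
    (balance_le_ker _ fun m h x => by
      simp only [LinearMap.comp_apply, TensorProduct.map_tmul, LinearMap.id_apply,
        AlgHom.toLinearMap_apply, map_mul, hf]
      exact mk_balance m h _)

section SAYD

variable [SAYDModule k H M]

/-- `m ⊗ h₀ ⊗ ⋯ ⊗ hₙ ↦ m⁽⁰⁾ ⊗ h₁ ⊗ ⋯ ⊗ hₙ ⊗ m⁽⁻¹⁾ h₀` on `M ⊗ H^{⊗ (n + 1)}`. -/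
def tauPre (n : ℕ) : M ⊗[k] TPow k H n →ₗ[k] M ⊗[k] TPow k H n :=
  TensorProduct.map LinearMap.id (TPow.twist k H n) ∘ₗ
    (TensorProduct.assoc k M H (TPow k H n)).toLinearMap ∘ₗ
    TensorProduct.map ((TensorProduct.comm k H M).toLinearMap ∘ₗ SAYDModule.coact) LinearMap.id

/-- The part of `tauPre` after the coaction, `g ⊗ m ↦ [m ⊗ (h₁ ⊗ ⋯ ⊗ hₙ ⊗ g h₀)]`. -/
def tauAux (n : ℕ) (x : TPow k H n) : H ⊗[k] M →ₗ[k] Cochain k H M n :=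
  (balance k H M n).mkQ ∘ₗ TensorProduct.map LinearMap.id (TPow.twist k H n) ∘ₗ
    (TensorProduct.assoc k M H (TPow k H n)).toLinearMap ∘ₗ
    (TensorProduct.mk k (M ⊗[k] H) (TPow k H n)).flip x ∘ₗ (TensorProduct.comm k H M).toLinearMap

lemma tauAux_tmul (n : ℕ) (x : TPow k H n) (g : H) (m : M) :
    tauAux n x (g ⊗ₜ[k] m) = (balance k H M n).mkQ (m ⊗ₜ[k] TPow.twist k H n (g ⊗ₜ[k] x)) := rfl

lemma mk_tauPre (n : ℕ) (x : TPow k H n) (m : M) :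
    (balance k H M n).mkQ (tauPre n (m ⊗ₜ[k] x)) =
      tauAux n x (SAYDModule.coact (k := k) (H := H) m) := rfl

lemma tauAux_aydMap (n : ℕ) (x : TPow k H n) (h : H) (p : H ⊗[k] M) :
    tauAux n x (aydMap k H M (comul.lTensor H (comul (R := k) h)) p) =
      tauAux n (TPow.diagonal k H n h * x) p := by
  induction p using TensorProduct.induction_on with
  | zero => simp
  | add x y hx hy => simp only [map_add, hx, hy]
  | tmul g m =>
    rw [tauAux_tmul, TPow.sum_diagonal_mul_twist, ← (ℛ k h).eq]
    simp only [map_sum, LinearMap.lTensor_tmul, LinearMap.sum_apply, TensorProduct.tmul_sum]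
    refine Finset.sum_congr rfl fun p _ => ?_
    conv_lhs => rw [← (ℛ k ((ℛ k h).right p)).eq]
    simp only [map_sum, LinearMap.sum_apply, TensorProduct.tmul_sum, aydMap_tmul, tauAux_tmul,
      mk_balance]

/-- The cyclic operator
`m ⊗_H h₀ ⊗ ⋯ ⊗ hₙ ↦ m⁽⁰⁾ ⊗_H h₁ ⊗ ⋯ ⊗ hₙ ⊗ m⁽⁻¹⁾ h₀`. -/
def tau (n : ℕ) : Cochain k H M n →ₗ[k] Cochain k H M n :=
  (balance k H M n).liftQ ((balance k H M n).mkQ ∘ₗ tauPre n)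
    (balance_le_ker _ fun m h x => by
      rw [LinearMap.comp_apply, LinearMap.comp_apply, mk_tauPre, mk_tauPre, SAYDModule.ayd,
        tauAux_aydMap])

variable (k H M)

/-- The cocyclic module `C(H, M)`. Its last coface
`m ⊗_H h₀ ⊗ ⋯ ⊗ hₙ ↦ m⁽⁰⁾ ⊗_H h₀⁽²⁾ ⊗ h₁ ⊗ ⋯ ⊗ hₙ ⊗ m⁽⁻¹⁾ h₀⁽¹⁾` is the composite of `δ₀` and of
the cyclic operator. -/
abbrev hopfCocyclic : CocyclicData.{u, max v w} k where
  obj := Cochain k H M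
  δ n i := if i ≤ n then Cochain.map (TPow.comulAt k H n i) (TPow.comulAt_diagonal n i)
    else tau (n + 1) ∘ₗ Cochain.map (TPow.comulAt k H n 0) (TPow.comulAt_diagonal n 0)
  σ n i := Cochain.map (TPow.counitAt k H n (i + 1)) (TPow.counitAt_diagonal n (i + 1))
  τ n := tau n

end SAYD

/-! ### The map `ρ` -/

/-- Compatibility of `ψ : M → M ⊗ M` with the coactions, `(Δ ⊗ ψ) ∘ φ_M = φ_{M ⊗ M} ∘ ψ`, where
`φ_{M ⊗ M}(m ⊗ n) = (m⁽⁻¹⁾ ⊗ n⁽⁻¹⁾) ⊗ (m⁽⁰⁾ ⊗ n⁽⁰⁾)`. -/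
def CoactCompatible [SAYDModule k H M] (ψ : M →ₗ[k] M ⊗[k] M) : Prop :=
  TensorProduct.map (comul (R := k) (A := H)) ψ ∘ₗ SAYDModule.coact =
    (TensorProduct.tensorTensorTensorComm k H M H M).toLinearMap ∘ₗ
      TensorProduct.map SAYDModule.coact SAYDModule.coact ∘ₗ ψ

variable (k H M) in
/-- The right action of `H ⊗ H` on `M ⊗ M`, `(m ⊗ n) (a ⊗ b) = m a ⊗ n b`. -/
def ract₂ : H ⊗[k] H →ₗ[k] Module.End k (M ⊗[k] M) :=
  TensorProduct.homTensorHomMap (RingHom.id k) M M M M ∘ₗ TensorProduct.map (ract k H M) (ract k H M)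

lemma ract₂_tmul (a c : H) (m m' : M) :
    ract₂ k H M (a ⊗ₜ[k] c) (m ⊗ₜ[k] m') = (m <• a) ⊗ₜ[k] (m' <• c) := rfl

variable (k H) in
/-- Compatibility of `ψ : M → M ⊗ M` with the actions, `ψ(m h) = ψ(m) Δ(h)`. -/
def ActCompatible (ψ : M →ₗ[k] M ⊗[k] M) : Prop :=
  ∀ (m : M) (h : H), ψ (m <• h) = ract₂ k H M (comul (R := k) h) (ψ m)

/-- `m ⊗ h₀ ⊗ ⋯ ⊗ hₙ ↦ (m₍₁₎ ⊗_H h₀⁽¹⁾ ⊗ ⋯ ⊗ hₙ⁽¹⁾) ⊗ (m₍₂₎ ⊗_H h₀⁽²⁾ ⊗ ⋯ ⊗ hₙ⁽²⁾)`, where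
`ψ(m) = m₍₁₎ ⊗ m₍₂₎`. -/
def rhoPre (ψ : M →ₗ[k] M ⊗[k] M) (n : ℕ) :
    M ⊗[k] TPow k H n →ₗ[k] Cochain k H M n ⊗[k] Cochain k H M n :=
  TensorProduct.map (balance k H M n).mkQ (balance k H M n).mkQ ∘ₗ
    (TensorProduct.tensorTensorTensorComm k M M (TPow k H n) (TPow k H n)).toLinearMap ∘ₗ
    TensorProduct.map ψ comul

lemma comul_diagonal [IsCocomm k H] (n : ℕ) (h : H) :
    comul (R := k) (TPow.diagonal k H n h) =
      TensorProduct.map (TPow.diagonal k H n).toLinearMap (TPow.diagonal k H n).toLinearMap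
        (comul (R := k) h) := by
  suffices hf : ∃ f : H →ₐc[k] TPow k H n, ∀ h, f h = TPow.diagonal k H n h by
    obtain ⟨f, hf⟩ := hf
    have e : (TPow.diagonal k H n).toLinearMap = (f : H →ₗ[k] TPow k H n) :=
      LinearMap.ext fun h => (hf h).symm
    rw [← hf, e]
    exact (CoalgHomClass.map_comp_comul_apply f h).symm
  clear h
  induction n with
  | zero => exact ⟨BialgHom.id k H, fun h => rfl⟩
  | succ n ih =>
    obtain ⟨f, hf⟩ := ih
    refine ⟨(Bialgebra.TensorProduct.map (BialgHom.id k H) f).comp (comulBialgHom k H),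
      fun h => ?_⟩
    have e : (TPow.diagonal k H n).toLinearMap = (f : H →ₗ[k] TPow k H n) :=
      LinearMap.ext fun h => (hf h).symm
    rw [TPow.diagonal_succ, e]
    rfl

/-- The map `ρₙ = Ωₙ ∘ (ψ ⊗ Δ^{⊗ (n + 1)}) : Cⁿ(H, M) → Cⁿ(H, M) ⊗ Cⁿ(H, M)`,
`m ⊗_H h₀ ⊗ ⋯ ⊗ hₙ ↦ (m₍₁₎ ⊗_H h₀⁽¹⁾ ⊗ ⋯ ⊗ hₙ⁽¹⁾) ⊗ (m₍₂₎ ⊗_H h₀⁽²⁾ ⊗ ⋯ ⊗ hₙ⁽²⁾)`. -/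
def rho [IsCocomm k H] (ψ : M →ₗ[k] M ⊗[k] M) (hψ : ActCompatible k H ψ) (n : ℕ) :
    Cochain k H M n →ₗ[k] Cochain k H M n ⊗[k] Cochain k H M n :=
  (balance k H M n).liftQ (rhoPre ψ n) (balance_le_ker _ fun m h x => by
    simp only [rhoPre, LinearMap.comp_apply, TensorProduct.map_tmul, hψ m h, Bialgebra.comul_mul,
      comul_diagonal]
    generalize comul (R := k) h = z
    generalize comul (R := k) x = y
    generalize ψ m = p
    induction z using TensorProduct.induction_on with
    | zero => simp
    | add z z' hz hz' =>
      simp only [map_add, LinearMap.add_apply, add_mul, TensorProduct.add_tmul,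
        TensorProduct.tmul_add, hz, hz']
    | tmul a c =>
      induction p using TensorProduct.induction_on with
      | zero => simp
      | add p p' hp hp' => simp only [map_add, TensorProduct.add_tmul, hp, hp']
      | tmul m m' =>
        induction y using TensorProduct.induction_on with
        | zero => simp
        | add y y' hy hy' => simp only [map_add, mul_add, TensorProduct.tmul_add, hy, hy']
        | tmul y y' =>
          rw [ract₂_tmul, TensorProduct.map_tmul, Algebra.TensorProduct.tmul_mul_tmul]
          simp only [LinearEquiv.coe_coe, TensorProduct.tensorTensorTensorComm_tmul,
            TensorProduct.map_tmul, AlgHom.toLinearMap_apply]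
          rw [mk_balance, mk_balance])

end Hopf

end HopfCyclic

namespace HopfCyclic

universe u v w

/-! ### The Künneth theorem for supercomplexes -/

namespace SuperData

variable {k : Type u} [Field k] (K L : SuperData.{u, w} k)

lemma neg_one_pow_val_add_one (i : ZMod 2) :
    (-1 : k) ^ (i + 1).val = -(-1 : k) ^ i.val := by
  rw [ZMod.val_add, ← neg_one_pow_eq_pow_mod_two, pow_add, ZMod.val_one, pow_one, mul_neg_one]

lemma eq_add_one_of_ne : ∀ {i j : ZMod 2}, j ≠ i → i = j + 1 := by decide

/-- The projection to the part of parity `i`. -/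
def parityProj (i : ZMod 2) : Module.End k K.V :=
  (2 : k)⁻¹ • (LinearMap.id + (-1 : k) ^ i.val • K.sgn)

lemma parityProj_of_mem [CharZero k] {i : ZMod 2} {x : K.V} (hx : x ∈ K.N i) :
    K.parityProj i x = x := by
  have h : (2 : k) ≠ 0 := two_ne_zero
  rw [parityProj, LinearMap.smul_apply, LinearMap.add_apply, LinearMap.smul_apply,
    K.sgn_of_mem i x hx, smul_smul, ← mul_pow, neg_one_mul, neg_neg, one_pow, one_smul,
    LinearMap.id_apply, ← two_smul k x, smul_smul, inv_mul_cancel₀ h, one_smul]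

lemma parityProj_of_mem_add_one {i : ZMod 2} {x : K.V} (hx : x ∈ K.N (i + 1)) :
    K.parityProj i x = 0 := by
  rw [parityProj, LinearMap.smul_apply, LinearMap.add_apply, LinearMap.smul_apply,
    K.sgn_of_mem _ x hx, neg_one_pow_val_add_one, smul_smul, mul_neg, ← mul_pow, neg_one_mul,
    neg_neg, one_pow, neg_one_smul, LinearMap.id_apply, add_neg_cancel, smul_zero]

lemma exists_homotopy_component (i : ZMod 2) : ∃ h : Module.End k K.V,
    (∀ x, h x ∈ K.N (i + 1)) ∧ ∀ y ∈ K.N (i + 1), K.d (h (K.d y)) = K.d y := by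
  let f : K.N (i + 1) →ₗ[k] K.V := K.d ∘ₗ (K.N (i + 1)).subtype
  obtain ⟨e, he⟩ := f.rangeRestrict.exists_rightInverse_of_surjective f.range_rangeRestrict
  obtain ⟨g, hg⟩ := e.exists_extend
  refine ⟨(K.N (i + 1)).subtype ∘ₗ g, fun x => (g x).2, fun y hy => ?_⟩
  have h1 : g (K.d y) = e (f.rangeRestrict ⟨y, hy⟩) :=
    LinearMap.congr_fun hg (f.rangeRestrict ⟨y, hy⟩)
  have h2 := congrArg Subtype.val (LinearMap.congr_fun he (f.rangeRestrict ⟨y, hy⟩))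
  change K.d (g (K.d y)) = K.d y
  rw [h1]
  exact h2

lemma exists_homotopy [CharZero k] : ∃ h : Module.End k K.V,
    ∀ i, (∀ x ∈ K.N i, h x ∈ K.N (i + 1)) ∧ ∀ y ∈ K.N i, K.d y ∈ K.N (i + 1) →
      K.d (h (K.d y)) = K.d y := by
  choose h h1 h2 using K.exists_homotopy_component
  have two : ∀ i : ZMod 2, i + 1 + 1 = i := by decide
  have key : ∀ i, ∀ x ∈ K.N i, (∑ j : ZMod 2, h j ∘ₗ K.parityProj j) x = h i x := by
    intro i x hx
    rw [LinearMap.sum_apply, Finset.sum_eq_single i]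
    · rw [LinearMap.comp_apply, parityProj_of_mem K hx]
    · intro j _ hj
      have : i = j + 1 := eq_add_one_of_ne hj
      rw [LinearMap.comp_apply, parityProj_of_mem_add_one K (this ▸ hx), map_zero]
    · exact fun hi => absurd (Finset.mem_univ i) hi
  refine ⟨∑ j : ZMod 2, h j ∘ₗ K.parityProj j, fun i => ⟨fun x hx => ?_, fun y hy hdy => ?_⟩⟩
  · rw [key i x hx]
    exact h1 i x
  · rw [key _ _ hdy]
    exact h2 (i + 1) y (by rwa [two])

variable {K L}

lemma IsSupercomplex.exists_contraction [CharZero k] (hK : K.IsSupercomplex) :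
    ∃ h P : Module.End k K.V, (∀ i, ∀ x ∈ K.N i, h x ∈ K.N (i + 1)) ∧
      (∀ x, P x = x - K.d (h x) - h (K.d x)) ∧ (∀ i, ∀ x ∈ K.N i, P x ∈ K.Z i) ∧
      ∀ i, ∀ x ∈ K.N i, P (K.d x) = 0 := by
  obtain ⟨h, hh⟩ := K.exists_homotopy
  have two : ∀ i : ZMod 2, i + 1 + 1 = i := by decide
  refine ⟨h, LinearMap.id - K.d ∘ₗ h - h ∘ₗ K.d, fun i x hx => (hh i).1 x hx, fun x => rfl,
    fun i x hx => ⟨?_, ?_⟩, fun i x hx => ?_⟩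
  · refine Submodule.sub_mem _ (Submodule.sub_mem _ hx ?_) ?_
    · have := (hK _ _ ((hh i).1 x hx)).1
      rwa [two] at this
    · have := (hh _).1 _ (hK i x hx).1
      rwa [two] at this
  · rw [SetLike.mem_coe, LinearMap.mem_ker, LinearMap.sub_apply, LinearMap.sub_apply, map_sub, map_sub]
    simp only [LinearMap.id_apply, LinearMap.comp_apply]
    rw [(hK _ _ ((hh i).1 x hx)).2, (hh i).2 x hx (hK i x hx).1]
    simp
  · rw [LinearMap.sub_apply, LinearMap.sub_apply]
    simp only [LinearMap.id_apply, LinearMap.comp_apply]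
    rw [(hK i x hx).2, (hh i).2 x hx (hK i x hx).1]
    simp

lemma tensor_induction {n : ZMod 2} 
    {p : ∀ z : K.V ⊗[k] L.V, z ∈ (K.tensor L).N n → Prop} (h0 : p 0 (Submodule.zero_mem _))
    (hadd : ∀ x y hx hy, p x hx → p y hy → p (x + y) (Submodule.add_mem _ hx hy))
    (ht : ∀ i j (h : i + j = n), ∀ x (hx : x ∈ K.N i), ∀ y (hy : y ∈ L.N j),
      p (x ⊗ₜ[k] y) (tmul_mem_N K L hx hy h))
    {z : K.V ⊗[k] L.V} (hz : z ∈ (K.tensor L).N n) : p z hz := by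
  induction hz using Submodule.iSup_induction' with
  | zero => exact h0
  | add x y h h' hx hy => exact hadd x y h h' hx hy
  | mem q x hx =>
    obtain ⟨⟨i, j⟩, hij⟩ := q
    obtain ⟨z, rfl⟩ := hx
    induction z using TensorProduct.induction_on with
    | zero => simpa only [map_zero] using h0
    | add x y hx hy => simpa only [map_add] using hadd _ _ _ _ hx hy
    | tmul x y => exact ht i j hij x x.2 y y.2

lemma IsSupercomplex.tensor (hK : K.IsSupercomplex) (hL : L.IsSupercomplex) :
    (K.tensor L).IsSupercomplex := by
  intro n z hz
  induction hz using tensor_induction with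
  | h0 => rw [map_zero, map_zero]; exact ⟨Submodule.zero_mem _, rfl⟩
  | hadd x y _ _ hx hy =>
    rw [map_add, map_add, hx.2, hy.2, add_zero]
    exact ⟨Submodule.add_mem _ hx.1 hy.1, rfl⟩
  | ht i j hij x hx y hy =>
    have e1 : i + 1 + j = n + 1 := by rw [← hij]; ring
    have e2 : i + (j + 1) = n + 1 := by rw [← hij]; ring
    rw [tensor_d_tmul, K.sgn_of_mem i x hx, ← TensorProduct.smul_tmul']
    refine ⟨Submodule.add_mem _ (tmul_mem_N K L (hK i x hx).1 hy e1)
      (Submodule.smul_mem _ _ (tmul_mem_N K L hx (hL j y hy).1 e2)), ?_⟩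
    rw [map_add, map_smul, tensor_d_tmul, tensor_d_tmul, (hK i x hx).2, (hL j y hy).2,
      K.sgn_of_mem _ _ (hK i x hx).1, neg_one_pow_val_add_one]
    simp [TensorProduct.smul_tmul', TensorProduct.neg_tmul]

lemma nablaComponent_mk {i j n : ZMod 2} (h : i + j = n) (x : K.Z i) (y : L.Z j) :
    nablaComponent K L i j n h
      (Submodule.Quotient.mk (p := K.Bd i) x ⊗ₜ[k] Submodule.Quotient.mk (p := L.Bd j) y) =
      Submodule.Quotient.mk ⟨(x : K.V) ⊗ₜ[k] (y : L.V), tmul_mem_Z K L x.2 y.2 h⟩ := rfl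

/-- A linear map on the whole space which on cocycles of parity `i` is the class map, and which
vanishes on boundaries and on the other parity. -/
lemma IsSupercomplex.exists_classMap [CharZero k] (hK : K.IsSupercomplex) (i : ZMod 2) :
    ∃ Q : K.V →ₗ[k] K.Coh i, (∀ x : K.Z i, Q x = Submodule.Quotient.mk x) ∧
      (∀ x ∈ K.N (i + 1), Q x = 0) ∧ ∀ j, ∀ x ∈ K.N j, Q (K.d x) = 0 := by
  obtain ⟨h, P, h1, hP, h2, h3⟩ := hK.exists_contraction
  have two : ∀ i : ZMod 2, i + 1 + 1 = i := by decide
  obtain ⟨g, hg⟩ := LinearMap.exists_extend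
    ((K.Bd i).mkQ ∘ₗ (P.restrict (p := K.N i) (q := K.Z i) (h2 i)))
  have hg' : ∀ x (hx : x ∈ K.N i), g x = Submodule.Quotient.mk ⟨P x, h2 i x hx⟩ :=
    fun x hx => LinearMap.congr_fun hg ⟨x, hx⟩
  have h0 : ∀ x ∈ K.N (i + 1), (g ∘ₗ K.parityProj i) x = 0 := fun x hx => by
    rw [LinearMap.comp_apply, parityProj_of_mem_add_one K hx, map_zero]
  refine ⟨g ∘ₗ K.parityProj i, fun x => ?_, h0, fun j x hx => ?_⟩
  · rw [LinearMap.comp_apply, parityProj_of_mem K x.2.1, hg' _ x.2.1]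
    refine (Submodule.Quotient.eq _).2 ⟨-h x, Submodule.neg_mem _ (h1 i x x.2.1), ?_⟩
    change K.d (-h x) = P x - x
    rw [hP, LinearMap.mem_ker.1 x.2.2, map_zero, map_neg]
    abel
  · by_cases hij : j = i
    · subst hij
      exact h0 _ (hK j x hx).1
    · have hj : j + 1 = i := (eq_add_one_of_ne hij).symm
      have hd : K.d x ∈ K.N i := hj ▸ (hK j x hx).1
      rw [LinearMap.comp_apply, parityProj_of_mem K hd, hg' _ hd]
      refine (Submodule.Quotient.mk_eq_zero _).2 ?_
      have : (⟨P (K.d x), h2 i _ hd⟩ : K.Z i) = 0 := Subtype.ext (h3 j x hx)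
      rw [this]
      exact Submodule.zero_mem _

lemma nabla_surjective [CharZero k] (hK : K.IsSupercomplex) (hL : L.IsSupercomplex) (n : ZMod 2) :
    Function.Surjective (K.nabla L n) := by
  obtain ⟨h, P, h1, hP, h2, h3⟩ := hK.exists_contraction
  obtain ⟨h', P', h1', hP', h2', h3'⟩ := hL.exists_contraction
  intro c
  obtain ⟨z, rfl⟩ := Submodule.Quotient.mk_surjective _ c
  let G : Module.End k (K.V ⊗[k] L.V) :=
    TensorProduct.map h LinearMap.id + TensorProduct.map (P ∘ₗ K.sgn) h'
  have hG : ∀ w ∈ (K.tensor L).N n, G w ∈ (K.tensor L).N (n + 1) := by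
    intro w hw
    induction hw using tensor_induction with
    | h0 => rw [map_zero]; exact Submodule.zero_mem _
    | hadd x y _ _ hx hy => rw [map_add]; exact Submodule.add_mem _ hx hy
    | ht i j hij x hx y hy =>
      have e1 : i + 1 + j = n + 1 := by rw [← hij]; ring
      have e2 : i + (j + 1) = n + 1 := by rw [← hij]; ring
      refine Submodule.add_mem _ (tmul_mem_N K L (h1 i x hx) hy e1) ?_
      refine tmul_mem_N K L ?_ (h1' j y hy) e2
      rw [LinearMap.comp_apply, K.sgn_of_mem i x hx, map_smul]
      exact Submodule.smul_mem _ _ (h2 i x hx).1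
  have hPP : ∀ w ∈ (K.tensor L).N n,
      w - TensorProduct.map P P' w = (K.tensor L).d (G w) + G ((K.tensor L).d w) := by
    intro w hw
    induction hw using tensor_induction with
    | h0 => simp
    | hadd x y _ _ hx hy =>
      simp only [map_add] at hx hy ⊢
      rw [add_sub_add_comm, hx, hy]
      abel
    | ht i j hij x hx y hy =>
      have eP : K.d (P x) = 0 := LinearMap.mem_ker.1 (h2 i x hx).2
      have eG : ∀ (a : K.V) (b : L.V), G (a ⊗ₜ[k] b) = h a ⊗ₜ[k] b + P (K.sgn a) ⊗ₜ[k] h' b :=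
        fun a b => rfl
      have e4 := neg_one_pow_val_add_one (k := k) i
      have e5 : (-1 : k) ^ i.val * (-1) ^ i.val = 1 := by
        rw [← mul_pow, neg_one_mul, neg_neg, one_pow]
      rw [tensor_d_tmul, map_add, eG, eG, eG, map_add, tensor_d_tmul, tensor_d_tmul,
        TensorProduct.map_tmul, K.sgn_of_mem i x hx, K.sgn_of_mem _ _ (hK i x hx).1,
        K.sgn_of_mem _ _ (h1 i x hx)]
      simp only [map_smul, eP, h3 i x hx, K.sgn_of_mem i x hx, K.sgn_of_mem i _ (h2 i x hx).1,
        smul_smul, e4, e5, smul_zero, TensorProduct.zero_tmul, one_smul, neg_smul,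
        TensorProduct.neg_tmul, map_neg]
      have e6 : K.d (h x) ⊗ₜ[k] y = x ⊗ₜ[k] y - h (K.d x) ⊗ₜ[k] y - P x ⊗ₜ[k] y := by
        rw [hP, ← TensorProduct.sub_tmul, ← TensorProduct.sub_tmul]; congr 1; abel
      have e7 : P x ⊗ₜ[k] L.d (h' y) = P x ⊗ₜ[k] y - P x ⊗ₜ[k] h' (L.d y) - P x ⊗ₜ[k] P' y := by
        rw [hP' y, ← TensorProduct.tmul_sub, ← TensorProduct.tmul_sub]; congr 1; abel
      rw [e6, e7]
      abel
  have hrange : ∀ w ∈ (K.tensor L).N n, ∃ (hw : TensorProduct.map P P' w ∈ (K.tensor L).Z n),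
      Submodule.Quotient.mk ⟨_, hw⟩ ∈ LinearMap.range (K.nabla L n) := by
    intro w hw
    induction hw using tensor_induction with
    | h0 =>
      refine ⟨by rw [map_zero]; exact Submodule.zero_mem _, ?_⟩
      convert Submodule.zero_mem _
      refine (Submodule.Quotient.mk_eq_zero _).2 ?_
      convert Submodule.zero_mem _
      exact map_zero _
    | hadd x y _ _ hx hy =>
      obtain ⟨a, ha⟩ := hx
      obtain ⟨b, hb⟩ := hy
      refine ⟨by rw [map_add]; exact Submodule.add_mem _ a b, ?_⟩
      convert Submodule.add_mem _ ha hb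
      rw [← Submodule.Quotient.mk_add]
      congr 1
      exact Subtype.ext (map_add _ _ _)
    | ht i j hij x hx y hy =>
      refine ⟨tmul_mem_Z K L (h2 i x hx) (h2' j y hy) hij,
        DirectSum.lof k {p : ZMod 2 × ZMod 2 // p.1 + p.2 = n} (fun p => K.Coh p.1.1 ⊗[k] L.Coh p.1.2) ⟨(i, j), hij⟩
          (Submodule.Quotient.mk (⟨P x, h2 i x hx⟩ : K.Z i) ⊗ₜ[k]
            Submodule.Quotient.mk (⟨P' y, h2' j y hy⟩ : L.Z j)), ?_⟩
      rw [nabla, DirectSum.toModule_lof]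
      rfl
  obtain ⟨hw, c, hc⟩ := hrange z z.2.1
  refine ⟨c, hc.trans ?_⟩
  refine ((Submodule.Quotient.eq ((K.tensor L).Bd n)).2 ⟨G z, hG z z.2.1, ?_⟩).symm
  have := hPP z z.2.1
  rw [LinearMap.mem_ker.1 z.2.2, map_zero, add_zero] at this
  exact this.symm

lemma exists_nabla_retraction [CharZero k] (hK : K.IsSupercomplex) (hL : L.IsSupercomplex)
    (n : ZMod 2) : ∃ F : K.V ⊗[k] L.V →ₗ[k] K.CohTensor L n,
      (∀ w ∈ (K.tensor L).N (n + 1), F ((K.tensor L).d w) = 0) ∧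
      ∀ (p : {p : ZMod 2 × ZMod 2 // p.1 + p.2 = n}) (x : K.Z p.1.1) (y : L.Z p.1.2),
        F ((x : K.V) ⊗ₜ[k] (y : L.V)) =
          DirectSum.lof k {p : ZMod 2 × ZMod 2 // p.1 + p.2 = n}
            (fun p => K.Coh p.1.1 ⊗[k] L.Coh p.1.2) p
            (Submodule.Quotient.mk (p := K.Bd p.1.1) x ⊗ₜ[k]
              Submodule.Quotient.mk (p := L.Bd p.1.2) y) := by
  choose Q hQ1 hQ2 hQ3 using hK.exists_classMap
  choose Q' hQ1' hQ2' hQ3' using hL.exists_classMap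
  refine ⟨∑ p : {p : ZMod 2 × ZMod 2 // p.1 + p.2 = n},
      DirectSum.lof k {p : ZMod 2 × ZMod 2 // p.1 + p.2 = n}
        (fun p => K.Coh p.1.1 ⊗[k] L.Coh p.1.2) p ∘ₗ TensorProduct.map (Q p.1.1) (Q' p.1.2),
    fun w hw => ?_, fun p x y => ?_⟩
  · induction hw using tensor_induction with
    | h0 => simp
    | hadd x y _ _ hx hy => rw [map_add, map_add, hx, hy, add_zero]
    | ht i j hij x hx y hy =>
      rw [tensor_d_tmul, K.sgn_of_mem i x hx, ← TensorProduct.smul_tmul', map_add, map_smul,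
        LinearMap.sum_apply, LinearMap.sum_apply]
      simp only [LinearMap.comp_apply, TensorProduct.map_tmul, hQ3 _ i x hx, hQ3' _ j y hy,
        TensorProduct.zero_tmul, TensorProduct.tmul_zero, map_zero, Finset.sum_const_zero,
        smul_zero, add_zero]
  · rw [LinearMap.sum_apply, Finset.sum_eq_single p]
    · rw [LinearMap.comp_apply, TensorProduct.map_tmul, hQ1, hQ1']
    · rintro ⟨⟨i, j⟩, hij⟩ _ hq
      rw [LinearMap.comp_apply, TensorProduct.map_tmul]
      obtain ⟨⟨i', j'⟩, hij'⟩ := p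
      have hi : i ≠ i' := fun h => hq (Subtype.ext (Prod.ext h (by
        change j = j'
        have hij : i + j = n := hij
        have hij' : i' + j' = n := hij'
        rw [← hij', h] at hij
        exact add_left_cancel hij)))
      have h0 : Q i (x : K.V) = 0 :=
        hQ2 i x ((eq_add_one_of_ne hi : i' = i + 1) ▸ (x.2.1 : (x : K.V) ∈ K.N i'))
      rw [h0, TensorProduct.zero_tmul, map_zero]
    · exact fun h => absurd (Finset.mem_univ p) h

lemma nabla_injective [CharZero k] (hK : K.IsSupercomplex) (hL : L.IsSupercomplex) (n : ZMod 2) :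
    Function.Injective (K.nabla L n) := by
  obtain ⟨F, hFd, hF⟩ := exists_nabla_retraction hK hL n
  have key : ∀ c : K.CohTensor L n, ∃ z : (K.tensor L).Z n,
      K.nabla L n c = Submodule.Quotient.mk z ∧ F (z : K.V ⊗[k] L.V) = c := by
    intro c
    induction c using DirectSum.induction_on with
    | zero => exact ⟨0, by rw [map_zero, Submodule.Quotient.mk_zero], map_zero F⟩
    | add a b ha hb =>
      obtain ⟨x, hx, hx'⟩ := ha
      obtain ⟨y, hy, hy'⟩ := hb
      exact ⟨x + y, by rw [map_add, hx, hy, Submodule.Quotient.mk_add],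
        (map_add F _ _).trans (congrArg₂ _ hx' hy')⟩
    | of p c =>
      rw [← DirectSum.lof_eq_of k]
      induction c using TensorProduct.induction_on with
      | zero =>
        exact ⟨0, by rw [map_zero, map_zero, Submodule.Quotient.mk_zero],
          (map_zero F).trans (map_zero _).symm⟩
      | add a b ha hb =>
        obtain ⟨x, hx, hx'⟩ := ha
        obtain ⟨y, hy, hy'⟩ := hb
        exact ⟨x + y, by rw [map_add, map_add, hx, hy, Submodule.Quotient.mk_add],
          (map_add F _ _).trans ((congrArg₂ _ hx' hy').trans (map_add _ _ _).symm)⟩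
      | tmul a b =>
        obtain ⟨x, rfl⟩ := Submodule.Quotient.mk_surjective _ a
        obtain ⟨y, rfl⟩ := Submodule.Quotient.mk_surjective _ b
        refine ⟨⟨_, tmul_mem_Z K L x.2 y.2 p.2⟩, ?_, hF p x y⟩
        rw [nabla, DirectSum.toModule_lof, nablaComponent_mk]
  intro a b hab
  obtain ⟨x, hx, hxa⟩ := key a
  obtain ⟨y, hy, hyb⟩ := key b
  obtain ⟨w, hw, hwz⟩ := (Submodule.Quotient.eq _).1 (hx.symm.trans (hab.trans hy))
  have e : (x : K.V ⊗[k] L.V) = y + (K.tensor L).d w := by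
    rw [hwz]
    exact (add_sub_cancel (y : K.V ⊗[k] L.V) x).symm
  rw [← hxa, ← hyb, e, map_add, hFd w hw, add_zero]

theorem nabla_bijective [CharZero k] (hK : K.IsSupercomplex) (hL : L.IsSupercomplex) (n : ZMod 2) :
    Function.Bijective (K.nabla L n) :=
  ⟨nabla_injective hK hL n, nabla_surjective hK hL n⟩

end SuperData

end HopfCyclic

namespace HopfCyclic

universe u v w

namespace CocyclicData

variable {k : Type u} [Field k]

/-! ### Cofaces, codegeneracies and cyclic operators on the total space -/

section Operators

variable (C : CocyclicData.{u, w} k)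

/-- The `a`-th coface of every degree, as one operator on the total space. -/
def cof (a : ℕ) : Module.End k C.Tot :=
  DirectSum.toModule k ℕ C.Tot fun n => DirectSum.lof k ℕ C.obj (n + 1) ∘ₗ C.δ n a

/-- The homogeneous elements of degree `n`. -/
def deg (n : ℕ) : Submodule k C.Tot := LinearMap.range (DirectSum.lof k ℕ C.obj n)

lemma s_lof (a n : ℕ) (x : C.obj (n + 1)) :
    C.s a (DirectSum.lof k ℕ C.obj (n + 1) x) = DirectSum.lof k ℕ C.obj n (C.σ n a x) := by
  rw [s, DirectSum.toModule_lof]; rfl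

lemma s_lof_zero (a : ℕ) (x : C.obj 0) : C.s a (DirectSum.lof k ℕ C.obj 0 x) = 0 := by
  rw [s, DirectSum.toModule_lof]; rfl

lemma cof_lof (a n : ℕ) (x : C.obj n) :
    C.cof a (DirectSum.lof k ℕ C.obj n x) = DirectSum.lof k ℕ C.obj (n + 1) (C.δ n a x) := by
  rw [cof, DirectSum.toModule_lof]; rfl

lemma t_lof (n : ℕ) (x : C.obj n) :
    C.t (DirectSum.lof k ℕ C.obj n x) = DirectSum.lof k ℕ C.obj n (C.τ n x) := by
  rw [t, DirectSum.toModule_lof]; rfl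

lemma t_pow_lof (n j : ℕ) (x : C.obj n) :
    (C.t ^ j) (DirectSum.lof k ℕ C.obj n x) =
      DirectSum.lof k ℕ C.obj n (((C.τ n : Module.End k (C.obj n)) ^ j) x) := by
  induction j with
  | zero => simp
  | succ j ih => rw [pow_succ', Module.End.mul_apply, ih, t_lof, pow_succ']; rfl

lemma sgn_lof (n : ℕ) (x : C.obj n) : C.sgn (DirectSum.lof k ℕ C.obj n x) =
    (-1 : k) ^ n • DirectSum.lof k ℕ C.obj n x := by
  rw [sgn, DirectSum.toModule_lof]; rfl

variable {C}

lemma lof_mem_deg (n : ℕ) (x : C.obj n) : DirectSum.lof k ℕ C.obj n x ∈ C.deg n := ⟨x, rfl⟩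

lemma s_mem {n m : ℕ} {x : C.Tot} (hx : x ∈ C.deg n) (a : ℕ) (h : n = m + 1) :
    C.s a x ∈ C.deg m := by
  subst h
  obtain ⟨x, rfl⟩ := hx
  exact ⟨_, (s_lof C a m x).symm⟩

lemma cof_mem {n m : ℕ} {x : C.Tot} (hx : x ∈ C.deg n) (a : ℕ) (h : m = n + 1) :
    C.cof a x ∈ C.deg m := by
  subst h
  obtain ⟨x, rfl⟩ := hx
  exact ⟨_, (cof_lof C a n x).symm⟩

lemma t_mem {n : ℕ} {x : C.Tot} (hx : x ∈ C.deg n) : C.t x ∈ C.deg n := by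
  obtain ⟨x, rfl⟩ := hx
  exact ⟨_, (t_lof C n x).symm⟩

lemma t_pow_mem {n : ℕ} {x : C.Tot} (hx : x ∈ C.deg n) (j : ℕ) : (C.t ^ j) x ∈ C.deg n := by
  obtain ⟨x, rfl⟩ := hx
  exact ⟨_, (t_pow_lof C n j x).symm⟩

lemma sgn_of_mem_deg {n : ℕ} {x : C.Tot} (hx : x ∈ C.deg n) : C.sgn x = (-1 : k) ^ n • x := by
  obtain ⟨x, rfl⟩ := hx
  exact sgn_lof C n x

lemma t_pow_succ (j : ℕ) (x : C.Tot) : (C.t ^ (j + 1)) x = (C.t ^ j) (C.t x) := by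
  rw [pow_succ, Module.End.mul_apply]

lemma t_pow_add (i j : ℕ) (x : C.Tot) : (C.t ^ (i + j)) x = (C.t ^ i) ((C.t ^ j) x) := by
  rw [pow_add, Module.End.mul_apply]

end Operators

namespace IsCocyclic

variable {C : CocyclicData.{u, w} k} (hC : C.IsCocyclic)

include hC

lemma s_s {d : ℕ} {x : C.Tot} (hx : x ∈ C.deg d) {i j : ℕ} (hij : i ≤ j) (hj : j + 2 ≤ d) :
    C.s j (C.s i x) = C.s i (C.s (j + 1) x) := by
  obtain ⟨n, rfl⟩ := Nat.exists_eq_add_of_le' (show 2 ≤ d by omega)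
  obtain ⟨x, rfl⟩ := hx
  rw [s_lof, s_lof, s_lof, s_lof]
  exact congrArg _ (LinearMap.congr_fun (hC.σ_σ n i j hij (by omega)) x)

lemma cof_cof {d : ℕ} {x : C.Tot} (hx : x ∈ C.deg d) {i j : ℕ} (hij : i < j) (hj : j ≤ d + 2) :
    C.cof j (C.cof i x) = C.cof i (C.cof (j - 1) x) := by
  obtain ⟨x, rfl⟩ := hx
  rw [cof_lof, cof_lof, cof_lof, cof_lof]
  exact congrArg _ (LinearMap.congr_fun (hC.δ_δ d i j hij hj) x)

lemma s_cof_lt {d : ℕ} {x : C.Tot} (hx : x ∈ C.deg d) {i j : ℕ} (hij : i < j) (hj : j ≤ d) :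
    C.s j (C.cof i x) = C.cof i (C.s (j - 1) x) := by
  obtain ⟨n, rfl⟩ := Nat.exists_eq_add_of_le' (show 1 ≤ d by omega)
  obtain ⟨x, rfl⟩ := hx
  rw [cof_lof, s_lof, s_lof, cof_lof]
  exact congrArg _ (LinearMap.congr_fun (hC.σ_δ_lt n i j hij hj) x)

lemma s_cof_self {d : ℕ} {x : C.Tot} (hx : x ∈ C.deg d) {j : ℕ} (hj : j ≤ d) :
    C.s j (C.cof j x) = x := by
  obtain ⟨x, rfl⟩ := hx
  rw [cof_lof, s_lof]
  exact congrArg _ (LinearMap.congr_fun (hC.σ_δ_self d j hj) x)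

lemma s_cof_succ {d : ℕ} {x : C.Tot} (hx : x ∈ C.deg d) {j : ℕ} (hj : j ≤ d) :
    C.s j (C.cof (j + 1) x) = x := by
  obtain ⟨x, rfl⟩ := hx
  rw [cof_lof, s_lof]
  exact congrArg _ (LinearMap.congr_fun (hC.σ_δ_succ d j hj) x)

lemma s_cof_gt {d : ℕ} {x : C.Tot} (hx : x ∈ C.deg d) {i j : ℕ} (hij : j + 1 < i)
    (hi : i ≤ d + 1) : C.s j (C.cof i x) = C.cof (i - 1) (C.s j x) := by
  obtain ⟨n, rfl⟩ := Nat.exists_eq_add_of_le' (show 1 ≤ d by omega)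
  obtain ⟨x, rfl⟩ := hx
  rw [cof_lof, s_lof, s_lof, cof_lof]
  exact congrArg _ (LinearMap.congr_fun (hC.σ_δ_gt n i j hij (by omega)) x)

lemma t_cof {d : ℕ} {x : C.Tot} (hx : x ∈ C.deg d) {i : ℕ} (hi : 1 ≤ i) (hi' : i ≤ d + 1) :
    C.t (C.cof i x) = C.cof (i - 1) (C.t x) := by
  obtain ⟨x, rfl⟩ := hx
  rw [cof_lof, t_lof, t_lof, cof_lof]
  exact congrArg _ (LinearMap.congr_fun (hC.τ_δ d i hi hi') x)

lemma t_cof_zero {d : ℕ} {x : C.Tot} (hx : x ∈ C.deg d) :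
    C.t (C.cof 0 x) = C.cof (d + 1) x := by
  obtain ⟨x, rfl⟩ := hx
  rw [cof_lof, t_lof, cof_lof]
  exact congrArg _ (LinearMap.congr_fun (hC.τ_δ_zero d) x)

lemma t_s {d : ℕ} {x : C.Tot} (hx : x ∈ C.deg d) {i : ℕ} (hi : 1 ≤ i) (hi' : i + 1 ≤ d) :
    C.t (C.s i x) = C.s (i - 1) (C.t x) := by
  obtain ⟨n, rfl⟩ := Nat.exists_eq_add_of_le' (show 1 ≤ d by omega)
  obtain ⟨x, rfl⟩ := hx
  rw [s_lof, t_lof, t_lof, s_lof]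
  exact congrArg _ (LinearMap.congr_fun (hC.τ_σ n i hi (by omega)) x)

lemma t_s_zero {d : ℕ} {x : C.Tot} (hx : x ∈ C.deg d) (hd : 1 ≤ d) :
    C.t (C.s 0 x) = C.s (d - 1) (C.t (C.t x)) := by
  obtain ⟨n, rfl⟩ := Nat.exists_eq_add_of_le' hd
  obtain ⟨x, rfl⟩ := hx
  rw [s_lof, t_lof, t_lof, t_lof, s_lof]
  exact congrArg _ (LinearMap.congr_fun (hC.τ_σ_zero n) x)

lemma t_pow_self {d : ℕ} {x : C.Tot} (hx : x ∈ C.deg d) : (C.t ^ (d + 1)) x = x := by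
  obtain ⟨x, rfl⟩ := hx
  rw [t_pow_lof, hC.τ_pow, Module.End.one_apply]

lemma t_pow_s_of_le {d : ℕ} {x : C.Tot} (hx : x ∈ C.deg d) {j a : ℕ} (hj : j ≤ a)
    (ha : a + 1 ≤ d) : (C.t ^ j) (C.s a x) = C.s (a - j) ((C.t ^ j) x) := by
  induction j with
  | zero => rfl
  | succ j ih =>
    rw [pow_succ', Module.End.mul_apply, Module.End.mul_apply, ih (by omega),
      hC.t_s (t_pow_mem hx j) (by omega) (by omega), Nat.sub_sub]

lemma t_pow_s_of_lt {d : ℕ} {x : C.Tot} (hx : x ∈ C.deg d) {j a : ℕ} (hj : a < j)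
    (hj' : j ≤ a + d) (ha : a + 1 ≤ d) :
    (C.t ^ j) (C.s a x) = C.s (a + d - j) ((C.t ^ (j + 1)) x) := by
  obtain ⟨l, rfl⟩ := Nat.exists_eq_add_of_le' (show a + 1 ≤ j from hj)
  rw [show l + (a + 1) = l + 1 + a by omega, t_pow_add, hC.t_pow_s_of_le hx le_rfl ha,
    Nat.sub_self, t_pow_succ, hC.t_s_zero (t_pow_mem hx a) (by omega),
    hC.t_pow_s_of_le (t_mem (t_mem (t_pow_mem hx a))) (by omega) (by omega),
    show l + 1 + a + 1 = l + 1 + 1 + a by omega, t_pow_add, t_pow_succ, t_pow_succ]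
  congr 2
  omega

lemma t_pow_cof_of_le {d : ℕ} {x : C.Tot} (hx : x ∈ C.deg d) {j a : ℕ} (hj : j ≤ a)
    (ha : a ≤ d + 1) : (C.t ^ j) (C.cof a x) = C.cof (a - j) ((C.t ^ j) x) := by
  induction j with
  | zero => rfl
  | succ j ih =>
    rw [pow_succ', Module.End.mul_apply, Module.End.mul_apply, ih (by omega),
      hC.t_cof (t_pow_mem hx j) (by omega) (by omega), Nat.sub_sub]

lemma t_pow_cof_of_lt {d : ℕ} {x : C.Tot} (hx : x ∈ C.deg d) {j a : ℕ} (hj : a < j)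
    (hj' : j ≤ a + d + 2) (ha : a ≤ d + 1) :
    (C.t ^ j) (C.cof a x) = C.cof (a + d + 2 - j) ((C.t ^ (j - 1)) x) := by
  obtain ⟨l, rfl⟩ := Nat.exists_eq_add_of_le' (show a + 1 ≤ j from hj)
  rw [show l + (a + 1) = l + 1 + a by omega, t_pow_add, hC.t_pow_cof_of_le hx le_rfl ha,
    Nat.sub_self, t_pow_succ, hC.t_cof_zero (t_pow_mem hx a),
    hC.t_pow_cof_of_le (t_pow_mem hx a) (by omega) (by omega),
    show l + 1 + a - 1 = l + a by omega, t_pow_add]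
  congr 2
  omega

end IsCocyclic

/-! ### Rotated extra codegeneracies -/

section Extra

variable (C : CocyclicData.{u, w} k)

/-- The operator `s_{i - p - 1} t ^ (p + 1)`, which in degree `i` is the `p`-th rotation of the extra
codegeneracy. -/
def extra (i p : ℕ) : Module.End k C.Tot := C.s (i - p - 1) * C.t ^ (p + 1)

lemma extra_apply (i p : ℕ) (x : C.Tot) : C.extra i p x = C.s (i - p - 1) ((C.t ^ (p + 1)) x) := rfl

variable {C}

lemma extra_mem {n m : ℕ} {x : C.Tot} (hx : x ∈ C.deg n) (i p : ℕ) (h : n = m + 1) :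
    C.extra i p x ∈ C.deg m := s_mem (t_pow_mem hx _) _ h

end Extra

namespace IsCocyclic

variable {C : CocyclicData.{u, w} k} (hC : C.IsCocyclic)

include hC

lemma extra_cof_zero {d : ℕ} {x : C.Tot} (hx : x ∈ C.deg d) {p : ℕ} (hp : p ≤ d) :
    C.extra (d + 1) p (C.cof 0 x) = (C.t ^ p) x := by
  rw [extra_apply, hC.t_pow_cof_of_lt hx (by omega) (by omega) (by omega),
    show 0 + d + 2 - (p + 1) = d + 1 - p - 1 + 1 by omega,
    hC.s_cof_succ (t_pow_mem hx _) (by omega), Nat.add_sub_cancel]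

lemma extra_cof_last {d : ℕ} {x : C.Tot} (hx : x ∈ C.deg d) {p : ℕ} (hp : p ≤ d) :
    C.extra (d + 1) p (C.cof (d + 1) x) = (C.t ^ (p + 1)) x := by
  rw [extra_apply, hC.t_pow_cof_of_le hx (by omega) (by omega),
    show d + 1 - (p + 1) = d + 1 - p - 1 by omega, hC.s_cof_self (t_pow_mem hx _) (by omega)]

lemma extra_cof_of_le {d : ℕ} {x : C.Tot} (hx : x ∈ C.deg d) {p a : ℕ} (hp : p ≤ d) (ha : 1 ≤ a)
    (hap : a ≤ p) : C.extra (d + 1) p (C.cof a x) = C.cof (d - p + a) (C.extra d (p - 1) x) := by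
  rw [extra_apply, hC.t_pow_cof_of_lt hx (by omega) (by omega) (by omega),
    hC.s_cof_gt (t_pow_mem hx _) (by omega) (by omega), extra_apply,
    show d + 1 - p - 1 = d - (p - 1) - 1 by omega, show p + 1 - 1 = p - 1 + 1 by omega]
  congr 2
  omega

lemma extra_cof_of_lt {d : ℕ} {x : C.Tot} (hx : x ∈ C.deg d) {p a : ℕ} (hp : p < a) (ha : a ≤ d) :
    C.extra (d + 1) p (C.cof a x) = C.cof (a - p - 1) (C.extra d p x) := by
  rw [extra_apply, hC.t_pow_cof_of_le hx (by omega) (by omega),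
    hC.s_cof_lt (t_pow_mem hx _) (by omega) (by omega), extra_apply,
    show d + 1 - p - 1 - 1 = d - p - 1 by omega, Nat.sub_sub a]

/-- Reorganisation of the inner cofaces under the rotated extra codegeneracies, with a weight `g`
that depends on the rotation only. -/
lemma sum_extra_cof {d : ℕ} {x : C.Tot} (hx : x ∈ C.deg d) (g : ℕ → k) :
    ∑ a ∈ Finset.range d, ∑ p ∈ Finset.range (d + 1),
      ((-1) ^ (a + 1) * (-1) ^ (p * d) * g (if p ≤ a then p else p - 1)) •
        C.extra (d + 1) p (C.cof (a + 1) x) =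
    -∑ p ∈ Finset.range d, ∑ a ∈ Finset.range (d + 1),
      ((-1) ^ a * (-1) ^ (p * (d - 1)) * g p) • C.cof a (C.extra d p x) := by
  have hd : ∀ p : ℕ, p < d → (-1 : k) ^ (p * d) = (-1) ^ p * (-1) ^ (p * (d - 1)) := by
    intro p hp
    rw [← pow_add]
    obtain ⟨e, rfl⟩ := Nat.exists_eq_add_of_le' (show 1 ≤ d by omega)
    congr 1
    rw [Nat.add_sub_cancel]; ring
  rw [Finset.sum_comm, ← Finset.sum_neg_distrib]
  have h1 : ∀ p ∈ Finset.range (d + 1), ∑ a ∈ Finset.range d,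
      ((-1) ^ (a + 1) * (-1) ^ (p * d) * g (if p ≤ a then p else p - 1)) •
        C.extra (d + 1) p (C.cof (a + 1) x) =
      (∑ a ∈ Finset.range p, ((-1) ^ (a + 1) * (-1) ^ (p * d) * g (p - 1)) •
        C.cof (d - p + (a + 1)) (C.extra d (p - 1) x)) +
      ∑ a ∈ Finset.range (d - p), ((-1) ^ (p + a + 1) * (-1) ^ (p * d) * g p) •
        C.cof a (C.extra d p x) := by
    intro p hp
    have hp : p ≤ d := Nat.lt_succ_iff.1 (Finset.mem_range.1 hp)
    conv_lhs => rw [← Nat.add_sub_cancel' hp, Finset.sum_range_add]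
    rw [Nat.add_sub_cancel' hp]
    congr 1
    · refine Finset.sum_congr rfl fun a ha => ?_
      have ha := Finset.mem_range.1 ha
      rw [if_neg (by omega), hC.extra_cof_of_le hx hp (by omega) (by omega)]
    · refine Finset.sum_congr rfl fun a ha => ?_
      have ha := Finset.mem_range.1 ha
      rw [if_pos (by omega), hC.extra_cof_of_lt hx (by omega) (by omega),
        show p + a + 1 - p - 1 = a by omega]
  rw [Finset.sum_congr rfl h1, Finset.sum_add_distrib, Finset.sum_range_succ', Finset.sum_range_succ
    _ d, Nat.sub_self, Finset.range_zero, Finset.sum_empty, Finset.sum_empty, add_zero, add_zero,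
    ← Finset.sum_add_distrib]
  refine Finset.sum_congr rfl fun p hp => ?_
  have hp := Finset.mem_range.1 hp
  have hs : Finset.range (d + 1) = Finset.range (d - p + (p + 1)) := by congr 1; omega
  rw [add_comm, hs, Finset.sum_range_add _ (d - p), neg_add,
    ← Finset.sum_neg_distrib, ← Finset.sum_neg_distrib]
  have h2 : (-1 : k) ^ p * (-1) ^ p = 1 := by rw [← mul_pow]; simp
  congr 1
  · refine Finset.sum_congr rfl fun a ha => ?_
    rw [← neg_smul]
    congr 1
    rw [hd p hp, pow_succ, pow_add]
    linear_combination (-(-1 : k) ^ a * (-1) ^ (p * (d - 1)) * g p) * h2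
  · refine Finset.sum_congr rfl fun a ha => ?_
    rw [← neg_smul, show d - (p + 1) + (a + 1) = d - p + a by omega, Nat.add_sub_cancel]
    congr 1
    have h3 : (-1 : k) ^ d = (-1) ^ (d - p) * (-1) ^ p := by
      rw [← pow_add]; congr 1; omega
    rw [add_mul, one_mul, pow_add _ (p * d), hd p hp, h3, pow_succ, pow_add]
    linear_combination (-(-1 : k) ^ (d - p) * (-1) ^ a * (-1) ^ (p * (d - 1)) * g p) * h2

end IsCocyclic

end CocyclicData

end HopfCyclic

namespace HopfCyclic

universe u v w

namespace CocyclicData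

variable {k : Type u} [Field k]

/-! ### Degeneracy words

A list of booleans describes which of the steps `j, j + 1, …` are kept (`true`) and which are
removed by a codegeneracy (`false`). -/

section Words

variable (C : CocyclicData.{u, w} k)

/-- The composite of the codegeneracies `s_a` over the positions `a`, counted from `j`, at which the
word is `false`. -/
def wd : ℕ → List Bool → Module.End k C.Tot
  | _, [] => 1
  | j, true :: w => wd (j + 1) w
  | j, false :: w => C.s j * wd (j + 1) w

variable {C}

lemma wd_nil (j : ℕ) (x : C.Tot) : C.wd j [] x = x := rfl

lemma wd_cons_true (j : ℕ) (w : List Bool) : C.wd j (true :: w) = C.wd (j + 1) w := rfl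

lemma wd_cons_false (j : ℕ) (w : List Bool) (x : C.Tot) :
    C.wd j (false :: w) x = C.s j (C.wd (j + 1) w x) := rfl

lemma wd_append (j : ℕ) (u v : List Bool) (x : C.Tot) :
    C.wd j (u ++ v) x = C.wd j u (C.wd (j + u.length) v x) := by
  induction u generalizing j with
  | nil => rfl
  | cons b u ih =>
    cases b
    · rw [List.cons_append, wd_cons_false, wd_cons_false, ih, List.length_cons,
        show j + 1 + u.length = j + (u.length + 1) by omega]
    · rw [List.cons_append, wd_cons_true, wd_cons_true, ih, List.length_cons,
        show j + 1 + u.length = j + (u.length + 1) by omega]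

lemma wd_append_true (j : ℕ) (u : List Bool) : C.wd j (u ++ [true]) = C.wd j u :=
  LinearMap.ext fun x => by rw [wd_append]; rfl

lemma wd_mem {d m : ℕ} {x : C.Tot} (hx : x ∈ C.deg d) (j : ℕ) (w : List Bool)
    (h : d = m + w.count false) : C.wd j w x ∈ C.deg m := by
  induction w generalizing j m with
  | nil => rw [h] at hx; exact hx
  | cons b w ih =>
    cases b
    · rw [List.count_cons_self] at h
      exact s_mem (ih (j + 1) (m := m + 1) (by omega)) _ rfl
    · rw [List.count_cons_of_ne (by decide)] at h
      exact ih (j + 1) h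

lemma wd_mem_sub {d : ℕ} {x : C.Tot} (hx : x ∈ C.deg d) (j : ℕ) (w : List Bool)
    (h : w.length ≤ d) : C.wd j w x ∈ C.deg (d - w.count false) :=
  wd_mem hx j w (Nat.sub_add_cancel ((List.count_le_length).trans h)).symm

end Words

lemma count_true_add_count_false (w : List Bool) : w.count true + w.count false = w.length := by
  induction w with
  | nil => rfl
  | cons b w ih => cases b <;> simp <;> omega

namespace IsCocyclic

variable {C : CocyclicData.{u, w} k} (hC : C.IsCocyclic)

include hC

lemma s_wd {d : ℕ} {x : C.Tot} (hx : x ∈ C.deg d) {a j : ℕ} (ha : a ≤ j) (w : List Bool)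
    (h : j + 1 + w.length ≤ d) : C.s a (C.wd (j + 1) w x) = C.wd j w (C.s a x) := by
  induction w generalizing j with
  | nil => rfl
  | cons b w ih =>
    rw [List.length_cons] at h
    have hc := List.count_le_length (l := w) (a := false)
    cases b
    · rw [wd_cons_false, wd_cons_false, ← ih (by omega) (by omega),
        hC.s_s (wd_mem_sub hx _ w (by omega)) ha (by omega)]
    · exact ih (by omega) (by omega)

lemma wd_cons_false' {d : ℕ} {x : C.Tot} (hx : x ∈ C.deg d) (j : ℕ) (w : List Bool)
    (h : j + 1 + w.length ≤ d) : C.wd j (false :: w) x = C.wd j w (C.s j x) :=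
  hC.s_wd hx le_rfl w h

lemma wd_append_false {d : ℕ} {x : C.Tot} (hx : x ∈ C.deg d) (u v : List Bool)
    (h : u.length + 1 + v.length ≤ d) :
    C.wd 0 (u ++ false :: v) x = C.wd 0 (u ++ v) (C.s u.length x) := by
  rw [wd_append, Nat.zero_add, hC.wd_cons_false' hx _ _ h, wd_append, Nat.zero_add]

lemma s_wd_of_le {d : ℕ} {x : C.Tot} (hx : x ∈ C.deg d) {a j : ℕ} (w : List Bool)
    (ha : j + w.count true ≤ a) (h : a + w.count false + 1 ≤ d) :
    C.s a (C.wd j w x) = C.wd j w (C.s (a + w.count false) x) := by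
  induction w generalizing j a with
  | nil => rfl
  | cons b w ih =>
    have hc := count_true_add_count_false w
    cases b
    · rw [List.count_cons_self, List.count_cons_of_ne (by decide)] at *
      rw [wd_cons_false, wd_cons_false, hC.s_s (wd_mem_sub hx _ w (by omega)) (by omega) (by omega),
        ih (by omega) (by omega), show a + 1 + w.count false = a + (w.count false + 1) by omega]
    · rw [List.count_cons_self, List.count_cons_of_ne (by decide)] at *
      exact ih (by omega) (by omega)

/-- Removing a kept step. -/
lemma s_wd_append_true {d : ℕ} {x : C.Tot} (hx : x ∈ C.deg d) (u v : List Bool)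
    (h : u.length + 1 + v.length ≤ d) :
    C.s (u.count true) (C.wd 0 (u ++ true :: v) x) = C.wd 0 (u ++ false :: v) x := by
  have hc := count_true_add_count_false u
  have hv := List.count_le_length (l := v) (a := false)
  rw [wd_append, wd_append, Nat.zero_add, wd_cons_true, wd_cons_false,
    hC.s_wd_of_le (wd_mem_sub hx _ v (by omega)) u (by omega) (by omega), hc]

lemma wd_cof {d : ℕ} {x : C.Tot} (hx : x ∈ C.deg d) {a j : ℕ} (ha : a ≤ j) (w : List Bool)
    (h : j + w.length ≤ d) : C.wd (j + 1) w (C.cof a x) = C.cof a (C.wd j w x) := by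
  induction w generalizing j with
  | nil => rfl
  | cons b w ih =>
    rw [List.length_cons] at h
    have hc := List.count_le_length (l := w) (a := false)
    cases b
    · rw [wd_cons_false, wd_cons_false, ih (by omega) (by omega),
        hC.s_cof_lt (wd_mem_sub hx _ w (by omega)) (by omega) (by omega), Nat.add_sub_cancel]
    · exact ih (by omega) (by omega)

lemma wd_cof_of_lt {d : ℕ} {x : C.Tot} (hx : x ∈ C.deg d) {a j : ℕ} (w : List Bool)
    (ha : j + w.length + 1 ≤ a) (h : a ≤ d + 1) :
    C.wd j w (C.cof a x) = C.cof (a - w.count false) (C.wd j w x) := by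
  induction w generalizing j with
  | nil => rfl
  | cons b w ih =>
    rw [List.length_cons] at ha
    have hc := List.count_le_length (l := w) (a := false)
    cases b
    · rw [wd_cons_false, wd_cons_false, ih (by omega),
        hC.s_cof_gt (wd_mem_sub hx _ w (by omega)) (by omega) (by omega), List.count_cons_self,
        Nat.sub_sub]
    · rw [wd_cons_true, List.count_cons_of_ne (by decide)]
      exact ih (by omega)

/-- The coface between two kept steps. -/
lemma wd_cof_true_true {d : ℕ} {x : C.Tot} (hx : x ∈ C.deg d) (u v : List Bool)
    (h : u.length + 1 + v.length ≤ d) :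
    C.wd 0 (u ++ true :: true :: v) (C.cof (u.length + 1) x) =
      C.cof (u.count true + 1) (C.wd 0 (u ++ true :: v) x) := by
  have hc := count_true_add_count_false u
  have hv := List.count_le_length (l := v) (a := false)
  rw [wd_append, wd_append, Nat.zero_add, wd_cons_true, wd_cons_true, wd_cons_true,
    hC.wd_cof hx le_rfl v h, hC.wd_cof_of_lt (wd_mem_sub hx _ v (by omega)) u (by omega) (by omega)]
  congr 2
  omega

lemma wd_cof_true_false {d : ℕ} {x : C.Tot} (hx : x ∈ C.deg d) (u v : List Bool)
    (h : u.length + 1 + v.length ≤ d) :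
    C.wd 0 (u ++ true :: false :: v) (C.cof (u.length + 1) x) = C.wd 0 (u ++ true :: v) x := by
  have hv := List.count_le_length (l := v) (a := false)
  rw [wd_append, wd_append, Nat.zero_add, wd_cons_true, wd_cons_false, wd_cons_true,
    hC.wd_cof hx le_rfl v h, hC.s_cof_self (wd_mem_sub hx _ v (by omega)) (by omega)]

lemma wd_cof_false {d : ℕ} {x : C.Tot} (hx : x ∈ C.deg d) (u v : List Bool) (b : Bool)
    (h : u.length + 1 + v.length ≤ d) :
    C.wd 0 (u ++ false :: b :: v) (C.cof (u.length + 1) x) = C.wd 0 (u ++ b :: v) x := by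
  have hv := List.count_le_length (l := v) (a := false)
  rw [wd_append, wd_append, Nat.zero_add, wd_cons_false]
  cases b
  · rw [wd_cons_false, wd_cons_false, hC.wd_cof hx le_rfl v h,
      hC.s_cof_self (wd_mem_sub hx _ v (by omega)) (by omega)]
  · rw [wd_cons_true, wd_cons_true, hC.wd_cof hx le_rfl v h,
      hC.s_cof_succ (wd_mem_sub hx _ v (by omega)) (by omega)]

lemma wd_cons_true_cof_zero {d : ℕ} {x : C.Tot} (hx : x ∈ C.deg d) (w : List Bool)
    (h : w.length ≤ d) : C.wd 0 (true :: w) (C.cof 0 x) = C.cof 0 (C.wd 0 w x) :=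
  hC.wd_cof hx le_rfl w (by omega)

lemma wd_cons_false_cof_zero {d : ℕ} {x : C.Tot} (hx : x ∈ C.deg d) (w : List Bool)
    (h : w.length ≤ d) : C.wd 0 (false :: w) (C.cof 0 x) = C.wd 0 w x := by
  rw [wd_cons_false, hC.wd_cof hx le_rfl w (by omega),
    hC.s_cof_self (wd_mem_sub hx _ w h) (by omega)]

lemma wd_append_true_cof {d : ℕ} {x : C.Tot} (w : List Bool) (h : w.length = d)
    (hx : x ∈ C.deg d) : C.wd 0 (w ++ [true]) (C.cof (d + 1) x) =
      C.cof (w.count true + 1) (C.wd 0 w x) := by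
  have hc := count_true_add_count_false w
  rw [wd_append_true, hC.wd_cof_of_lt hx w (by omega) (by omega)]
  congr 2
  omega

lemma wd_append_false_cof {d : ℕ} {x : C.Tot} (w : List Bool) (h : w.length = d)
    (hx : x ∈ C.deg d) : C.wd 0 (w ++ [false]) (C.cof (d + 1) x) = C.wd 0 w x := by
  rw [wd_append, Nat.zero_add, h, wd_cons_false, wd_nil, hC.s_cof_succ hx le_rfl]

lemma t_wd {d : ℕ} {x : C.Tot} (hx : x ∈ C.deg d) {j : ℕ} (w : List Bool)
    (h : j + 1 + w.length ≤ d) : C.t (C.wd (j + 1) w x) = C.wd j w (C.t x) := by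
  induction w generalizing j with
  | nil => rfl
  | cons b w ih =>
    rw [List.length_cons] at h
    have hc := List.count_le_length (l := w) (a := false)
    cases b
    · rw [wd_cons_false, wd_cons_false,
        hC.t_s (wd_mem_sub hx _ w (by omega)) (by omega) (by omega), ih (by omega),
        Nat.add_sub_cancel]
    · exact ih (by omega)

/-- Rotation of a degeneracy word around one of its kept steps. -/
lemma t_pow_wd {d : ℕ} {x : C.Tot} (hx : x ∈ C.deg d) (u v : List Bool)
    (h : d = u.length + 1 + v.length) :
    (C.t ^ (u.count true + 1)) (C.wd 0 (u ++ true :: v) x) =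
      C.wd 0 (v ++ true :: u) ((C.t ^ (u.length + 1)) x) := by
  induction u generalizing v d x with
  | nil =>
    rw [List.nil_append, wd_cons_true, wd_append_true]
    exact hC.t_wd hx v (by simp at h; omega)
  | cons b u ih =>
    rw [List.length_cons] at h ⊢
    cases b
    · rw [List.count_cons_of_ne (by decide), List.cons_append,
        hC.wd_cons_false' hx _ _ (by simp; omega),
        ih (s_mem hx 0 (m := d - 1) (by omega)) v (by omega),
        hC.t_pow_s_of_lt hx (by omega) (by omega) (by omega),
        show v ++ true :: false :: u = (v ++ [true]) ++ false :: u by simp,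
        hC.wd_append_false (t_pow_mem hx _) _ _ (by simp; omega), List.append_assoc,
        show 0 + d - (u.length + 1) = (v ++ [true]).length by simp; omega]
      rfl
    · rw [List.count_cons_self, t_pow_succ, List.cons_append, wd_cons_true,
        hC.t_wd hx _ (by simp; omega), ← wd_append_true, List.append_assoc, List.cons_append,
        ih (t_mem hx) _ (by simp; omega), t_pow_succ (u.length + 1), List.append_assoc]
      rfl

/-- The rotated extra codegeneracies of a degeneracy word. -/
lemma extra_wd {d : ℕ} {x : C.Tot} (hx : x ∈ C.deg d) (u v : List Bool)
    (h : d = u.length + 1 + v.length) :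
    C.extra ((u ++ true :: v).count true) (u.count true) (C.wd 0 (u ++ true :: v) x) =
      C.wd 0 (v ++ u) (C.s v.length ((C.t ^ (u.length + 1)) x)) := by
  rw [extra_apply, hC.t_pow_wd hx u v h, List.count_append, List.count_cons_self,
    show u.count true + (v.count true + 1) - u.count true - 1 = v.count true by omega,
    hC.s_wd_append_true (t_pow_mem hx _) v u (by omega),
    hC.wd_append_false (t_pow_mem hx _) v u (by omega)]

lemma extra_wd_eq_wd_extra {d : ℕ} {x : C.Tot} (hx : x ∈ C.deg d) (u v : List Bool)
    (h : d = u.length + 1 + v.length) :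
    C.extra ((u ++ true :: v).count true) (u.count true) (C.wd 0 (u ++ true :: v) x) =
      C.wd 0 (v ++ u) (C.extra d u.length x) := by
  rw [hC.extra_wd hx u v h, extra_apply, show d - u.length - 1 = v.length by omega]

end IsCocyclic

end CocyclicData

end HopfCyclic

namespace HopfCyclic

universe u v w

namespace CocyclicData

variable {k : Type u} [Field k]

/-! ### The periodic supercomplex of a cocyclic module -/

section Differentials

variable (C : CocyclicData.{u, w} k)

/-- Connes' operator without the factor `1 - λ`, on degree `d`. -/
def connes (d : ℕ) : Module.End k C.Tot :=
  ∑ r ∈ Finset.range d, (-1 : k) ^ (r * (d - 1)) • C.extra d r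

variable {C}

lemma connes_apply (d : ℕ) (x : C.Tot) :
    C.connes d x = ∑ r ∈ Finset.range d, (-1 : k) ^ (r * (d - 1)) • C.extra d r x := by
  simp only [connes, LinearMap.sum_apply, LinearMap.smul_apply]

lemma connes_mem {n m : ℕ} {x : C.Tot} (hx : x ∈ C.deg n) (d : ℕ) (h : n = m + 1) :
    C.connes d x ∈ C.deg m := by
  rw [connes_apply]
  exact Submodule.sum_mem _ fun r _ => Submodule.smul_mem _ _ (extra_mem hx d r h)

lemma b_apply {d : ℕ} {x : C.Tot} (hx : x ∈ C.deg d) :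
    C.b x = ∑ i ∈ Finset.range (d + 2), (-1 : k) ^ i • C.cof i x := by
  obtain ⟨x, rfl⟩ := hx
  rw [b, DirectSum.toModule_lof, LinearMap.comp_apply, LinearMap.sum_apply, map_sum]
  refine Finset.sum_congr rfl fun i _ => ?_
  rw [cof_lof, LinearMap.smul_apply, map_smul]

lemma b_mem {d : ℕ} {x : C.Tot} (hx : x ∈ C.deg d) : C.b x ∈ C.deg (d + 1) := by
  rw [b_apply hx]
  exact Submodule.sum_mem _ fun i _ => Submodule.smul_mem _ _ (cof_mem hx i rfl)

lemma B_of_deg_zero {x : C.Tot} (hx : x ∈ C.deg 0) : C.B x = 0 := by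
  obtain ⟨x, rfl⟩ := hx
  rw [B, DirectSum.toModule_lof]; rfl

lemma B_mem {n m : ℕ} {x : C.Tot} (hx : x ∈ C.deg n) (h : n = m + 1) : C.B x ∈ C.deg m := by
  subst h
  obtain ⟨x, rfl⟩ := hx
  rw [B, DirectSum.toModule_lof]
  exact lof_mem_deg _ _

lemma lof_norm_pow (n r : ℕ) (x : C.obj n) :
    DirectSum.lof k ℕ C.obj n ((((-1 : k) ^ n • (C.τ n : Module.End k (C.obj n))) ^ r) x) =
      (-1 : k) ^ (r * n) • (C.t ^ r) (DirectSum.lof k ℕ C.obj n x) := by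
  rw [smul_pow, LinearMap.smul_apply, map_smul, t_pow_lof, ← pow_mul, mul_comm]

end Differentials

namespace IsCocyclic

variable {C : CocyclicData.{u, w} k} (hC : C.IsCocyclic)

include hC

lemma extra_eq {d : ℕ} {x : C.Tot} (hx : x ∈ C.deg (d + 1)) {r : ℕ} (hr : r ≤ d) :
    C.extra (d + 1) r x = (C.t ^ r) (C.s d (C.t x)) := by
  rw [hC.t_pow_s_of_le (t_mem hx) hr le_rfl, extra_apply, t_pow_succ,
    show d + 1 - r - 1 = d - r by omega]

/-- Connes' operator agrees with `connes` up to a term that vanishes on normalized cochains. -/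
lemma exists_B_eq (d : ℕ) : ∃ R : Module.End k C.Tot, ∀ x ∈ C.deg d,
    C.B x = C.connes d x + R (C.s 0 x) := by
  cases d with
  | zero =>
    refine ⟨0, fun x hx => ?_⟩
    rw [B_of_deg_zero hx, connes_apply]; simp
  | succ n =>
    refine ⟨-∑ r ∈ Finset.range (n + 1), (-1 : k) ^ (r * n) • (-1 : k) ^ (n + 1) • (C.t ^ (r + 1)),
      fun x hx => ?_⟩
    rw [connes_apply]
    have h1 : ∀ r ∈ Finset.range (n + 1), (-1 : k) ^ (r * (n + 1 - 1)) • C.extra (n + 1) r x =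
        (-1 : k) ^ (r * n) • (C.t ^ r) (C.s n (C.t x)) := fun r hr => by
      rw [hC.extra_eq hx (Nat.lt_succ_iff.1 (Finset.mem_range.1 hr)), Nat.add_sub_cancel]
    rw [Finset.sum_congr rfl h1]
    have h2 : ∀ r : ℕ, (C.t ^ (r + 1)) (C.s 0 x) = (C.t ^ r) (C.s n (C.t (C.t x))) := fun r => by
      rw [t_pow_succ, hC.t_s_zero hx (by omega), Nat.add_sub_cancel]
    rw [LinearMap.neg_apply, LinearMap.sum_apply]
    simp only [LinearMap.smul_apply, h2]
    rw [← Finset.sum_neg_distrib, ← Finset.sum_add_distrib]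
    obtain ⟨x, rfl⟩ := hx
    rw [B, DirectSum.toModule_lof]
    simp only [LinearMap.comp_apply, LinearMap.sub_apply, LinearMap.id_apply, LinearMap.smul_apply,
      map_sub, map_smul, LinearMap.sum_apply, map_sum, lof_norm_pow]
    rw [Finset.smul_sum, ← Finset.sum_sub_distrib]
    refine Finset.sum_congr rfl fun r _ => ?_
    rw [← s_lof, ← t_lof, ← s_lof, ← t_lof, ← t_lof, sub_eq_add_neg, smul_comm]

/-- A codegeneracy after a rotated extra codegeneracy factors through a codegeneracy. -/
lemma exists_s_extra {d a r : ℕ} (ha : a + 2 ≤ d) (hr : r < d) :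
    ∃ (F : Module.End k C.Tot) (m : ℕ), m < d ∧ ∀ x ∈ C.deg d, C.s a (C.extra d r x) =
      F (C.s m x) := by
  rcases le_or_gt (d - r - 1) a with h | h
  · refine ⟨C.s (d - r - 1) * C.t ^ r, a + r + 1 - d, by omega, fun x hx => ?_⟩
    rw [extra_apply, hC.s_s (t_pow_mem hx _) h ha, Module.End.mul_apply,
      hC.t_pow_s_of_lt hx (by omega) (by omega) (by omega),
      show a + r + 1 - d + d - r = a + 1 by omega]
  · refine ⟨C.s (d - r - 2) * C.t ^ (r + 1), a + r + 1, by omega, fun x hx => ?_⟩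
    have := hC.s_s (t_pow_mem hx (r + 1)) (show a ≤ d - r - 2 by omega) (by omega)
    rw [show d - r - 2 + 1 = d - r - 1 by omega] at this
    rw [extra_apply, ← this, Module.End.mul_apply, hC.t_pow_s_of_le hx (by omega) (by omega),
      show a + r + 1 - (r + 1) = a by omega]

/-- The extra codegeneracy after its `r`-th rotation factors through the `r`-th codegeneracy. -/
lemma exists_s_t_extra {d r : ℕ} (hd : 2 ≤ d) (hr : r < d) :
    ∃ F : Module.End k C.Tot, ∀ x ∈ C.deg d, C.s (d - 2) (C.t (C.extra d r x)) = F (C.s r x) := by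
  rcases Nat.lt_or_ge r (d - 1) with h | h
  · refine ⟨C.s (d - r - 2) * C.t ^ (r + 1), fun x hx => ?_⟩
    rw [extra_apply, hC.t_s (t_pow_mem hx _) (by omega) (by omega), Module.End.mul_apply,
      hC.t_pow_s_of_lt hx (by omega) (by omega) (by omega), ← Module.End.mul_apply C.t,
      ← pow_succ', show d - r - 1 - 1 = d - r - 2 by omega,
      hC.s_s (t_pow_mem hx _) (by omega) (by omega),
      show r + d - (r + 1) = d - 2 + 1 by omega]
  · refine ⟨C.s (d - 2) * C.t, fun x hx => ?_⟩
    obtain rfl : r = d - 1 := by omega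
    have e : (C.t ^ d) x = (C.t ^ (d - 1 + 1)) x := by rw [Nat.sub_add_cancel (by omega)]
    rw [extra_apply, show d - (d - 1) - 1 = 0 by omega, ← e,
      hC.t_s_zero (t_pow_mem hx _) (by omega), ← Module.End.mul_apply C.t (C.t ^ d),
      ← pow_succ', hC.t_pow_self hx, Module.End.mul_apply, hC.t_s hx (by omega) (by omega)]
    have := hC.s_s (t_mem hx) (le_refl (d - 2)) (by omega)
    rw [show d - 2 + 1 = d - 1 by omega] at this
    rw [← this, show d - 1 - 1 = d - 2 by omega]

lemma exists_extra_extra {d r r' : ℕ} (hd : 2 ≤ d) (hr : r < d) (hr' : r' < d - 1) :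
    ∃ F : Module.End k C.Tot, ∀ x ∈ C.deg d, C.extra (d - 1) r' (C.extra d r x) =
      F (C.s r x) := by
  obtain ⟨F, hF⟩ := hC.exists_s_t_extra hd hr
  refine ⟨C.t ^ r' * F, fun x hx => ?_⟩
  have h : C.extra d r x ∈ C.deg (d - 2 + 1) := extra_mem hx _ _ (by omega)
  rw [show d - 1 = d - 2 + 1 by omega, hC.extra_eq h (by omega), hF x hx, Module.End.mul_apply]

lemma connes_b {d : ℕ} {x : C.Tot} (hx : x ∈ C.deg d) :
    C.connes (d + 1) (C.b x) = -∑ a ∈ Finset.range (d + 1), (-1 : k) ^ a •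
      C.cof a (C.connes d x) := by
  have h0 := hC.sum_extra_cof hx (fun _ => 1)
  simp only [mul_one] at h0
  rw [Finset.sum_comm (s := Finset.range d) (t := Finset.range (d + 1)) (f := fun p a =>
    ((-1 : k) ^ a * (-1) ^ (p * (d - 1))) • C.cof a (C.extra d p x))] at h0
  have h1 : ∀ a, C.cof a (C.connes d x) = ∑ p ∈ Finset.range d, (-1 : k) ^ (p * (d - 1)) •
      C.cof a (C.extra d p x) := fun a => by
    rw [connes_apply, map_sum]
    exact Finset.sum_congr rfl fun p _ => map_smul _ _ _
  simp only [h1, Finset.smul_sum, smul_smul]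
  rw [← h0, b_apply hx, map_sum, Finset.sum_range_succ, Finset.sum_range_succ']
  have h2 : ∀ a, C.connes (d + 1) ((-1 : k) ^ a • C.cof a x) = ∑ p ∈ Finset.range (d + 1),
      ((-1 : k) ^ a * (-1) ^ (p * d)) • C.extra (d + 1) p (C.cof a x) := fun a => by
    rw [map_smul, connes_apply, Finset.smul_sum]
    exact Finset.sum_congr rfl fun p _ => by rw [smul_smul, Nat.add_sub_cancel]
  simp only [h2]
  rw [add_assoc, add_eq_left, ← Finset.sum_add_distrib]
  have h3 : ∀ p ∈ Finset.range (d + 1),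
      ((-1 : k) ^ 0 * (-1) ^ (p * d)) • C.extra (d + 1) p (C.cof 0 x) +
      ((-1 : k) ^ (d + 1) * (-1) ^ (p * d)) • C.extra (d + 1) p (C.cof (d + 1) x) =
      (-1 : k) ^ (p * d) • (C.t ^ p) x - (-1 : k) ^ ((p + 1) * d) • (C.t ^ (p + 1)) x := by
    intro p hp
    have hp : p ≤ d := Nat.lt_succ_iff.1 (Finset.mem_range.1 hp)
    rw [hC.extra_cof_zero hx hp, hC.extra_cof_last hx hp, pow_zero, one_mul, sub_eq_add_neg,
      ← neg_smul]
    congr 2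
    ring
  rw [Finset.sum_congr rfl h3, Finset.sum_range_sub', hC.t_pow_self hx]
  have : (-1 : k) ^ ((d + 1) * d) = 1 := by
    rw [mul_comm]; exact (Nat.even_mul_succ_self d).neg_one_pow
  rw [this]
  simp

end IsCocyclic

lemma alternating_sum_eq_zero {V : Type*} [AddCommGroup V] [Module k V] (D : ℕ) (F : ℕ → ℕ → V)
    (hF : ∀ i j, i < j → j ≤ D → F j i = F i (j - 1)) :
    ∑ j ∈ Finset.range (D + 1), ∑ i ∈ Finset.range D, (-1 : k) ^ (i + j) • F j i = 0 := by
  induction D with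
  | zero => simp
  | succ D ih =>
    rw [Finset.sum_range_succ, Finset.sum_congr rfl fun j _ => Finset.sum_range_succ _ D,
      Finset.sum_add_distrib, ih fun i j hij hj => hF i j hij (by omega), zero_add,
      ← Finset.sum_add_distrib]
    refine Finset.sum_eq_zero fun i hi => ?_
    have hi := Finset.mem_range.1 hi
    rw [hF i (D + 1) hi le_rfl, Nat.add_sub_cancel, ← add_smul, ← add_assoc, add_comm D i, pow_succ]
    simp

namespace IsCocyclic

variable {C : CocyclicData.{u, w} k} (hC : C.IsCocyclic)

include hC

lemma b_b {d : ℕ} {x : C.Tot} (hx : x ∈ C.deg d) : C.b (C.b x) = 0 := by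
  rw [b_apply (b_mem hx), b_apply hx]
  simp only [map_sum, Finset.smul_sum, map_smul, smul_smul, ← pow_add]
  rw [← alternating_sum_eq_zero (k := k) (d + 2) (fun j i => C.cof j (C.cof i x))
    fun i j hij hj => hC.cof_cof hx hij hj]
  exact Finset.sum_congr rfl fun j _ => Finset.sum_congr rfl fun i _ => by rw [add_comm]

lemma s_b_eq_zero {d : ℕ} {x : C.Tot} (hx : x ∈ C.deg d) (h : ∀ a < d, C.s a x = 0) {a : ℕ}
    (ha : a < d + 1) : C.s a (C.b x) = 0 := by
  have ha' : a ≤ d := Nat.lt_succ_iff.1 ha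
  rw [b_apply hx, map_sum, ← Finset.sum_subset (s₁ := {a, a + 1})]
  · rw [Finset.sum_pair (by omega), map_smul, map_smul, hC.s_cof_self hx ha',
      hC.s_cof_succ hx ha', pow_succ]
    simp
  · intro i hi
    simp only [Finset.mem_insert, Finset.mem_singleton] at hi
    exact Finset.mem_range.2 (by omega)
  · intro i hi hi'
    have hi := Finset.mem_range.1 hi
    simp only [Finset.mem_insert, Finset.mem_singleton, not_or] at hi'
    rcases Nat.lt_or_gt_of_ne hi'.1 with h' | h'
    · rw [map_smul, hC.s_cof_lt hx h' ha', h _ (by omega), map_zero, smul_zero]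
    · rw [map_smul, hC.s_cof_gt hx (by omega) (by omega), h _ (by omega), map_zero, smul_zero]

lemma B_eq_connes {d : ℕ} {x : C.Tot} (hx : x ∈ C.deg d) (h : ∀ a < d, C.s a x = 0) :
    C.B x = C.connes d x := by
  obtain ⟨R, hR⟩ := hC.exists_B_eq d
  rcases Nat.eq_zero_or_pos d with rfl | hd
  · rw [B_of_deg_zero hx, connes_apply]; simp
  · rw [hR x hx, h 0 hd, map_zero, add_zero]

lemma s_connes_eq_zero {d : ℕ} {x : C.Tot} (hx : x ∈ C.deg d) (h : ∀ a < d, C.s a x = 0) {a : ℕ}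
    (ha : a + 2 ≤ d) : C.s a (C.connes d x) = 0 := by
  rw [connes_apply, map_sum]
  refine Finset.sum_eq_zero fun r hr => ?_
  obtain ⟨F, m, hm, hF⟩ := hC.exists_s_extra ha (Finset.mem_range.1 hr)
  rw [map_smul, hF x hx, h m hm, map_zero, smul_zero]

lemma connes_connes_eq_zero {d : ℕ} {x : C.Tot} (hx : x ∈ C.deg d) (h : ∀ a < d, C.s a x = 0) :
    C.connes (d - 1) (C.connes d x) = 0 := by
  rw [connes_apply]
  refine Finset.sum_eq_zero fun r' hr' => ?_
  have hr' := Finset.mem_range.1 hr'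
  rw [connes_apply, map_sum, Finset.sum_eq_zero fun r hr => ?_, smul_zero]
  have hr := Finset.mem_range.1 hr
  obtain ⟨F, hF⟩ := hC.exists_extra_extra (r := r) (r' := r') (show 2 ≤ d by omega) hr hr'
  rw [map_smul, hF x hx, h r hr, map_zero, smul_zero]

end IsCocyclic

section Normalized

variable {C : CocyclicData.{u, w} k}

lemma mem_normalized {d : ℕ} {x : C.Tot} (hx : x ∈ C.deg d) (h : ∀ a < d, C.s a x = 0)
    {i : ZMod 2} (hi : (d : ZMod 2) = i) : x ∈ C.normalized i := by
  obtain ⟨x, rfl⟩ := hx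
  refine ⟨fun n hn => ?_, fun n a ha => ?_⟩
  · rw [DirectSum.lof_eq_of, DirectSum.of_eq_of_ne _ _ _ (by rintro rfl; exact hn hi)]
  · by_cases hd : n + 1 = d
    · subst hd
      rw [DirectSum.lof_eq_of, DirectSum.of_eq_same]
      have := h a (by omega)
      rw [s_lof] at this
      exact DirectSum.of_injective _ (this.trans (map_zero _).symm)
    · rw [DirectSum.lof_eq_of, DirectSum.of_eq_of_ne _ _ _ hd, map_zero]

lemma normalized_induction {i : ZMod 2} {p : ∀ x : C.Tot, x ∈ C.normalized i → Prop}
    (h0 : p 0 (Submodule.zero_mem _))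
    (hadd : ∀ x y hx hy, p x hx → p y hy → p (x + y) (Submodule.add_mem _ hx hy))
    (hdeg : ∀ (d : ℕ) (hd : (d : ZMod 2) = i) (x : C.obj d)
      (h : ∀ a < d, C.s a (DirectSum.lof k ℕ C.obj d x) = 0),
      p (DirectSum.lof k ℕ C.obj d x) (mem_normalized (lof_mem_deg d x) h hd))
    {x : C.Tot} (hx : x ∈ C.normalized i) : p x hx := by
  classical
  suffices h : ∃ h, p (∑ n ∈ DFinsupp.support x, DirectSum.of C.obj n (x n)) h by
    obtain ⟨h, hp⟩ := h
    have e := DirectSum.sum_support_of x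
    simpa only [e] using hp
  refine Finset.sum_induction _ (fun y => ∃ h, p y h)
    (fun a b ⟨ha, ha'⟩ ⟨hb, hb'⟩ => ⟨_, hadd a b ha hb ha' hb'⟩) ⟨_, h0⟩ fun n hn => ?_
  have hn : x n ≠ 0 := DFinsupp.mem_support_iff.1 hn
  rw [← DirectSum.lof_eq_of k]
  refine ⟨_, hdeg n (by_contra fun h => hn (hx.1 n h)) (x n) fun a ha => ?_⟩
  obtain ⟨m, rfl⟩ := Nat.exists_eq_add_of_le' (show 1 ≤ n by omega)
  rw [s_lof, hx.2 m a (by omega), map_zero]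

theorem IsCocyclic.isSupercomplex_periodic (hC : C.IsCocyclic) : C.periodic.IsSupercomplex := by
  intro i x hx
  change (C.b + C.B) x ∈ C.normalized (i + 1) ∧ (C.b + C.B) ((C.b + C.B) x) = 0
  change x ∈ C.normalized i at hx
  induction hx using normalized_induction with
  | h0 => rw [map_zero, map_zero]; exact ⟨Submodule.zero_mem _, rfl⟩
  | hadd x y _ _ hx hy =>
    rw [map_add, map_add, hx.2, hy.2, add_zero]
    exact ⟨Submodule.add_mem _ hx.1 hy.1, rfl⟩
  | hdeg d hd y h =>
    have hx := lof_mem_deg (C := C) d y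
    generalize DirectSum.lof k ℕ C.obj d y = x at hx h
    clear y
    have hb : ∀ a < d + 1, C.s a (C.b x) = 0 := fun a ha => hC.s_b_eq_zero hx h ha
    rw [LinearMap.add_apply, LinearMap.add_apply, map_add, map_add, hC.b_b hx, zero_add,
      hC.B_eq_connes (b_mem hx) hb, hC.connes_b hx, hC.B_eq_connes hx h]
    have h1 : C.b x ∈ C.normalized (i + 1) := mem_normalized (b_mem hx) hb (by rw [← hd]; simp)
    rcases Nat.eq_zero_or_pos d with rfl | hd'
    · have : C.connes 0 x = 0 := by rw [connes_apply]; simp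
      rw [this]
      refine ⟨by rwa [add_zero], ?_⟩
      simp
    · obtain ⟨n, rfl⟩ := Nat.exists_eq_add_of_le' hd'
      have hc := connes_mem hx (n + 1) rfl
      have hs : ∀ a < n, C.s a (C.connes (n + 1) x) = 0 := fun a ha =>
        hC.s_connes_eq_zero hx h (by omega)
      rw [hC.B_eq_connes hc hs]
      have h2 := hC.connes_connes_eq_zero hx h
      rw [Nat.add_sub_cancel] at h2
      rw [h2, add_zero, b_apply hc]
      refine ⟨Submodule.add_mem _ h1 (mem_normalized hc hs ?_), by simp⟩
      rw [← hd, Nat.cast_add, add_assoc]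
      simp [show (1 : ZMod 2) + 1 = 0 from rfl]

end Normalized

end CocyclicData

end HopfCyclic

namespace HopfCyclic

universe u v w

namespace CocyclicData

/-! ### Sums over words -/

section WordSums

/-- The words of length `n` in two letters. The letter `true` is a step of the first factor, the
letter `false` a step of the second factor. -/
def words : ℕ → Finset (List Bool)
  | 0 => {[]}
  | n + 1 => ((words n).map ⟨List.cons true, List.cons_injective⟩).disjUnion
      ((words n).map ⟨List.cons false, List.cons_injective⟩) (by
        rw [Finset.disjoint_left]
        intro a ha hb
        obtain ⟨u, _, rfl⟩ := Finset.mem_map.1 ha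
        obtain ⟨v, _, hv⟩ := Finset.mem_map.1 hb
        simp at hv)

variable {V : Type*} [AddCommMonoid V]

lemma mem_words {n : ℕ} {w : List Bool} : w ∈ words n ↔ w.length = n := by
  induction n generalizing w with
  | zero => simp [words]
  | succ n ih =>
    rw [words, Finset.mem_disjUnion, Finset.mem_map, Finset.mem_map]
    constructor
    · rintro (⟨u, hu, rfl⟩ | ⟨u, hu, rfl⟩) <;> simp [ih.1 hu]
    · intro h
      cases w with
      | nil => simp at h
      | cons b w =>
        have hw : w ∈ words n := ih.2 (by simpa using h)
        cases b
        · exact Or.inr ⟨w, hw, rfl⟩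
        · exact Or.inl ⟨w, hw, rfl⟩

lemma sum_words_zero (f : List Bool → V) : ∑ w ∈ words 0, f w = f [] := by simp [words]

lemma sum_words_succ (n : ℕ) (f : List Bool → V) : ∑ w ∈ words (n + 1), f w =
    ∑ w ∈ words n, f (true :: w) + ∑ w ∈ words n, f (false :: w) := by
  rw [words, Finset.sum_disjUnion, Finset.sum_map, Finset.sum_map]; rfl

lemma sum_words_add (m n : ℕ) (f : List Bool → V) : ∑ w ∈ words (m + n), f w =
    ∑ u ∈ words m, ∑ v ∈ words n, f (u ++ v) := by
  induction m generalizing f with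
  | zero => rw [sum_words_zero, Nat.zero_add]; rfl
  | succ m ih =>
    rw [show m + 1 + n = m + n + 1 by omega, sum_words_succ, sum_words_succ, ih, ih]
    rfl

lemma sum_words_succ' (n : ℕ) (f : List Bool → V) : ∑ w ∈ words (n + 1), f w =
    ∑ w ∈ words n, f (w ++ [true]) + ∑ w ∈ words n, f (w ++ [false]) := by
  rw [sum_words_add, ← Finset.sum_add_distrib]
  refine Finset.sum_congr rfl fun u _ => ?_
  rw [sum_words_succ, sum_words_zero, sum_words_zero]

/-- Words with a marked letter `c`. -/
lemma sum_words_marked (c : Bool) (n : ℕ) (g : List Bool → ℕ → V) :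
    ∑ w ∈ words n, ∑ a ∈ Finset.range (w.count c), g w a =
      ∑ m ∈ Finset.range n, ∑ u ∈ words m, ∑ v ∈ words (n - (m + 1)),
        g (u ++ c :: v) (u.count c) := by
  induction n generalizing g with
  | zero => rw [sum_words_zero]; simp
  | succ n ih =>
    have h1 : ∑ w ∈ words n, ∑ a ∈ Finset.range ((c :: w).count c), g (c :: w) a =
        ∑ m ∈ Finset.range n, ∑ u ∈ words m, ∑ v ∈ words (n - (m + 1)),
          g (c :: (u ++ c :: v)) ((c :: u).count c) + ∑ v ∈ words n, g (c :: v) 0 := by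
      have := ih fun w a => g (c :: w) (a + 1)
      simp only [List.count_cons_self, Finset.sum_range_succ', Finset.sum_add_distrib]
      rw [this]
    have h2 : ∑ w ∈ words n, ∑ a ∈ Finset.range (((!c) :: w).count c), g ((!c) :: w) a =
        ∑ m ∈ Finset.range n, ∑ u ∈ words m, ∑ v ∈ words (n - (m + 1)),
          g ((!c) :: (u ++ c :: v)) (((!c) :: u).count c) := by
      have := ih fun w a => g ((!c) :: w) a
      have hc : ∀ w : List Bool, ((!c) :: w).count c = w.count c := fun w =>
        List.count_cons_of_ne (by cases c <;> decide)
      simp only [hc]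
      exact this
    have h3 : ∀ (m : ℕ) (f : List Bool → V), ∑ w ∈ words (m + 1), f w =
        ∑ w ∈ words m, f (c :: w) + ∑ w ∈ words m, f ((!c) :: w) := fun m f => by
      rw [sum_words_succ]
      cases c
      · rw [add_comm]; rfl
      · rfl
    rw [h3, h1, h2, Finset.sum_range_succ', sum_words_zero]
    simp only [h3, Finset.sum_add_distrib, Nat.add_sub_add_right]
    rw [add_right_comm]
    rfl

end WordSums

/-! ### Signs and orders of words -/

section WordSigns

variable (k : Type u) [Field k]

lemma neg_one_pow_eq_of_add {a b s t : ℕ} (h : a + 2 * s = b + 2 * t) :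
    (-1 : k) ^ a = (-1) ^ b := by
  have h1 : (-1 : k) ^ (a + 2 * s) = (-1) ^ a := by rw [pow_add, pow_mul]; simp
  have h2 : (-1 : k) ^ (b + 2 * t) = (-1) ^ b := by rw [pow_add, pow_mul]; simp
  rw [← h1, h, h2]

/-- The sign of a word, seen as a shuffle of its letters `true` with its letters `false`. -/
def sg : List Bool → k
  | [] => 1
  | true :: w => sg w
  | false :: w => (-1) ^ w.count true * sg w

lemma sg_append (u v : List Bool) :
    sg k (u ++ v) = (-1) ^ (u.count false * v.count true) * (sg k u * sg k v) := by
  induction u with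
  | nil => simp [sg]
  | cons b u ih =>
    cases b
    · rw [List.cons_append, sg, ih, sg, List.count_append, List.count_cons_self, add_mul, one_mul,
        pow_add, pow_add]
      ring
    · rw [List.cons_append, sg, ih, sg, List.count_cons_of_ne (by decide)]

/-- `precedes k w p q` is `1` if the `p`-th letter `true` of the word `w` comes before its `q`-th
letter `false`, and `0` otherwise. -/
def precedes : List Bool → ℕ → ℕ → k
  | [], _, _ => 0
  | true :: _, 0, _ => 1
  | true :: w, p + 1, q => precedes w p q
  | false :: _, _, 0 => 0
  | false :: w, p, q + 1 => precedes w p q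

lemma precedes_true_true (u v : List Bool) (p q : ℕ) :
    precedes k (u ++ true :: true :: v) p q =
      precedes k (u ++ true :: v) (if p ≤ u.count true then p else p - 1) q := by
  induction u generalizing p q with
  | nil => rcases p with _ | _ | p <;> simp [precedes]
  | cons b u ih =>
    cases b
    · cases q with
      | zero => simp [precedes]
      | succ q => simpa [precedes, List.count_cons_of_ne] using ih p q
    · cases p with
      | zero => simp [precedes]
      | succ p =>
        rw [List.cons_append, precedes, ih, List.count_cons_self, List.cons_append]
        by_cases h : p ≤ u.count true
        · rw [if_pos h, if_pos (by omega), precedes]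
        · obtain ⟨p, rfl⟩ := Nat.exists_eq_add_of_le' (show 1 ≤ p by omega)
          rw [if_neg h, if_neg (by omega)]; rfl

lemma precedes_false_false (u v : List Bool) (p q : ℕ) :
    precedes k (u ++ false :: false :: v) p q =
      precedes k (u ++ false :: v) p (if q ≤ u.count false then q else q - 1) := by
  induction u generalizing p q with
  | nil => rcases q with _ | _ | q <;> simp [precedes]
  | cons b u ih =>
    cases b
    · cases q with
      | zero => simp [precedes]
      | succ q =>
        rw [List.cons_append, precedes, ih, List.count_cons_self, List.cons_append]
        by_cases h : q ≤ u.count false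
        · rw [if_pos h, if_pos (by omega), precedes]
        · obtain ⟨q, rfl⟩ := Nat.exists_eq_add_of_le' (show 1 ≤ q by omega)
          rw [if_neg h, if_neg (by omega)]; rfl
    · cases p with
      | zero => simp [precedes]
      | succ p => simpa [precedes, List.count_cons_of_ne] using ih p q

lemma precedes_swap (u v : List Bool) (p q : ℕ) :
    precedes k (u ++ true :: false :: v) p q - precedes k (u ++ false :: true :: v) p q =
      if p = u.count true ∧ q = u.count false then 1 else 0 := by
  induction u generalizing p q with
  | nil => cases p <;> cases q <;> simp [precedes]
  | cons b u ih =>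
    cases b
    · cases q with
      | zero => simp [precedes]
      | succ q => simpa [precedes, List.count_cons_of_ne] using ih p q
    · cases p with
      | zero => simp [precedes]
      | succ p => simpa [precedes, List.count_cons_of_ne] using ih p q

lemma precedes_of_le_of_lt (w : List Bool) {p q : ℕ} (hp : w.count true ≤ p)
    (hq : q < w.count false) : precedes k w p q = 0 := by
  induction w generalizing p q with
  | nil => rfl
  | cons b w ih =>
    cases b
    · cases q with
      | zero => simp [precedes]
      | succ q => simp at hp hq; exact ih hp hq
    · cases p with
      | zero => simp at hp
      | succ p => simp at hp hq; exact ih hp hq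

lemma precedes_of_lt_of_le (w : List Bool) {p q : ℕ} (hp : p < w.count true)
    (hq : w.count false ≤ q) : precedes k w p q = 1 := by
  induction w generalizing p q with
  | nil => simp at hp
  | cons b w ih =>
    cases b
    · cases q with
      | zero => simp at hq
      | succ q => simp at hp hq; exact ih hp hq
    · cases p with
      | zero => simp [precedes]
      | succ p => simp at hp hq; exact ih hp hq

lemma precedes_append_true (w : List Bool) {p q : ℕ} (hq : q < w.count false) :
    precedes k (w ++ [true]) p q = precedes k w p q := by
  induction w generalizing p q with
  | nil => simp at hq
  | cons b w ih =>
    cases b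
    · cases q with
      | zero => simp [precedes]
      | succ q => simp at hq; exact ih hq
    · cases p with
      | zero => simp [precedes]
      | succ p => simp at hq; exact ih hq

lemma precedes_append_false (w : List Bool) {p q : ℕ} (hp : p < w.count true) :
    precedes k (w ++ [false]) p q = precedes k w p q := by
  induction w generalizing p q with
  | nil => simp at hp
  | cons b w ih =>
    cases b
    · cases q with
      | zero => simp [precedes]
      | succ q => simp at hp; exact ih hp
    · cases p with
      | zero => simp [precedes]
      | succ p => simp at hp; exact ih hp

end WordSigns

end CocyclicData

end HopfCyclic

namespace HopfCyclic

universe u v w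

namespace CocyclicData

variable {k : Type u} [Field k]

/-! ### Shuffle maps as sums over words -/

section ShuffleMaps

variable (C D : CocyclicData.{u, w} k)

/-- The action of a word: the first factor loses the steps `false`, the second one the steps
`true`. -/
def pw (w : List Bool) : Module.End k (C.Tot ⊗[k] D.Tot) :=
  TensorProduct.map (C.wd 0 w) (D.wd 0 (w.map not))

lemma pw_tmul (w : List Bool) (x : C.Tot) (y : D.Tot) :
    C.pw D w (x ⊗ₜ[k] y) = C.wd 0 w x ⊗ₜ[k] D.wd 0 (w.map not) y := rfl

/-- The coefficient of a pair of rotations in the cyclic shuffle map. -/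
def cycCoeff (c e p q : ℕ) : k := (-1) ^ (c - 1) * (-1) ^ (p * (c - 1)) * (-1) ^ (q * (e - 1))

/-- The sum of the pairs of rotated extra codegeneracies over the pairs of letters of the word that
stand in the right order. -/
def cyc (w : List Bool) : Module.End k (C.Tot ⊗[k] D.Tot) :=
  ∑ p ∈ Finset.range (w.count true), ∑ q ∈ Finset.range (w.count false),
    (cycCoeff (w.count true) (w.count false) p q * precedes k w p q) •
      TensorProduct.map (C.extra (w.count true) p) (D.extra (w.count false) q)

lemma cyc_tmul (w : List Bool) (x : C.Tot) (y : D.Tot) :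
    C.cyc D w (x ⊗ₜ[k] y) =
      ∑ p ∈ Finset.range (w.count true), ∑ q ∈ Finset.range (w.count false),
        (cycCoeff (w.count true) (w.count false) p q * precedes k w p q) •
          (C.extra (w.count true) p x ⊗ₜ[k] D.extra (w.count false) q y) := by
  simp only [cyc, LinearMap.sum_apply, LinearMap.smul_apply, TensorProduct.map_tmul]

/-- The shuffle map in degree `n`, as a sum over words. -/
def wordSh (n : ℕ) : Module.End k (C.Tot ⊗[k] D.Tot) := ∑ w ∈ words n, sg k w • C.pw D w

/-- The cyclic shuffle map in degree `n`, as a sum over words. -/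
def wordCsh (n : ℕ) : Module.End k (C.Tot ⊗[k] D.Tot) :=
  ∑ w ∈ words n, sg k w • (C.cyc D w * C.pw D w)

/-- The differential of the tensor product induced by operators on both factors. -/
def tensorOp (f : Module.End k C.Tot) (g : Module.End k D.Tot) : Module.End k (C.Tot ⊗[k] D.Tot) :=
  TensorProduct.map f LinearMap.id + TensorProduct.map C.sgn g

lemma tensorOp_tmul (f : Module.End k C.Tot) (g : Module.End k D.Tot) (x : C.Tot) (y : D.Tot) :
    C.tensorOp D f g (x ⊗ₜ[k] y) = f x ⊗ₜ[k] y + C.sgn x ⊗ₜ[k] g y := rfl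

end ShuffleMaps

lemma map_not_append (u v : List Bool) : (u ++ v).map not = u.map not ++ v.map not :=
  List.map_append

lemma count_map_not (c : Bool) (u : List Bool) : (u.map not).count c = u.count (!c) := by
  induction u with
  | nil => rfl
  | cons b u ih => cases b <;> cases c <;> simp_all

namespace IsCocyclic

variable {C D : CocyclicData.{u, w} k} (hC : C.IsCocyclic) (hD : D.IsCocyclic)

include hC hD

lemma pw_inner {N r : ℕ} {x : C.Tot} (hx : x ∈ C.deg N) {y : D.Tot} (hy : y ∈ D.deg N)
    {u v : List Bool} (hu : u.length = r) (hv : r + 1 + v.length = N) :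
    C.pw D (u ++ true :: true :: v) (C.cof (r + 1) x ⊗ₜ[k] D.cof (r + 1) y) =
      C.cof (u.count true + 1) (C.wd 0 (u ++ true :: v) x) ⊗ₜ[k]
        D.wd 0 ((u ++ true :: v).map not) y ∧
    C.pw D (u ++ false :: false :: v) (C.cof (r + 1) x ⊗ₜ[k] D.cof (r + 1) y) =
      C.wd 0 (u ++ false :: v) x ⊗ₜ[k]
        D.cof (u.count false + 1) (D.wd 0 ((u ++ false :: v).map not) y) ∧
    C.pw D (u ++ true :: false :: v) (C.cof (r + 1) x ⊗ₜ[k] D.cof (r + 1) y) =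
      C.wd 0 (u ++ true :: v) x ⊗ₜ[k] D.wd 0 ((u ++ false :: v).map not) y ∧
    C.pw D (u ++ false :: true :: v) (C.cof (r + 1) x ⊗ₜ[k] D.cof (r + 1) y) =
      C.wd 0 (u ++ true :: v) x ⊗ₜ[k] D.wd 0 ((u ++ false :: v).map not) y := by
  subst hu
  have hl : (u.map not).length = u.length := List.length_map _
  have hl' : (v.map not).length = v.length := List.length_map _
  have h1 : u.length + 1 + v.length ≤ N := hv.le
  have h2 : (u.map not).length + 1 + (v.map not).length ≤ N := by omega
  simp only [pw_tmul, map_not_append, List.map_cons, Bool.not_true, Bool.not_false]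
  refine ⟨?_, ?_, ?_, ?_⟩
  · rw [hC.wd_cof_true_true hx u v h1, ← hl, hD.wd_cof_false hy _ _ _ h2]
  · rw [hC.wd_cof_false hx u v _ h1, ← hl, hD.wd_cof_true_true hy _ _ h2, count_map_not,
      Bool.not_true]
  · rw [hC.wd_cof_true_false hx u v h1, ← hl, hD.wd_cof_false hy _ _ _ h2]
  · rw [hC.wd_cof_false hx u v _ h1, ← hl, hD.wd_cof_true_false hy _ _ h2]

/-- Expansion of a sum over words after the Hochschild coboundary of the diagonal. -/
lemma sum_coboundary {V : Type*} [AddCommGroup V] [Module k V]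
    (G : List Bool → C.Tot ⊗[k] D.Tot →ₗ[k] V) {N : ℕ} {x : C.Tot} (hx : x ∈ C.deg N)
    {y : D.Tot} (hy : y ∈ D.deg N) :
    ∑ i ∈ Finset.range (N + 2), (-1 : k) ^ i • ∑ w ∈ words (N + 1),
      G w (C.pw D w (C.cof i x ⊗ₜ[k] D.cof i y)) =
    ∑ w ∈ words N,
      ((G (true :: w) (C.cof 0 (C.wd 0 w x) ⊗ₜ[k] D.wd 0 (w.map not) y) + (-1 : k) ^ (N + 1) •
        G (w ++ [true]) (C.cof (w.count true + 1) (C.wd 0 w x) ⊗ₜ[k] D.wd 0 (w.map not) y)) +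
      (G (false :: w) (C.wd 0 w x ⊗ₜ[k] D.cof 0 (D.wd 0 (w.map not) y)) + (-1 : k) ^ (N + 1) •
        G (w ++ [false])
          (C.wd 0 w x ⊗ₜ[k] D.cof (w.count false + 1) (D.wd 0 (w.map not) y)))) +
    ∑ r ∈ Finset.range N, ∑ u ∈ words r, ∑ v ∈ words (N - (r + 1)), (-1 : k) ^ (r + 1) •
      (G (u ++ true :: true :: v)
        (C.cof (u.count true + 1) (C.wd 0 (u ++ true :: v) x) ⊗ₜ[k]
          D.wd 0 ((u ++ true :: v).map not) y) +
      G (u ++ false :: false :: v)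
        (C.wd 0 (u ++ false :: v) x ⊗ₜ[k]
          D.cof (u.count false + 1) (D.wd 0 ((u ++ false :: v).map not) y)) +
      (G (u ++ true :: false :: v) + G (u ++ false :: true :: v))
        (C.wd 0 (u ++ true :: v) x ⊗ₜ[k] D.wd 0 ((u ++ false :: v).map not) y)) := by
  rw [Finset.sum_range_succ, Finset.sum_range_succ', add_assoc, add_comm]
  congr 1
  · rw [pow_zero, one_smul, sum_words_succ, sum_words_succ', smul_add, Finset.smul_sum,
      Finset.smul_sum, ← Finset.sum_add_distrib, ← Finset.sum_add_distrib,
      ← Finset.sum_add_distrib]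
    refine Finset.sum_congr rfl fun w hw => ?_
    have hw : w.length = N := mem_words.1 hw
    have hw' : (w.map not).length = N := by rw [List.length_map, hw]
    rw [pw_tmul, pw_tmul, pw_tmul, pw_tmul, map_not_append, map_not_append]
    simp only [List.map_cons, List.map_nil, Bool.not_true, Bool.not_false]
    rw [hC.wd_cons_true_cof_zero hx w hw.le, hD.wd_cons_false_cof_zero hy _ hw'.le,
      hC.wd_cons_false_cof_zero hx w hw.le, hD.wd_cons_true_cof_zero hy _ hw'.le,
      hC.wd_append_true_cof w hw hx, hD.wd_append_false_cof _ hw' hy,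
      hC.wd_append_false_cof w hw hx, hD.wd_append_true_cof _ hw' hy, count_map_not, Bool.not_true]
    abel
  · refine Finset.sum_congr rfl fun r hr => ?_
    have hr := Finset.mem_range.1 hr
    have hs : words (N + 1) = words (r + (2 + (N - (r + 1)))) := by congr 1; omega
    rw [hs, sum_words_add, Finset.smul_sum]
    refine Finset.sum_congr rfl fun u hu => ?_
    have hu : u.length = r := mem_words.1 hu
    rw [sum_words_add, sum_words_succ, sum_words_succ, sum_words_succ, sum_words_zero,
      sum_words_zero, sum_words_zero, sum_words_zero, ← Finset.sum_add_distrib,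
      ← Finset.sum_add_distrib, ← Finset.sum_add_distrib, Finset.smul_sum]
    refine Finset.sum_congr rfl fun v hv => ?_
    have hv : r + 1 + v.length = N := by rw [mem_words.1 hv]; omega
    obtain ⟨h1, h2, h3, h4⟩ := hC.pw_inner hD hx hy hu hv
    simp only [List.cons_append, List.nil_append]
    rw [h1, h2, h3, h4, LinearMap.add_apply]
    congr 1
    abel

end IsCocyclic

end CocyclicData

end HopfCyclic

namespace HopfCyclic

universe u v w

namespace CocyclicData

variable {k : Type u} [Field k]

/-! ### The shuffle maps and the differentials -/

namespace IsCocyclic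

variable {C D : CocyclicData.{u, w} k} (hC : C.IsCocyclic) (hD : D.IsCocyclic)

include hC hD

lemma sum_coboundary_marked {V : Type*} [AddCommGroup V] [Module k V]
    (G : List Bool → C.Tot ⊗[k] D.Tot →ₗ[k] V) (gX gY : List Bool → ℕ → C.Tot ⊗[k] D.Tot →ₗ[k] V)
    (hX : ∀ u v : List Bool, (-1 : k) ^ (u.length + 1) • G (u ++ true :: true :: v) =
      gX (u ++ true :: v) (u.count true))
    (hY : ∀ u v : List Bool, (-1 : k) ^ (u.length + 1) • G (u ++ false :: false :: v) =
      gY (u ++ false :: v) (u.count false))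
    {N : ℕ} {x : C.Tot} (hx : x ∈ C.deg N) {y : D.Tot} (hy : y ∈ D.deg N) (R : List Bool → V)
    (hR : ∀ (w : List Bool) (a : C.Tot) (b : D.Tot), w.length = N → a ∈ C.deg (w.count true) →
      b ∈ D.deg (w.count false) → a = C.wd 0 w x → b = D.wd 0 (w.map not) y →
      ((G (true :: w) (C.cof 0 a ⊗ₜ[k] b) + (-1 : k) ^ (N + 1) •
        G (w ++ [true]) (C.cof (w.count true + 1) a ⊗ₜ[k] b)) +
      (G (false :: w) (a ⊗ₜ[k] D.cof 0 b) + (-1 : k) ^ (N + 1) •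
        G (w ++ [false]) (a ⊗ₜ[k] D.cof (w.count false + 1) b))) +
      (∑ j ∈ Finset.range (w.count true), gX w j (C.cof (j + 1) a ⊗ₜ[k] b) +
      ∑ j ∈ Finset.range (w.count false), gY w j (a ⊗ₜ[k] D.cof (j + 1) b)) = R w) :
    ∑ i ∈ Finset.range (N + 2), (-1 : k) ^ i • ∑ w ∈ words (N + 1),
      G w (C.pw D w (C.cof i x ⊗ₜ[k] D.cof i y)) =
    ∑ w ∈ words N, R w +
    ∑ r ∈ Finset.range N, ∑ u ∈ words r, ∑ v ∈ words (N - (r + 1)), (-1 : k) ^ (r + 1) •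
      (G (u ++ true :: false :: v) + G (u ++ false :: true :: v))
        (C.wd 0 (u ++ true :: v) x ⊗ₜ[k] D.wd 0 ((u ++ false :: v).map not) y) := by
  have hR' := fun (w : List Bool) (hw : w ∈ words N) => by
    have hw := mem_words.1 hw
    have hc := count_true_add_count_false w
    exact (hR w _ _ hw (wd_mem hx 0 w (by omega))
      (wd_mem hy 0 (w.map not) (by rw [count_map_not, Bool.not_false]; omega)) rfl rfl).symm
  have hsplit : ∀ A X Y : List Bool → V, ∑ w ∈ words N, (A w + (X w + Y w)) =
      ∑ w ∈ words N, A w + (∑ w ∈ words N, X w + ∑ w ∈ words N, Y w) := fun A X Y => by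
    rw [Finset.sum_add_distrib, Finset.sum_add_distrib]
  have e := (Finset.sum_congr rfl hR').trans (hsplit _ _ _)
  rw [hC.sum_coboundary hD G hx hy, e, sum_words_marked true N
    (fun w a => gX w a (C.cof (a + 1) (C.wd 0 w x) ⊗ₜ[k] D.wd 0 (w.map not) y)),
    sum_words_marked false N
    (fun w a => gY w a (C.wd 0 w x ⊗ₜ[k] D.cof (a + 1) (D.wd 0 (w.map not) y))), add_assoc]
  congr 1
  rw [← Finset.sum_add_distrib, ← Finset.sum_add_distrib]
  refine Finset.sum_congr rfl fun r _ => ?_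
  rw [← Finset.sum_add_distrib, ← Finset.sum_add_distrib]
  refine Finset.sum_congr rfl fun u hu => ?_
  rw [← Finset.sum_add_distrib, ← Finset.sum_add_distrib]
  refine Finset.sum_congr rfl fun v _ => ?_
  rw [← hX, ← hY, mem_words.1 hu, smul_add, smul_add]
  rfl

end IsCocyclic

section Signs

variable (k)

lemma sg_true_true (u v : List Bool) : (-1 : k) ^ (u.length + 1) * sg k (u ++ true :: true :: v) =
    (-1) ^ (u.count true + 1) * sg k (u ++ true :: v) := by
  rw [sg_append, sg_append, ← count_true_add_count_false u]
  simp only [sg, List.count_cons_self]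
  have : (-1 : k) ^ (u.count true + u.count false + 1) *
      (-1) ^ (u.count false * (v.count true + 1 + 1)) =
      (-1) ^ (u.count true + 1) * (-1) ^ (u.count false * (v.count true + 1)) := by
    rw [← pow_add, ← pow_add]
    exact neg_one_pow_eq_of_add k (s := 0) (t := u.count false) (by ring)
  linear_combination (sg k u * sg k v) * this

lemma sg_false_false (u v : List Bool) :
    (-1 : k) ^ (u.length + 1) * sg k (u ++ false :: false :: v) =
      (-1) ^ (u.count false + 1) * ((-1) ^ (u ++ false :: v).count true *
        sg k (u ++ false :: v)) := by
  rw [sg_append, sg_append, ← count_true_add_count_false u, List.count_append]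
  simp only [sg, List.count_cons_of_ne (show false ≠ true by decide)]
  ring

lemma sg_true_false (u v : List Bool) :
    sg k (u ++ false :: true :: v) = -sg k (u ++ true :: false :: v) := by
  rw [sg_append, sg_append]
  simp only [sg, List.count_cons_self, List.count_cons_of_ne (show false ≠ true by decide)]
  ring

lemma sg_snoc_true (w : List Bool) : (-1 : k) ^ (w.length + 1) * sg k (w ++ [true]) =
    (-1) ^ (w.count true + 1) * sg k w := by
  have := sg_true_true k w []
  rw [sg_append, ← count_true_add_count_false w]
  simp only [sg, List.count_cons_self, List.count_nil]
  have : (-1 : k) ^ (w.count true + w.count false + 1) * (-1) ^ (w.count false * (0 + 1)) =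
      (-1) ^ (w.count true + 1) := by
    rw [← pow_add]
    exact neg_one_pow_eq_of_add k (s := 0) (t := w.count false) (by ring)
  linear_combination (sg k w) * this

lemma sg_snoc_false (w : List Bool) : (-1 : k) ^ (w.length + 1) * sg k (w ++ [false]) =
    (-1) ^ w.count true * (-1) ^ (w.count false + 1) * sg k w := by
  rw [sg_append, ← count_true_add_count_false w]
  simp only [sg, List.count_cons_of_ne (show false ≠ true by decide), List.count_nil]
  ring

end Signs

namespace IsCocyclic

variable {C D : CocyclicData.{u, w} k} (hC : C.IsCocyclic) (hD : D.IsCocyclic)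

include hC hD

/-- The shuffle map is a map of Hochschild complexes. -/
lemma wordSh_coboundary {N : ℕ} {x : C.Tot} (hx : x ∈ C.deg N) {y : D.Tot} (hy : y ∈ D.deg N) :
    ∑ i ∈ Finset.range (N + 2), (-1 : k) ^ i • C.wordSh D (N + 1) (C.cof i x ⊗ₜ[k] D.cof i y) =
      C.tensorOp D C.b D.b (C.wordSh D N (x ⊗ₜ[k] y)) := by
  have h0 : ∀ (n : ℕ) z, C.wordSh D n z = ∑ w ∈ words n,
      (sg k w • (LinearMap.id : Module.End k (C.Tot ⊗[k] D.Tot))) (C.pw D w z) :=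
    fun n z => by simp only [wordSh, LinearMap.sum_apply, LinearMap.smul_apply, LinearMap.id_apply]
  simp only [h0]
  rw [hC.sum_coboundary_marked hD (fun w => sg k w • LinearMap.id)
    (fun w a => ((-1) ^ (a + 1) * sg k w) • LinearMap.id)
    (fun w a => ((-1) ^ (a + 1) * ((-1) ^ w.count true * sg k w)) • LinearMap.id)
    (fun u v => by rw [smul_smul, sg_true_true]) (fun u v => by rw [smul_smul, sg_false_false])
    hx hy (fun w => sg k w • C.tensorOp D C.b D.b (C.wd 0 w x ⊗ₜ[k] D.wd 0 (w.map not) y))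
    fun w a b hw ha hb ea eb => ?_, Finset.sum_eq_zero (s := Finset.range N) fun r _ =>
      Finset.sum_eq_zero fun u _ => Finset.sum_eq_zero fun v _ => ?_, add_zero, map_sum]
  · exact Finset.sum_congr rfl fun w _ => by
      rw [LinearMap.smul_apply, map_smul, LinearMap.id_apply, pw_tmul]
  · rw [sg_true_false]
    simp
  · have h1 : C.b a = C.cof 0 a + (-1 : k) ^ (w.count true + 1) • C.cof (w.count true + 1) a +
        ∑ j ∈ Finset.range (w.count true), (-1 : k) ^ (j + 1) • C.cof (j + 1) a := by
      rw [b_apply ha, Finset.sum_range_succ, Finset.sum_range_succ', pow_zero, one_smul]; abel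
    have h2 : D.b b = D.cof 0 b + (-1 : k) ^ (w.count false + 1) • D.cof (w.count false + 1) b +
        ∑ j ∈ Finset.range (w.count false), (-1 : k) ^ (j + 1) • D.cof (j + 1) b := by
      rw [b_apply hb, Finset.sum_range_succ, Finset.sum_range_succ', pow_zero, one_smul]; abel
    rw [← ea, ← eb, tensorOp_tmul, h1, h2, sgn_of_mem_deg ha]
    simp only [LinearMap.smul_apply, LinearMap.id_apply, smul_smul, ← hw, sg_snoc_true,
      sg_snoc_false]
    simp only [sg, TensorProduct.add_tmul, TensorProduct.tmul_add, TensorProduct.sum_tmul,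
      TensorProduct.tmul_sum, smul_add, Finset.smul_sum, ← TensorProduct.smul_tmul',
      TensorProduct.tmul_smul, smul_smul]
    simp only [mul_comm, mul_left_comm, mul_assoc]
    abel

end IsCocyclic

end CocyclicData

end HopfCyclic

namespace HopfCyclic

universe u v w

namespace CocyclicData

variable {k : Type u} [Field k]

/-! ### The cyclic shuffle map -/

namespace IsCocyclic

variable {C D : CocyclicData.{u, w} k} (hC : C.IsCocyclic) (hD : D.IsCocyclic)

lemma sum_add_sum_neg_succ {V : Type*} [AddCommGroup V] [Module k V] (F : ℕ → V) (n : ℕ) :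
    ∑ p ∈ Finset.range n, F p + ∑ p ∈ Finset.range n, (-1 : k) • F (p + 1) =
      F 0 + (-1 : k) • F n := by
  simp only [neg_one_smul, Finset.sum_neg_distrib, ← sub_eq_add_neg]
  rw [← Finset.sum_sub_distrib, Finset.sum_range_sub']

lemma sum_neg_add_sum_succ {V : Type*} [AddCommGroup V] [Module k V] (F : ℕ → V) (n : ℕ) :
    ∑ p ∈ Finset.range n, (-1 : k) • F p + ∑ p ∈ Finset.range n, F (p + 1) =
      F n + (-1 : k) • F 0 := by
  simp only [neg_one_smul, Finset.sum_neg_distrib, ← sub_eq_add_neg, neg_add_eq_sub]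
  rw [← Finset.sum_sub_distrib, Finset.sum_range_sub]

lemma smul_add_neg_smul {V : Type*} [AddCommGroup V] [Module k V] (s c : k) (x y : V) :
    s • (x + c • y) + (-s) • x = (s * c) • y := by
  rw [smul_add, neg_smul, smul_smul]
  abel

lemma neg_one_pow_mul_succ (k : Type u) [Field k] (n : ℕ) : (-1 : k) ^ ((n + 1) * n) = 1 := by
  rw [mul_comm]; exact Even.neg_one_pow (Nat.even_mul_succ_self n)

section

include hC

lemma cyc_cof_true {w : List Bool} {a : C.Tot} (ha : a ∈ C.deg (w.count true)) (b : D.Tot) :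
    C.cyc D (true :: w) (C.cof 0 a ⊗ₜ[k] b) + (-1 : k) ^ (w.count true + 1) •
      C.cyc D (w ++ [true]) (C.cof (w.count true + 1) a ⊗ₜ[k] b) =
    (-1 : k) ^ w.count true • (a ⊗ₜ[k] D.connes (w.count false) b) := by
  have h1 : (w ++ [true]).count true = w.count true + 1 := by simp
  have h2 : (w ++ [true]).count false = w.count false := by simp
  rw [cyc_tmul, cyc_tmul, h1, h2, List.count_cons_self,
    List.count_cons_of_ne (show true ≠ false by decide), connes_apply]
  generalize hc : w.count true = c at *
  generalize he : w.count false = e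
  rw [Finset.sum_comm, Finset.sum_comm (s := Finset.range (c + 1)), Finset.smul_sum,
    ← Finset.sum_add_distrib, TensorProduct.tmul_sum, Finset.smul_sum]
  refine Finset.sum_congr rfl fun q hq => ?_
  have hq : q < e := Finset.mem_range.1 hq
  let F : ℕ → C.Tot ⊗[k] D.Tot := fun p => ((-1) ^ c * (-1) ^ (q * (e - 1)) * (-1) ^ (p * c) *
    precedes k (true :: w) p q) • ((C.t ^ p) a ⊗ₜ[k] D.extra e q b)
  have h3 : ∀ p ∈ Finset.range (c + 1),
      (cycCoeff (c + 1) e p q * precedes k (true :: w) p q) •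
        (C.extra (c + 1) p (C.cof 0 a) ⊗ₜ[k] D.extra e q b) = F p := by
    intro p hp
    have hp : p < c + 1 := Finset.mem_range.1 hp
    rw [hC.extra_cof_zero ha (by omega), cycCoeff, Nat.add_sub_cancel]
    simp only [F]
    congr 1
    ring
  have h4 : ∀ p ∈ Finset.range (c + 1),
      (-1 : k) ^ (c + 1) • (cycCoeff (c + 1) e p q * precedes k (w ++ [true]) p q) •
        (C.extra (c + 1) p (C.cof (c + 1) a) ⊗ₜ[k] D.extra e q b) = (-1 : k) • F (p + 1) := by
    intro p hp
    have hp : p < c + 1 := Finset.mem_range.1 hp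
    rw [hC.extra_cof_last ha (by omega), cycCoeff, Nat.add_sub_cancel,
      precedes_append_true k w (by omega), smul_smul]
    simp only [F]
    rw [smul_smul, precedes, add_mul, one_mul, pow_add (-1 : k) (p * c)]
    congr 1
    ring
  rw [Finset.smul_sum, Finset.sum_congr rfl h3, Finset.sum_congr rfl h4]
  refine (sum_add_sum_neg_succ F (c + 1)).trans ?_
  simp only [F]
  rw [precedes, precedes, precedes_of_le_of_lt k w (by omega) (by omega), mul_zero, zero_smul, smul_zero,
    add_zero, TensorProduct.tmul_smul, smul_smul]
  simp

end

section

include hD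

lemma cyc_cof_false {w : List Bool} (a : C.Tot) {b : D.Tot} (hb : b ∈ D.deg (w.count false)) :
    (-1 : k) ^ w.count true • C.cyc D (false :: w) (a ⊗ₜ[k] D.cof 0 b) +
      ((-1 : k) ^ w.count true * (-1) ^ (w.count false + 1)) •
      C.cyc D (w ++ [false]) (a ⊗ₜ[k] D.cof (w.count false + 1) b) =
    C.connes (w.count true) a ⊗ₜ[k] b := by
  have h1 : (w ++ [false]).count true = w.count true := by simp
  have h2 : (w ++ [false]).count false = w.count false + 1 := by simp
  rw [cyc_tmul, cyc_tmul, h1, h2, List.count_cons_self,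
    List.count_cons_of_ne (show false ≠ true by decide), connes_apply]
  generalize hc : w.count true = c
  generalize he : w.count false = e at *
  rw [Finset.smul_sum, Finset.smul_sum, ← Finset.sum_add_distrib, TensorProduct.sum_tmul]
  refine Finset.sum_congr rfl fun p hp => ?_
  have hp : p < c := Finset.mem_range.1 hp
  obtain ⟨c, rfl⟩ := Nat.exists_eq_add_of_le' (show 1 ≤ c by omega)
  let F : ℕ → C.Tot ⊗[k] D.Tot := fun q => ((-1) ^ (p * c) * (-1) ^ (q * e) *
    precedes k (false :: w) p q) • (C.extra (c + 1) p a ⊗ₜ[k] (D.t ^ q) b)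
  have h3 : ∀ q ∈ Finset.range (e + 1),
      (-1 : k) ^ (c + 1) • (cycCoeff (c + 1) (e + 1) p q * precedes k (false :: w) p q) •
        (C.extra (c + 1) p a ⊗ₜ[k] D.extra (e + 1) q (D.cof 0 b)) = (-1 : k) • F q := by
    intro q hq
    have hq : q < e + 1 := Finset.mem_range.1 hq
    rw [hD.extra_cof_zero hb (by omega), cycCoeff, Nat.add_sub_cancel, Nat.add_sub_cancel,
      smul_smul]
    simp only [F]
    rw [smul_smul]
    congr 1
    have : (-1 : k) ^ c * (-1) ^ c = 1 := by rw [← mul_pow]; simp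
    rw [pow_succ]
    linear_combination (-(-1) ^ (p * c) * (-1) ^ (q * e) * precedes k (false :: w) p q) * this
  have h4 : ∀ q ∈ Finset.range (e + 1),
      ((-1 : k) ^ (c + 1) * (-1) ^ (e + 1)) •
        (cycCoeff (c + 1) (e + 1) p q * precedes k (w ++ [false]) p q) •
        (C.extra (c + 1) p a ⊗ₜ[k] D.extra (e + 1) q (D.cof (e + 1) b)) = F (q + 1) := by
    intro q hq
    have hq : q < e + 1 := Finset.mem_range.1 hq
    rw [hD.extra_cof_last hb (by omega), cycCoeff, Nat.add_sub_cancel, Nat.add_sub_cancel,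
      precedes_append_false k w (by omega), smul_smul]
    simp only [F]
    rw [precedes, add_mul, one_mul, pow_add (-1 : k) (q * e)]
    congr 1
    have : (-1 : k) ^ c * (-1) ^ c = 1 := by rw [← mul_pow]; simp
    rw [pow_succ, pow_succ]
    linear_combination ((-1) ^ (p * c) * (-1) ^ (q * e) * (-1) ^ e * precedes k w p q) * this
  rw [Finset.smul_sum, Finset.smul_sum, Finset.sum_congr rfl h3, Finset.sum_congr rfl h4]
  refine (sum_neg_add_sum_succ F (e + 1)).trans ?_
  simp only [F]
  rw [precedes, precedes, precedes_of_lt_of_le k w (by omega) (by omega), mul_zero, zero_smul,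
    smul_zero, add_zero, hD.t_pow_self hb, neg_one_pow_mul_succ, mul_one, mul_one, Nat.add_sub_cancel,
    TensorProduct.smul_tmul']

end

end IsCocyclic

section Inner

variable (C D : CocyclicData.{u, w} k)

/-- The operator `cyc` of a word whose `j`-th letter `true` has been doubled. -/
def cycTrue (w : List Bool) (j : ℕ) : Module.End k (C.Tot ⊗[k] D.Tot) :=
  ∑ p ∈ Finset.range (w.count true + 1), ∑ q ∈ Finset.range (w.count false),
    (cycCoeff (w.count true + 1) (w.count false) p q *
      precedes k w (if p ≤ j then p else p - 1) q) •
      TensorProduct.map (C.extra (w.count true + 1) p) (D.extra (w.count false) q)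

/-- The operator `cyc` of a word whose `j`-th letter `false` has been doubled. -/
def cycFalse (w : List Bool) (j : ℕ) : Module.End k (C.Tot ⊗[k] D.Tot) :=
  ∑ p ∈ Finset.range (w.count true), ∑ q ∈ Finset.range (w.count false + 1),
    (cycCoeff (w.count true) (w.count false + 1) p q *
      precedes k w p (if q ≤ j then q else q - 1)) •
      TensorProduct.map (C.extra (w.count true) p) (D.extra (w.count false + 1) q)

lemma cyc_true_true (u v : List Bool) :
    C.cyc D (u ++ true :: true :: v) = C.cycTrue D (u ++ true :: v) (u.count true) := by
  have h1 : (u ++ true :: true :: v).count true = (u ++ true :: v).count true + 1 := by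
    simp; omega
  have h2 : (u ++ true :: true :: v).count false = (u ++ true :: v).count false := by simp
  simp only [cyc, cycTrue, h1, h2, precedes_true_true]

lemma cyc_false_false (u v : List Bool) :
    C.cyc D (u ++ false :: false :: v) = C.cycFalse D (u ++ false :: v) (u.count false) := by
  have h1 : (u ++ false :: false :: v).count false = (u ++ false :: v).count false + 1 := by
    simp; omega
  have h2 : (u ++ false :: false :: v).count true = (u ++ false :: v).count true := by simp
  simp only [cyc, cycFalse, h1, h2, precedes_false_false]

lemma cyc_true_false (u v : List Bool) :
    C.cyc D (u ++ true :: false :: v) = C.cyc D (u ++ false :: true :: v) +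
      cycCoeff (k := k) ((u ++ true :: v).count true) ((u ++ false :: v).count false)
        (u.count true) (u.count false) •
      TensorProduct.map (C.extra ((u ++ true :: v).count true) (u.count true))
        (D.extra ((u ++ false :: v).count false) (u.count false)) := by
  have h1 : (u ++ true :: false :: v).count true = (u ++ true :: v).count true := by simp
  have h2 : (u ++ true :: false :: v).count false = (u ++ false :: v).count false := by simp
  have h3 : (u ++ false :: true :: v).count true = (u ++ true :: v).count true := by simp
  have h4 : (u ++ false :: true :: v).count false = (u ++ false :: v).count false := by simp
  have h5 : ∀ p q, precedes k (u ++ true :: false :: v) p q =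
      precedes k (u ++ false :: true :: v) p q +
        if p = u.count true ∧ q = u.count false then 1 else 0 := fun p q => by
    rw [← precedes_swap]; ring
  simp only [cyc, h1, h2, h3, h4, h5, mul_add, add_smul, Finset.sum_add_distrib]
  congr 1
  rw [Finset.sum_eq_single (u.count true), Finset.sum_eq_single (u.count false)]
  · rw [if_pos ⟨rfl, rfl⟩, mul_one]
  · intro q _ hq
    rw [if_neg fun h => hq h.2, mul_zero, zero_smul]
  · intro h
    exact absurd (Finset.mem_range.2 (by simp)) h
  · intro p _ hp
    refine Finset.sum_eq_zero fun q _ => ?_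
    rw [if_neg fun h => hp h.1, mul_zero, zero_smul]
  · intro h
    exact absurd (Finset.mem_range.2 (by simp)) h

end Inner

namespace IsCocyclic

variable {C D : CocyclicData.{u, w} k} (hC : C.IsCocyclic) (hD : D.IsCocyclic)

section

include hC

lemma cycTrue_cof {w : List Bool} {a : C.Tot} (ha : a ∈ C.deg (w.count true)) (b : D.Tot) :
    ∑ j ∈ Finset.range (w.count true), (-1 : k) ^ (j + 1) •
      C.cycTrue D w j (C.cof (j + 1) a ⊗ₜ[k] b) =
    TensorProduct.map C.b LinearMap.id (C.cyc D w (a ⊗ₜ[k] b)) := by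
  rw [cyc_tmul]
  simp only [cycTrue, LinearMap.sum_apply, LinearMap.smul_apply, TensorProduct.map_tmul, map_sum,
    map_smul, LinearMap.id_apply]
  generalize hc : w.count true = c at *
  generalize he : w.count false = e
  rcases Nat.eq_zero_or_pos c with rfl | hc0
  · simp
  rw [Finset.sum_comm (s := Finset.range c) (t := Finset.range e)]
  simp only [Finset.sum_comm (s := Finset.range (c + 1)) (t := Finset.range e), Finset.smul_sum]
  rw [Finset.sum_comm (s := Finset.range c) (t := Finset.range e)]
  refine Finset.sum_congr rfl fun q _ => ?_
  have h1 := congrArg (fun z => ((-1 : k) ^ c * (-1) ^ (q * (e - 1))) • (z ⊗ₜ[k] D.extra e q b))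
    (hC.sum_extra_cof ha fun p => precedes k w p q)
  simp only [TensorProduct.sum_tmul, TensorProduct.neg_tmul, Finset.smul_sum, smul_neg,
    ← TensorProduct.smul_tmul', smul_smul] at h1
  obtain ⟨c, rfl⟩ := Nat.exists_eq_add_of_le' (show 1 ≤ c by omega)
  refine Eq.trans ?_ (h1.trans ?_)
  · refine Finset.sum_congr rfl fun j _ => Finset.sum_congr rfl fun p _ => ?_
    rw [smul_smul, cycCoeff, Nat.add_sub_cancel]
    congr 1
    ring
  · rw [← Finset.sum_neg_distrib]
    refine Finset.sum_congr rfl fun p _ => ?_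
    rw [b_apply (extra_mem ha _ p rfl), TensorProduct.sum_tmul, Finset.smul_sum,
      ← Finset.sum_neg_distrib]
    refine Finset.sum_congr rfl fun i _ => ?_
    rw [← TensorProduct.smul_tmul', smul_smul, ← neg_smul, cycCoeff, Nat.add_sub_cancel]
    congr 1
    ring

end

section

include hD

lemma cycFalse_cof {w : List Bool} {a : C.Tot} (ha : a ∈ C.deg (w.count true)) {b : D.Tot}
    (hb : b ∈ D.deg (w.count false)) :
    ∑ j ∈ Finset.range (w.count false), ((-1 : k) ^ (j + 1) * (-1) ^ w.count true) •
      C.cycFalse D w j (a ⊗ₜ[k] D.cof (j + 1) b) =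
    TensorProduct.map C.sgn D.b (C.cyc D w (a ⊗ₜ[k] b)) := by
  rw [cyc_tmul]
  simp only [cycFalse, LinearMap.sum_apply, LinearMap.smul_apply, TensorProduct.map_tmul, map_sum,
    map_smul]
  generalize hc : w.count true = c at *
  generalize he : w.count false = e at *
  rcases Nat.eq_zero_or_pos e with rfl | he0
  · simp
  simp only [Finset.smul_sum]
  rw [Finset.sum_comm (s := Finset.range e) (t := Finset.range c)]
  refine Finset.sum_congr rfl fun p hp => ?_
  have hp : p < c := Finset.mem_range.1 hp
  have h1 := congrArg (fun z => (-(-1 : k) ^ (p * (c - 1))) • (C.extra c p a ⊗ₜ[k] z))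
    (hD.sum_extra_cof hb fun q => precedes k w p q)
  simp only [TensorProduct.tmul_sum, TensorProduct.tmul_neg, Finset.smul_sum, smul_neg,
    TensorProduct.tmul_smul, smul_smul] at h1
  obtain ⟨e, rfl⟩ := Nat.exists_eq_add_of_le' (show 1 ≤ e by omega)
  obtain ⟨c, rfl⟩ := Nat.exists_eq_add_of_le' (show 1 ≤ c by omega)
  have hcc : (-1 : k) ^ c * (-1) ^ c = 1 := by rw [← mul_pow]; simp
  refine Eq.trans ?_ (h1.trans ?_)
  · refine Finset.sum_congr rfl fun j _ => Finset.sum_congr rfl fun q _ => ?_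
    rw [smul_smul, cycCoeff, Nat.add_sub_cancel, Nat.add_sub_cancel, pow_succ (-1 : k) c]
    congr 1
    linear_combination (-(-1) ^ (j + 1) * (-1) ^ (p * c) * (-1) ^ (q * (e + 1)) *
      precedes k w p (if q ≤ j then q else q - 1)) * hcc
  · rw [← Finset.sum_neg_distrib]
    refine Finset.sum_congr rfl fun q _ => ?_
    rw [b_apply (extra_mem hb _ q rfl), sgn_of_mem_deg (extra_mem ha _ p rfl),
      TensorProduct.tmul_sum, Finset.smul_sum, ← Finset.sum_neg_distrib]
    refine Finset.sum_congr rfl fun i _ => ?_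
    rw [TensorProduct.tmul_smul, ← TensorProduct.smul_tmul', smul_smul, smul_smul, ← neg_smul,
      cycCoeff, Nat.add_sub_cancel, Nat.add_sub_cancel]
    congr 1
    linear_combination (-(-1) ^ i * (-1) ^ (p * c) * (-1) ^ (q * e) *
      precedes k w p q) * hcc

end

lemma sg_mul_cycCoeff (k : Type u) [Field k] (u v : List Bool) :
    (-1) ^ (u.length + 1) * (sg k (u ++ true :: false :: v) *
      cycCoeff (k := k) ((u ++ true :: v).count true) ((u ++ false :: v).count false)
        (u.count true) (u.count false)) =
    -((-1) ^ (u.length * (u.length + v.length)) * sg k (v ++ u)) := by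
  have hc : (u ++ true :: v).count true = u.count true + v.count true + 1 := by simp; omega
  have he : (u ++ false :: v).count false = u.count false + v.count false + 1 := by simp; omega
  rw [sg_append, sg_append, hc, he, cycCoeff, Nat.add_sub_cancel, Nat.add_sub_cancel,
    ← count_true_add_count_false u, ← count_true_add_count_false v]
  simp only [sg, List.count_cons_self, List.count_cons_of_ne (show false ≠ true by decide)]
  generalize u.count true = P
  generalize u.count false = Q
  generalize v.count true = P'
  generalize v.count false = Q'
  have : (-1 : k) ^ (P + Q + 1) * (-1) ^ (Q * (P' + 1)) * (-1) ^ P' * (-1) ^ (P + P') *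
      (-1) ^ (P * (P + P')) * (-1) ^ (Q * (Q + Q')) =
      (-1) ^ 1 * (-1) ^ ((P + Q) * (P + Q + (P' + Q'))) * (-1) ^ (Q' * P) := by
    simp only [← pow_add]
    exact neg_one_pow_eq_of_add k (s := P * Q + P * Q') (t := P + Q + P') (by ring)
  linear_combination (sg k u * sg k v) * this

section

include hC hD

/-- The relation `[b, sh'] + [B, sh] = 0` on the diagonal, before normalization. -/
lemma wordCsh_coboundary {N : ℕ} {x : C.Tot} (hx : x ∈ C.deg N) {y : D.Tot} (hy : y ∈ D.deg N) :
    ∑ i ∈ Finset.range (N + 2), (-1 : k) ^ i •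
        C.wordCsh D (N + 1) (C.cof i x ⊗ₜ[k] D.cof i y) +
      C.wordSh D (N - 1) (∑ r ∈ Finset.range N, (-1 : k) ^ (r * (N - 1)) •
        (C.extra N r x ⊗ₜ[k] D.extra N r y)) =
    ∑ w ∈ words N, sg k w • C.tensorOp D (C.connes (w.count true)) (D.connes (w.count false))
        (C.pw D w (x ⊗ₜ[k] y)) +
      C.tensorOp D C.b D.b (C.wordCsh D N (x ⊗ₜ[k] y)) := by
  have h0 : ∀ (n : ℕ) z, C.wordCsh D n z = ∑ w ∈ words n,
      (sg k w • C.cyc D w) (C.pw D w z) :=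
    fun n z => by
      simp only [wordCsh, LinearMap.sum_apply, LinearMap.smul_apply, Module.End.mul_apply]
  simp only [h0]
  rw [hC.sum_coboundary_marked hD (fun w => sg k w • C.cyc D w)
    (fun w a => ((-1) ^ (a + 1) * sg k w) • C.cycTrue D w a)
    (fun w a => ((-1) ^ (a + 1) * ((-1) ^ w.count true * sg k w)) • C.cycFalse D w a)
    (fun u v => by rw [smul_smul, sg_true_true, cyc_true_true])
    (fun u v => by rw [smul_smul, sg_false_false, cyc_false_false])
    hx hy (fun w => sg k w • C.tensorOp D (C.connes (w.count true)) (D.connes (w.count false))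
        (C.pw D w (x ⊗ₜ[k] y)) +
      C.tensorOp D C.b D.b ((sg k w • C.cyc D w) (C.pw D w (x ⊗ₜ[k] y))))
    fun w a b hw ha hb ea eb => ?_]
  · rw [Finset.sum_add_distrib, ← map_sum (C.tensorOp D C.b D.b), add_assoc, add_eq_left,
      map_sum, ← Finset.sum_add_distrib]
    refine Finset.sum_eq_zero fun r hr => ?_
    have hr : r < N := Finset.mem_range.1 hr
    have hN : N - 1 = (N - (r + 1)) + r := by omega
    rw [wordSh, LinearMap.sum_apply]
    conv_lhs => enter [2]; rw [show words (N - 1) = words ((N - (r + 1)) + r) by rw [hN]]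
    rw [sum_words_add, Finset.sum_comm (s := words (N - (r + 1))), ← Finset.sum_add_distrib]
    refine Finset.sum_eq_zero fun u hu => ?_
    rw [← Finset.sum_add_distrib]
    refine Finset.sum_eq_zero fun v hv => ?_
    have hu := mem_words.1 hu
    have hv := mem_words.1 hv
    have hu' : (u.map not).length = u.length := List.length_map _
    have hv' : (v.map not).length = v.length := List.length_map _
    have e1 := hC.extra_wd_eq_wd_extra hx (u := u) (v := v) (by omega)
    have e2 := hD.extra_wd_eq_wd_extra hy (u := u.map not) (v := v.map not) (by omega)
    have h1 : (u.map not ++ true :: v.map not) = (u ++ false :: v).map not := by simp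
    rw [h1, count_map_not, count_map_not, ← map_not_append, hu', Bool.not_true] at e2
    have hs := sg_mul_cycCoeff k u v
    have h2 : (sg k (u ++ true :: false :: v) • C.cyc D (u ++ true :: false :: v) +
        sg k (u ++ false :: true :: v) • C.cyc D (u ++ false :: true :: v)) =
        (sg k (u ++ true :: false :: v) *
          cycCoeff (k := k) ((u ++ true :: v).count true) ((u ++ false :: v).count false)
        (u.count true) (u.count false)) •
        TensorProduct.map (C.extra ((u ++ true :: v).count true) (u.count true))
        (D.extra ((u ++ false :: v).count false) (u.count false)) := by
      rw [sg_true_false, cyc_true_false]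
      exact smul_add_neg_smul (k := k) (V := Module.End k (C.Tot ⊗[k] D.Tot)) _ _ _ _
    rw [h2, LinearMap.smul_apply, TensorProduct.map_tmul, e1, e2, LinearMap.smul_apply, map_smul,
      pw_tmul, smul_smul, smul_smul, ← hu, ← add_smul, hs, hN, ← hv, ← hu]
    rw [show sg k (v ++ u) * (-1) ^ (u.length * (v.length + u.length)) =
      (-1) ^ (u.length * (u.length + v.length)) * sg k (v ++ u) by
        rw [mul_comm, add_comm v.length], neg_add_cancel, zero_smul]
  · rw [pw_tmul, ← ea, ← eb, tensorOp_tmul, sgn_of_mem_deg ha]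
    have e1 := congrArg (fun z => sg k w • z) (hC.cyc_cof_true ha b)
    have e2 := congrArg (fun z => sg k w • z) (hD.cyc_cof_false a hb)
    have e3 := congrArg (fun z => sg k w • z) (hC.cycTrue_cof ha b)
    have e4 := congrArg (fun z => sg k w • z) (hD.cycFalse_cof ha hb)
    simp only [smul_add, smul_smul, Finset.smul_sum] at e1 e2 e3 e4
    simp only [LinearMap.smul_apply, smul_smul, ← hw, sg_snoc_true, sg_snoc_false, sg, map_smul,
      tensorOp, LinearMap.add_apply, smul_add, TensorProduct.smul_tmul']
    simp only [TensorProduct.smul_tmul', mul_comm, mul_left_comm, mul_assoc] at e1 e2 e3 e4 ⊢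
    rw [e1, e2, e3, e4]
    abel

end

end IsCocyclic

end CocyclicData

end HopfCyclic

namespace HopfCyclic

universe u v w

namespace CocyclicData

variable {k : Type u} [Field k]

/-! ### Normalized cochains of a tensor product -/

section Bidegree

variable (C D : CocyclicData.{u, w} k)

/-- The image of `Cⁱ ⊗ Dʲ` in the tensor product of the total spaces. -/
def bideg (i j : ℕ) : Submodule k (C.Tot ⊗[k] D.Tot) :=
  LinearMap.range (TensorProduct.map (DirectSum.lof k ℕ C.obj i) (DirectSum.lof k ℕ D.obj j))

/-- The span of the tensors of normalized cochains of degrees `i` and `j`. -/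
def normalizedTensor (i j : ℕ) : Submodule k (C.Tot ⊗[k] D.Tot) :=
  Submodule.span k {z | ∃ x ∈ C.deg i, ∃ y ∈ D.deg j, (∀ a < i, C.s a x = 0) ∧
    (∀ b < j, D.s b y = 0) ∧ x ⊗ₜ[k] y = z}

variable {C D}

lemma bideg_induction {i j : ℕ} {p : C.Tot ⊗[k] D.Tot → Prop} (h0 : p 0)
    (hadd : ∀ x y, p x → p y → p (x + y)) (ht : ∀ x ∈ C.deg i, ∀ y ∈ D.deg j, p (x ⊗ₜ[k] y))
    {z : C.Tot ⊗[k] D.Tot} (hz : z ∈ C.bideg D i j) : p z := by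
  obtain ⟨z, rfl⟩ := hz
  induction z using TensorProduct.induction_on with
  | zero => rwa [map_zero]
  | add x y hx hy => rw [map_add]; exact hadd _ _ hx hy
  | tmul x y => exact ht _ (lof_mem_deg i x) _ (lof_mem_deg j y)

lemma eq_on_bideg {V : Type*} [AddCommGroup V] [Module k V] {i j : ℕ}
    (f g : C.Tot ⊗[k] D.Tot →ₗ[k] V)
    (h : ∀ x ∈ C.deg i, ∀ y ∈ D.deg j, f (x ⊗ₜ[k] y) = g (x ⊗ₜ[k] y))
    {z : C.Tot ⊗[k] D.Tot} (hz : z ∈ C.bideg D i j) : f z = g z := by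
  refine bideg_induction (p := fun z => f z = g z) ?_ (fun x y hx hy => ?_) h hz
  · rw [map_zero, map_zero]
  · rw [map_add, map_add, hx, hy]

lemma tmul_mem_bideg {i j : ℕ} {x : C.Tot} (hx : x ∈ C.deg i) {y : D.Tot} (hy : y ∈ D.deg j) :
    x ⊗ₜ[k] y ∈ C.bideg D i j := by
  obtain ⟨x, rfl⟩ := hx
  obtain ⟨y, rfl⟩ := hy
  exact ⟨x ⊗ₜ[k] y, rfl⟩

/-- A projection onto the normalized cochains that differs from the identity by a map that factors
through the codegeneracies. -/
lemma exists_normalization (C : CocyclicData.{u, w} k) (d : ℕ) :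
    ∃ R : ℕ → Module.End k C.Tot, ∀ x ∈ C.deg d,
      x - ∑ a ∈ Finset.range d, R a (C.s a x) ∈ C.deg d ∧
      ∀ b < d, C.s b (x - ∑ a ∈ Finset.range d, R a (C.s a x)) = 0 := by
  let f : C.obj d →ₗ[k] (Fin d → C.Tot) :=
    LinearMap.pi fun a => C.s a ∘ₗ DirectSum.lof k ℕ C.obj d
  obtain ⟨h, hh⟩ := f.rangeRestrict.exists_rightInverse_of_surjective f.range_rangeRestrict
  obtain ⟨g, hg⟩ := h.exists_extend
  have hfg : ∀ v, f (g (f v)) = f v := fun v => by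
    have h1 : g (f v) = h (f.rangeRestrict v) := LinearMap.congr_fun hg (f.rangeRestrict v)
    rw [h1]
    exact congrArg Subtype.val (LinearMap.congr_fun hh (f.rangeRestrict v))
  refine ⟨fun a => if ha : a < d then DirectSum.lof k ℕ C.obj d ∘ₗ g ∘ₗ
    LinearMap.single k (fun _ : Fin d => C.Tot) ⟨a, ha⟩ else 0, ?_⟩
  rintro _ ⟨v, rfl⟩
  have e : ∑ a ∈ Finset.range d, (if ha : a < d then DirectSum.lof k ℕ C.obj d ∘ₗ g ∘ₗ
      LinearMap.single k (fun _ : Fin d => C.Tot) ⟨a, ha⟩ else 0)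
      (C.s a (DirectSum.lof k ℕ C.obj d v)) = DirectSum.lof k ℕ C.obj d (g (f v)) := by
    rw [Finset.sum_range]
    have h1 : f v = ∑ a : Fin d, LinearMap.single k (fun _ : Fin d => C.Tot) a (f v a) :=
      (LinearMap.sum_single_apply _ _).symm
    rw [h1, map_sum, map_sum]
    refine Finset.sum_congr rfl fun a _ => ?_
    rw [dif_pos a.2]
    rfl
  rw [e, ← map_sub]
  refine ⟨lof_mem_deg _ _, fun b hb => ?_⟩
  have h2 : f (v - g (f v)) = 0 := by rw [map_sub, hfg, sub_self]
  exact congrFun h2 ⟨b, hb⟩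

lemma mem_normalizedTensor {i j : ℕ} {z : C.Tot ⊗[k] D.Tot} (hz : z ∈ C.bideg D i j)
    (h : ∀ a < i, TensorProduct.map (C.s a) LinearMap.id z = 0)
    (h' : ∀ b < j, TensorProduct.map LinearMap.id (D.s b) z = 0) :
    z ∈ C.normalizedTensor D i j := by
  obtain ⟨R, hR⟩ := C.exists_normalization i
  obtain ⟨R', hR'⟩ := D.exists_normalization j
  let P : Module.End k C.Tot := LinearMap.id - ∑ a ∈ Finset.range i, R a ∘ₗ C.s a
  let P' : Module.End k D.Tot := LinearMap.id - ∑ b ∈ Finset.range j, R' b ∘ₗ D.s b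
  have hP : ∀ x, P x = x - ∑ a ∈ Finset.range i, R a (C.s a x) := fun x => by
    simp [P, LinearMap.sub_apply, LinearMap.sum_apply]
  have hP' : ∀ x, P' x = x - ∑ a ∈ Finset.range j, R' a (D.s a x) := fun x => by
    simp [P', LinearMap.sub_apply, LinearMap.sum_apply]
  have e1 : TensorProduct.map P LinearMap.id z = z := by
    have : TensorProduct.map P (LinearMap.id (R := k) (M := D.Tot)) = LinearMap.id -
        ∑ a ∈ Finset.range i, TensorProduct.map (R a) LinearMap.id ∘ₗ
          TensorProduct.map (C.s a) LinearMap.id := by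
      refine TensorProduct.ext' fun x y => ?_
      rw [TensorProduct.map_tmul, hP, TensorProduct.sub_tmul, TensorProduct.sum_tmul,
        LinearMap.sub_apply, LinearMap.sum_apply]
      rfl
    rw [this, LinearMap.sub_apply, LinearMap.sum_apply, Finset.sum_eq_zero fun a ha => by
      rw [LinearMap.comp_apply, h a (Finset.mem_range.1 ha), map_zero], sub_zero,
      LinearMap.id_apply]
  have e2 : TensorProduct.map LinearMap.id P' z = z := by
    have : TensorProduct.map (LinearMap.id (R := k) (M := C.Tot)) P' = LinearMap.id -
        ∑ a ∈ Finset.range j, TensorProduct.map LinearMap.id (R' a) ∘ₗ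
          TensorProduct.map LinearMap.id (D.s a) := by
      refine TensorProduct.ext' fun x y => ?_
      rw [TensorProduct.map_tmul, hP', TensorProduct.tmul_sub, TensorProduct.tmul_sum,
        LinearMap.sub_apply, LinearMap.sum_apply]
      rfl
    rw [this, LinearMap.sub_apply, LinearMap.sum_apply, Finset.sum_eq_zero fun a ha => by
      rw [LinearMap.comp_apply, h' a (Finset.mem_range.1 ha), map_zero], sub_zero,
      LinearMap.id_apply]
  have e3 : TensorProduct.map P P' z = z := by
    rw [← LinearMap.comp_id P, ← LinearMap.id_comp P', TensorProduct.map_comp,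
      LinearMap.comp_apply, e2, e1]
  rw [← e3]
  clear e1 e2 e3 h h'
  refine bideg_induction (p := fun z => TensorProduct.map P P' z ∈ C.normalizedTensor D i j) ?_
    (fun x y hx hy => ?_) (fun x hx y hy => ?_) hz
  · rw [map_zero]; exact Submodule.zero_mem _
  · rw [map_add]; exact Submodule.add_mem _ hx hy
  · rw [TensorProduct.map_tmul, hP, hP']
    exact Submodule.subset_span ⟨_, (hR x hx).1, _, (hR' y hy).1, (hR x hx).2, (hR' y hy).2, rfl⟩

lemma normalizedTensor_induction {i j : ℕ} {p : C.Tot ⊗[k] D.Tot → Prop} (h0 : p 0)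
    (hadd : ∀ x y, p x → p y → p (x + y))
    (ht : ∀ x ∈ C.deg i, ∀ y ∈ D.deg j, (∀ a < i, C.s a x = 0) → (∀ b < j, D.s b y = 0) →
      p (x ⊗ₜ[k] y))
    {z : C.Tot ⊗[k] D.Tot} (hz : z ∈ C.normalizedTensor D i j) : p z := by
  refine Submodule.closure_induction (p := fun z _ => p z) h0 (fun x y _ _ => hadd x y) ?_ hz
  rintro r _ ⟨x, hx, y, hy, h, h', rfl⟩
  rw [TensorProduct.smul_tmul']
  exact ht _ (Submodule.smul_mem _ r hx) y hy (fun a ha => by rw [map_smul, h a ha, smul_zero]) h'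

lemma normalizedTensor_le (i j : ℕ) {n : ZMod 2} (h : ((i + j : ℕ) : ZMod 2) = n) :
    C.normalizedTensor D i j ≤ (C.periodic.tensor D.periodic).N n := by
  refine Submodule.span_le.2 ?_
  rintro _ ⟨x, hx, y, hy, h1, h2, rfl⟩
  exact SuperData.tmul_mem_N C.periodic D.periodic (mem_normalized hx h1 rfl)
    (mem_normalized hy h2 rfl) (by rw [← h, Nat.cast_add])

end Bidegree

end CocyclicData

end HopfCyclic

namespace HopfCyclic

universe u v w

namespace CocyclicData

variable {k : Type u} [Field k]

/-! ### The shuffle maps on normalized cochains -/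

lemma exists_eq_append_cons (c : Bool) {a : ℕ} {w : List Bool} (h : a < w.count c) :
    ∃ u v : List Bool, w = u ++ c :: v ∧ u.count c = a := by
  induction w generalizing a with
  | nil => simp at h
  | cons b w ih =>
    by_cases hb : b = c
    · subst hb
      rcases a with _ | a
      · exact ⟨[], w, rfl, rfl⟩
      · rw [List.count_cons_self] at h
        obtain ⟨u, v, rfl, hu⟩ := ih (show a < w.count b by omega)
        exact ⟨b :: u, v, rfl, by rw [List.count_cons_self, hu]⟩
    · rw [List.count_cons_of_ne hb] at h
      obtain ⟨u, v, rfl, hu⟩ := ih h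
      exact ⟨b :: u, v, rfl, by rw [List.count_cons_of_ne hb, hu]⟩

namespace IsCocyclic

variable {C D : CocyclicData.{u, w} k} (hC : C.IsCocyclic) (hD : D.IsCocyclic)

lemma pw_mem_bideg {N : ℕ} {z : C.Tot ⊗[k] D.Tot} (hz : z ∈ C.bideg D N N) {w : List Bool}
    (hw : w ∈ words N) : C.pw D w z ∈ C.bideg D (w.count true) (w.count false) := by
  have hw := mem_words.1 hw
  have hc := count_true_add_count_false w
  refine bideg_induction (p := fun z => C.pw D w z ∈ C.bideg D (w.count true) (w.count false))
    ?_ (fun x y hx hy => ?_) (fun x hx y hy => ?_) hz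
  · rw [map_zero]; exact Submodule.zero_mem _
  · rw [map_add]; exact Submodule.add_mem _ hx hy
  · rw [pw_tmul]
    exact tmul_mem_bideg (wd_mem hx _ _ (by omega))
      (wd_mem hy _ _ (by rw [count_map_not, Bool.not_false]; omega))

section

include hC hD

lemma pw_mem_normalizedTensor {N : ℕ} {z : C.Tot ⊗[k] D.Tot} (hz : z ∈ C.bideg D N N)
    (h : ∀ m < N, TensorProduct.map (C.s m) (D.s m) z = 0) {w : List Bool} (hw : w ∈ words N) :
    C.pw D w z ∈ C.normalizedTensor D (w.count true) (w.count false) := by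
  refine mem_normalizedTensor (pw_mem_bideg hz hw) (fun a ha => ?_) fun a ha => ?_
  · obtain ⟨u, v, rfl, rfl⟩ := exists_eq_append_cons true ha
    have hw := mem_words.1 hw
    rw [List.length_append, List.length_cons] at hw
    have hu : (u.map not).length = u.length := List.length_map _
    have hv : (v.map not).length = v.length := List.length_map _
    have e := eq_on_bideg (TensorProduct.map (C.s (u.count true)) LinearMap.id ∘ₗ
        C.pw D (u ++ true :: v))
      (C.pw D (u ++ v) ∘ₗ TensorProduct.map (C.s u.length) (D.s u.length))
      (fun x hx y hy => ?_) hz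
    · exact e.trans (by rw [LinearMap.comp_apply, h _ (by omega), map_zero])
    · rw [LinearMap.comp_apply, LinearMap.comp_apply, TensorProduct.map_tmul, pw_tmul, pw_tmul,
        TensorProduct.map_tmul, LinearMap.id_apply, hC.s_wd_append_true hx _ _ (by omega),
        hC.wd_append_false hx _ _ (by omega), map_not_append, map_not_append, List.map_cons,
        Bool.not_true, hD.wd_append_false hy _ _ (by omega), hu]
  · obtain ⟨u, v, rfl, rfl⟩ := exists_eq_append_cons false ha
    have hw := mem_words.1 hw
    rw [List.length_append, List.length_cons] at hw
    have hu : (u.map not).length = u.length := List.length_map _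
    have hv : (v.map not).length = v.length := List.length_map _
    have e := eq_on_bideg (TensorProduct.map LinearMap.id (D.s (u.count false)) ∘ₗ
        C.pw D (u ++ false :: v))
      (C.pw D (u ++ v) ∘ₗ TensorProduct.map (C.s u.length) (D.s u.length))
      (fun x hx y hy => ?_) hz
    · exact e.trans (by rw [LinearMap.comp_apply, h _ (by omega), map_zero])
    · have h1 : u.count false = (u.map not).count true := by rw [count_map_not, Bool.not_true]
      rw [LinearMap.comp_apply, LinearMap.comp_apply, TensorProduct.map_tmul, pw_tmul, pw_tmul,
        TensorProduct.map_tmul, LinearMap.id_apply, map_not_append, map_not_append, List.map_cons,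
        Bool.not_false, h1, hD.s_wd_append_true hy _ _ (by omega),
        hD.wd_append_false hy _ _ (by omega), hC.wd_append_false hx _ _ (by omega), hu]

lemma cyc_mem_normalizedTensor (w : List Bool) {z : C.Tot ⊗[k] D.Tot}
    (hz : z ∈ C.normalizedTensor D (w.count true) (w.count false)) :
    C.cyc D w z ∈ C.normalizedTensor D (w.count true - 1) (w.count false - 1) := by
  refine normalizedTensor_induction (p := fun z =>
    C.cyc D w z ∈ C.normalizedTensor D (w.count true - 1) (w.count false - 1))
    ?_ (fun x y hx hy => ?_) (fun x hx y hy hx' hy' => ?_) hz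
  · rw [map_zero]; exact Submodule.zero_mem _
  · rw [map_add]; exact Submodule.add_mem _ hx hy
  · rw [cyc_tmul]
    refine Submodule.sum_mem _ fun p hp => Submodule.sum_mem _ fun q hq =>
      Submodule.smul_mem _ _ (Submodule.subset_span ⟨_, ?_, _, ?_, ?_, ?_, rfl⟩)
    · have := Finset.mem_range.1 hp
      exact extra_mem hx _ _ (by omega)
    · have := Finset.mem_range.1 hq
      exact extra_mem hy _ _ (by omega)
    · intro a ha
      obtain ⟨F, m, hm, hF⟩ := hC.exists_s_extra (show a + 2 ≤ w.count true by omega)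
        (Finset.mem_range.1 hp)
      rw [hF x hx, hx' m hm, map_zero]
    · intro a ha
      obtain ⟨F, m, hm, hF⟩ := hD.exists_s_extra (show a + 2 ≤ w.count false by omega)
        (Finset.mem_range.1 hq)
      rw [hF y hy, hy' m hm, map_zero]

lemma tensorOp_B_eq {i j : ℕ} {z : C.Tot ⊗[k] D.Tot} (hz : z ∈ C.normalizedTensor D i j) :
    C.tensorOp D C.B D.B z = C.tensorOp D (C.connes i) (D.connes j) z := by
  refine normalizedTensor_induction (p := fun z =>
    C.tensorOp D C.B D.B z = C.tensorOp D (C.connes i) (D.connes j) z)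
    ?_ (fun x y hx hy => ?_) (fun x hx y hy hx' hy' => ?_) hz
  · rw [map_zero, map_zero]
  · rw [map_add, map_add, hx, hy]
  · rw [tensorOp_tmul, tensorOp_tmul, hC.B_eq_connes hx hx', hD.B_eq_connes hy hy']

omit hD in
lemma connes_extra_eq_zero {d r : ℕ} {x : C.Tot} (hx : x ∈ C.deg d) (h : ∀ a < d, C.s a x = 0)
    (hr : r < d) : C.connes (d - 1) (C.extra d r x) = 0 := by
  rw [connes_apply]
  refine Finset.sum_eq_zero fun r' hr' => ?_
  have hr' := Finset.mem_range.1 hr'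
  obtain ⟨F, hF⟩ := hC.exists_extra_extra (show 2 ≤ d by omega) hr hr'
  rw [hF x hx, h r hr, map_zero, smul_zero]

lemma tensorOp_B_cyc (w : List Bool) {z : C.Tot ⊗[k] D.Tot}
    (hz : z ∈ C.normalizedTensor D (w.count true) (w.count false)) :
    C.tensorOp D C.B D.B (C.cyc D w z) = 0 := by
  rw [hC.tensorOp_B_eq hD (hC.cyc_mem_normalizedTensor hD w hz)]
  refine normalizedTensor_induction (p := fun z => C.tensorOp D (C.connes (w.count true - 1))
    (D.connes (w.count false - 1)) (C.cyc D w z) = 0)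
    ?_ (fun x y hx hy => ?_) (fun x hx y hy hx' hy' => ?_) hz
  · rw [map_zero, map_zero]
  · rw [map_add, map_add, hx, hy, add_zero]
  · rw [cyc_tmul, map_sum]
    refine Finset.sum_eq_zero fun p hp => ?_
    rw [map_sum]
    refine Finset.sum_eq_zero fun q hq => ?_
    rw [map_smul, tensorOp_tmul, hC.connes_extra_eq_zero hx hx' (Finset.mem_range.1 hp),
      hD.connes_extra_eq_zero hy hy' (Finset.mem_range.1 hq), TensorProduct.zero_tmul,
      TensorProduct.tmul_zero, add_zero, smul_zero]

/-- The cyclic shuffle map vanishes on the image of Connes' operator. -/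
lemma wordCsh_extra {N r : ℕ} (hr : r < N) {z : C.Tot ⊗[k] D.Tot} (hz : z ∈ C.bideg D N N)
    (h : ∀ m < N, TensorProduct.map (C.s m) (D.s m) z = 0) :
    C.wordCsh D (N - 1) (TensorProduct.map (C.extra N r) (D.extra N r) z) = 0 := by
  rw [wordCsh, LinearMap.sum_apply, show N - 1 = (N - 1 - r) + r by omega]
  rw [sum_words_add]
  refine Finset.sum_eq_zero fun v hv => Finset.sum_eq_zero fun u hu => ?_
  have hv := mem_words.1 hv
  have hu := mem_words.1 hu
  have hu' : (u.map not).length = u.length := List.length_map _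
  have hv' : (v.map not).length = v.length := List.length_map _
  rw [LinearMap.smul_apply, Module.End.mul_apply, cyc, LinearMap.sum_apply,
    Finset.sum_eq_zero, smul_zero]
  intro p hp
  rw [LinearMap.sum_apply, Finset.sum_eq_zero]
  intro q hq
  have hp := Finset.mem_range.1 hp
  have hq := Finset.mem_range.1 hq
  rw [List.count_append] at hp hq
  have hc : (u ++ true :: v).count true = (v ++ u).count true + 1 := by simp; omega
  have he : (u ++ false :: v).count false = (v ++ u).count false + 1 := by simp; omega
  rw [LinearMap.smul_apply]
  have e1 := hC.exists_extra_extra (d := (u ++ true :: v).count true) (r := u.count true) (r' := p)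
    (by rw [hc, List.count_append]; omega) (by simp)
    (by rw [hc, List.count_append]; omega)
  have e2 := hD.exists_extra_extra (d := (u ++ false :: v).count false) (r := u.count false)
    (r' := q) (by rw [he, List.count_append]; omega) (by simp)
    (by rw [he, List.count_append]; omega)
  obtain ⟨F, hF⟩ := e1
  obtain ⟨F', hF'⟩ := e2
  have e := eq_on_bideg (TensorProduct.map (C.extra ((v ++ u).count true) p)
      (D.extra ((v ++ u).count false) q) ∘ₗ C.pw D (v ++ u) ∘ₗ
        TensorProduct.map (C.extra N r) (D.extra N r))
    (TensorProduct.map F F' ∘ₗ C.pw D (u ++ v) ∘ₗ TensorProduct.map (C.s r) (D.s r))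
    (fun x hx y hy => ?_) hz
  · rw [LinearMap.comp_apply, LinearMap.comp_apply, LinearMap.comp_apply, LinearMap.comp_apply,
      h r hr, map_zero, map_zero] at e
    rw [e, smul_zero]
  · have e1 := hC.extra_wd_eq_wd_extra hx (u := u) (v := v) (by omega)
    have e2 := hD.extra_wd_eq_wd_extra hy (u := u.map not) (v := v.map not) (by omega)
    have h1 : (u.map not ++ true :: v.map not) = (u ++ false :: v).map not := by simp
    rw [h1, count_map_not, count_map_not, ← map_not_append, hu', Bool.not_true] at e2
    have hl : (u ++ true :: v).length = N := by simp; omega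
    have hl' : (u ++ false :: v).length = N := by simp; omega
    have hcc := count_true_add_count_false (u ++ true :: v)
    have hcc' := count_true_add_count_false (u ++ false :: v)
    have m1 : C.wd 0 (u ++ true :: v) x ∈ C.deg ((u ++ true :: v).count true) :=
      wd_mem hx _ _ (by omega)
    have m2 : D.wd 0 ((u ++ false :: v).map not) y ∈ D.deg ((u ++ false :: v).count false) :=
      wd_mem hy _ _ (by rw [count_map_not, Bool.not_false]; omega)
    have f1 := hF _ m1
    have f2 := hF' _ m2
    rw [hc, Nat.add_sub_cancel, ← hc] at f1
    rw [he, Nat.add_sub_cancel, ← he] at f2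
    have h2 : u.count false = (u.map not).count true := by rw [count_map_not, Bool.not_true]
    simp only [LinearMap.comp_apply, TensorProduct.map_tmul, pw_tmul]
    rw [← hu, ← e1, ← e2, f1, f2, hC.s_wd_append_true hx _ _ (by omega),
      hC.wd_append_false hx _ _ (by omega), ← h1, h2, hD.s_wd_append_true hy _ _ (by omega),
      hD.wd_append_false hy _ _ (by omega), hu', map_not_append]

end

end IsCocyclic

end CocyclicData

end HopfCyclic

namespace HopfCyclic

universe u v w

namespace CocyclicData

variable {k : Type u} [Field k]

/-! ### Shuffles and words -/

/-- The positions of the letter `c` in a word, counted from `j`. -/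
def positions (c : Bool) : ℕ → List Bool → List ℕ
  | _, [] => []
  | j, b :: w => if b = c then j :: positions c (j + 1) w else positions c (j + 1) w

lemma mem_positions {c : Bool} {j p : ℕ} {w : List Bool} :
    p ∈ positions c j w ↔ ∃ q, w[q]? = some c ∧ p = j + q := by
  induction w generalizing j with
  | nil => simp [positions]
  | cons b w ih =>
    have h : (∃ q, (b :: w)[q]? = some c ∧ p = j + q) ↔
        (b = c ∧ p = j) ∨ ∃ q, w[q]? = some c ∧ p = j + 1 + q := by
      constructor
      · rintro ⟨_ | q, h, rfl⟩
        · exact Or.inl ⟨by simpa using h, by omega⟩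
        · exact Or.inr ⟨q, by simpa using h, by omega⟩
      · rintro (⟨rfl, rfl⟩ | ⟨q, h, rfl⟩)
        · exact ⟨0, by simp, by omega⟩
        · exact ⟨q + 1, by simpa using h, by omega⟩
    rw [h, ← ih, positions]
    split_ifs with hb
    · rw [List.mem_cons]; tauto
    · tauto

lemma le_of_mem_positions {c : Bool} {j p : ℕ} {w : List Bool} (h : p ∈ positions c j w) :
    j ≤ p := by
  obtain ⟨q, -, rfl⟩ := mem_positions.1 h
  omega

lemma positions_pairwise (c : Bool) (j : ℕ) (w : List Bool) :
    (positions c j w).Pairwise (· < ·) := by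
  induction w generalizing j with
  | nil => exact List.Pairwise.nil
  | cons b w ih =>
    rw [positions]
    split_ifs
    · exact List.Pairwise.cons (fun p hp => le_of_mem_positions hp) (ih _)
    · exact ih _

lemma length_positions (c : Bool) (j : ℕ) (w : List Bool) :
    (positions c j w).length = w.count c := by
  induction w generalizing j with
  | nil => rfl
  | cons b w ih =>
    rw [positions]
    split_ifs with hb
    · rw [hb, List.length_cons, ih, List.count_cons_self]
    · rw [ih, List.count_cons_of_ne hb]

lemma positions_map_not (c : Bool) (j : ℕ) (w : List Bool) :
    positions c j (w.map not) = positions (!c) j w := by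
  induction w generalizing j with
  | nil => rfl
  | cons b w ih => cases b <;> cases c <;> simp [positions, ih]

lemma wd_eq_prod (C : CocyclicData.{u, w} k) (j : ℕ) (w : List Bool) :
    C.wd j w = ((positions false j w).map C.s).prod := by
  induction w generalizing j with
  | nil => rfl
  | cons b w ih => cases b <;> simp [positions, ih, wd]

lemma getD_mem_positions {c : Bool} {j p : ℕ} {w : List Bool} (h : p < w.count c) :
    (positions c j w).getD p 0 ∈ positions c j w := by
  rw [← length_positions c j] at h
  rw [List.getD_eq_getElem _ _ h]
  exact List.getElem_mem h

lemma precedes_eq {w : List Bool} (j : ℕ) {p q : ℕ} (hp : p < w.count true)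
    (hq : q < w.count false) : precedes k w p q =
      if (positions true j w).getD p 0 < (positions false j w).getD q 0 then 1 else 0 := by
  induction w generalizing j p q with
  | nil => simp at hp
  | cons b w ih =>
    cases b
    · rw [List.count_cons_self] at hq
      rw [List.count_cons_of_ne (by decide)] at hp
      rcases q with _ | q
      · have := le_of_mem_positions (getD_mem_positions (j := j + 1) hp)
        rw [precedes, if_neg]
        simp only [positions, reduceIte, Bool.false_eq_true, List.getD_cons_zero]
        omega
      · rw [precedes, ih (j + 1) hp (by omega)]
        simp [positions]
    · rw [List.count_cons_self] at hp
      rw [List.count_cons_of_ne (by decide)] at hq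
      rcases p with _ | p
      · have := le_of_mem_positions (getD_mem_positions (j := j + 1) hq)
        rw [precedes, if_pos]
        simp only [positions, reduceIte, Bool.true_eq_false, List.getD_cons_zero]
        omega
      · rw [precedes, ih (j + 1) (by omega) hq]
        simp [positions]

lemma sg_eq_prod (w : List Bool) : sg k w = ∏ p ∈ Finset.range (w.count true),
    ∏ q ∈ Finset.range (w.count false), (2 * precedes k w p q - 1) := by
  induction w with
  | nil => simp [sg]
  | cons b w ih =>
    cases b
    · rw [List.count_cons_self, List.count_cons_of_ne (by decide)]
      simp only [Finset.prod_range_succ', precedes, Finset.prod_mul_distrib]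
      rw [sg, ih, mul_comm]
      congr 1
      rw [Finset.prod_const, Finset.card_range]
      congr 1
      ring
    · rw [List.count_cons_self, List.count_cons_of_ne (by decide), Finset.prod_range_succ']
      simp only [precedes]
      rw [sg, ih, Finset.prod_eq_one (s := Finset.range (w.count false)) fun q _ => by ring,
        mul_one]

section Shuffle

variable {n i : ℕ}

/-- The word of a shuffle, which has the letter `true` at the first `i` values. -/
def shuffleWord (i : ℕ) (μ : Equiv.Perm (Fin n)) : List Bool :=
  List.ofFn fun p => decide ((μ.symm p).val < i)

/-- A permutation of `{0, …, n - 1}` as a function on the natural numbers. -/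
def permVal (μ : Equiv.Perm (Fin n)) (a : ℕ) : ℕ := if h : a < n then (μ ⟨a, h⟩).val else a

lemma permVal_val (μ : Equiv.Perm (Fin n)) (a : Fin n) : permVal μ a = μ a := by
  rw [permVal, dif_pos a.2]

lemma shuffleWord_permVal (μ : Equiv.Perm (Fin n)) {a : ℕ} (ha : a < n) (c : Bool) :
    (shuffleWord i μ)[permVal μ a]? = some c ↔ decide (a < i) = c := by
  rw [permVal, dif_pos ha, shuffleWord, List.getElem?_ofFn, dif_pos (μ _).2]
  simp

lemma mem_positions_shuffleWord (μ : Equiv.Perm (Fin n)) (c : Bool) (p : ℕ) :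
    p ∈ positions c 0 (shuffleWord i μ) ↔ ∃ a < n, decide (a < i) = c ∧ permVal μ a = p := by
  rw [mem_positions]
  constructor
  · rintro ⟨q, h, rfl⟩
    have hq : q < n := by
      by_contra hq
      rw [List.getElem?_eq_none (by rw [shuffleWord, List.length_ofFn]; omega)] at h
      simp at h
    have e : permVal μ (μ.symm ⟨q, hq⟩) = q := by rw [permVal_val, Equiv.apply_symm_apply]
    refine ⟨μ.symm ⟨q, hq⟩, Fin.is_lt _, (shuffleWord_permVal μ (Fin.is_lt _) c).1 ?_, ?_⟩
    · rw [e]; exact h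
    · rw [e, Nat.zero_add]
  · rintro ⟨a, ha, h, rfl⟩
    exact ⟨_, (shuffleWord_permVal μ ha c).2 h, (Nat.zero_add _).symm⟩

lemma mem_shuffles {μ : Equiv.Perm (Fin n)} : μ ∈ shuffles n i ↔ IsShuffle i μ := by
  simp [shuffles]

lemma positions_shuffleWord_true (hi : i ≤ n) {μ : Equiv.Perm (Fin n)} (hμ : μ ∈ shuffles n i) :
    positions true 0 (shuffleWord i μ) = (List.range i).map (permVal μ) := by
  refine List.Pairwise.eq_of_mem_iff (positions_pairwise _ _ _) ?_ fun p => ?_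
  · rw [List.pairwise_map]
    refine List.pairwise_lt_range.imp_of_mem fun {a b} ha hb hab => ?_
    have ha := List.mem_range.1 ha
    have hb := List.mem_range.1 hb
    rw [permVal, permVal, dif_pos (by omega), dif_pos (by omega)]
    exact (mem_shuffles.1 hμ).1 _ _ hab hb
  · rw [mem_positions_shuffleWord, List.mem_map]
    simp only [decide_eq_true_eq, List.mem_range]
    constructor
    · rintro ⟨a, -, h, rfl⟩; exact ⟨a, h, rfl⟩
    · rintro ⟨a, h, rfl⟩; exact ⟨a, by omega, h, rfl⟩

lemma positions_shuffleWord_false {μ : Equiv.Perm (Fin n)} (hμ : μ ∈ shuffles n i) :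
    positions false 0 (shuffleWord i μ) =
      (List.range (n - i)).map fun q => permVal μ (i + q) := by
  refine List.Pairwise.eq_of_mem_iff (positions_pairwise _ _ _) ?_ fun p => ?_
  · rw [List.pairwise_map]
    refine List.pairwise_lt_range.imp_of_mem fun {a b} ha hb hab => ?_
    have ha := List.mem_range.1 ha
    have hb := List.mem_range.1 hb
    rw [permVal, permVal, dif_pos (by omega), dif_pos (by omega)]
    exact (mem_shuffles.1 hμ).2 _ _ (by rw [Fin.mk_lt_mk]; omega) (by simp)
  · rw [mem_positions_shuffleWord, List.mem_map]
    simp only [decide_eq_false_iff_not, List.mem_range]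
    constructor
    · rintro ⟨a, ha, h, rfl⟩; exact ⟨a - i, by omega, by congr 1; omega⟩
    · rintro ⟨a, h, rfl⟩; exact ⟨i + a, by omega, by omega, rfl⟩

lemma count_shuffleWord (hi : i ≤ n) {μ : Equiv.Perm (Fin n)} (hμ : μ ∈ shuffles n i) :
    (shuffleWord i μ).count true = i ∧ (shuffleWord i μ).count false = n - i := by
  rw [← length_positions true 0, ← length_positions false 0, positions_shuffleWord_true hi hμ,
    positions_shuffleWord_false hμ]
  simp

lemma precedes_shuffleWord (hi : i ≤ n) {μ : Equiv.Perm (Fin n)} (hμ : μ ∈ shuffles n i)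
    {p q : ℕ} (hp : p < i) (hq : q < n - i) : precedes k (shuffleWord i μ) p q =
      if permVal μ p < permVal μ (i + q) then 1 else 0 := by
  obtain ⟨h1, h2⟩ := count_shuffleWord hi hμ
  rw [precedes_eq 0 (by rwa [h1]) (by rwa [h2]), positions_shuffleWord_true hi hμ,
    positions_shuffleWord_false hμ, List.getD_eq_getElem _ _ (by simpa using hp),
    List.getD_eq_getElem _ _ (by simpa using hq)]
  simp

@[to_additive]
lemma prod_fin_split {V : Type*} [CommMonoid V] (hi : i ≤ n) (F : ℕ → ℕ → V) :
    ∏ a : Fin n, ∏ c : Fin n, (if a.val < i ∧ i ≤ c.val then F a c else 1) =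
      ∏ p ∈ Finset.range i, ∏ q ∈ Finset.range (n - i), F p (i + q) := by
  obtain ⟨j, rfl⟩ := Nat.exists_eq_add_of_le hi
  rw [Fin.prod_univ_eq_prod_range
    (fun a => ∏ c : Fin (i + j), if a < i ∧ i ≤ c.val then F a c else 1), Finset.prod_range_add,
    Finset.prod_eq_one (s := Finset.range j) fun a _ => Finset.prod_eq_one fun c _ =>
      if_neg (by omega), mul_one]
  refine Finset.prod_congr rfl fun p hp => ?_
  have hp := Finset.mem_range.1 hp
  rw [Fin.prod_univ_eq_prod_range (fun c => if p < i ∧ i ≤ c then F p c else 1),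
    Finset.prod_range_add, Finset.prod_eq_one (s := Finset.range i) fun a ha => by
      have := Finset.mem_range.1 ha
      exact if_neg (by omega), one_mul, Nat.add_sub_cancel_left]
  exact Finset.prod_congr rfl fun q _ => if_pos ⟨hp, by omega⟩

lemma sign_eq_sg (hi : i ≤ n) {μ : Equiv.Perm (Fin n)} (hμ : μ ∈ shuffles n i) :
    ((Equiv.Perm.sign μ : ℤ) : k) = sg k (shuffleWord i μ) := by
  obtain ⟨h1, h2⟩ := count_shuffleWord hi hμ
  have hs := mem_shuffles.1 hμ
  rw [sg_eq_prod, h1, h2, Equiv.Perm.sign_eq_prod_prod_Ioi]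
  have h3 : ∏ p ∈ Finset.range i, ∏ q ∈ Finset.range (n - i),
      (2 * precedes k (shuffleWord i μ) p q - 1) =
      ∏ p ∈ Finset.range i, ∏ q ∈ Finset.range (n - i),
        if permVal μ p < permVal μ (i + q) then (1 : k) else -1 := by
    refine Finset.prod_congr rfl fun p hp => Finset.prod_congr rfl fun q hq => ?_
    rw [precedes_shuffleWord hi hμ (Finset.mem_range.1 hp) (Finset.mem_range.1 hq)]
    split_ifs <;> ring
  rw [h3, ← prod_fin_split hi fun a c => if permVal μ a < permVal μ c then (1 : k) else -1]
  push_cast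
  refine Finset.prod_congr rfl fun a _ => ?_
  rw [← Finset.prod_subset (Finset.subset_univ (Finset.Ioi a))]
  · refine Finset.prod_congr rfl fun c hc => ?_
    have hac := Finset.mem_Ioi.1 hc
    rw [permVal_val, permVal_val]
    by_cases h : a.val < i ∧ i ≤ c.val
    · rw [if_pos h]
      simp only [Fin.lt_def]
      split_ifs <;> simp
    · have : μ a < μ c := by
        by_cases h' : c.val < i
        · exact hs.1 a c hac h'
        · exact hs.2 a c hac (by omega)
      rw [if_neg h, if_pos this]
      simp
  · intro c _ hc
    rw [Finset.mem_Ioi, Fin.lt_def] at hc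
    exact if_neg (by omega)

lemma degenFirst_eq (D : CocyclicData.{u, w} k) (hi : i ≤ n) {μ : Equiv.Perm (Fin n)}
    (hμ : μ ∈ shuffles n i) : D.degenFirst i μ = D.wd 0 ((shuffleWord i μ).map not) := by
  rw [wd_eq_prod, positions_map_not, Bool.not_false, positions_shuffleWord_true hi hμ, degenFirst]
  congr 1
  have h1 : ((List.finRange n).filter fun a => a.val < i).map (fun a => a.val) = List.range i := by
    refine List.Pairwise.eq_of_mem_iff (r := (· < ·)) ?_ List.pairwise_lt_range fun p => ?_
    · exact List.pairwise_map.2 ((List.pairwise_lt_finRange n).filter _)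
    · simp only [List.mem_map, List.mem_filter, List.mem_finRange, true_and, decide_eq_true_eq,
        List.mem_range]
      exact ⟨by rintro ⟨a, h, rfl⟩; exact h, fun h => ⟨⟨p, by omega⟩, h, rfl⟩⟩
  rw [← h1, List.map_map, List.map_map]
  exact List.map_congr_left fun a _ => by
    rw [Function.comp_apply, Function.comp_apply, permVal_val]

lemma degenLast_eq (C : CocyclicData.{u, w} k) {μ : Equiv.Perm (Fin n)}
    (hμ : μ ∈ shuffles n i) : C.degenLast i μ = C.wd 0 (shuffleWord i μ) := by
  rw [wd_eq_prod, positions_shuffleWord_false hμ, degenLast]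
  congr 1
  have h1 : ((List.finRange n).filter fun a => i ≤ a.val).map (fun a => a.val) =
      (List.range (n - i)).map fun q => i + q := by
    refine List.Pairwise.eq_of_mem_iff (r := (· < ·)) ?_ ?_ fun p => ?_
    · exact List.pairwise_map.2 ((List.pairwise_lt_finRange n).filter _)
    · exact List.pairwise_map.2 (List.pairwise_lt_range.imp fun h => by omega)
    · simp only [List.mem_map, List.mem_filter, List.mem_finRange, true_and, decide_eq_true_eq,
        List.mem_range]
      exact ⟨by rintro ⟨a, h, rfl⟩; exact ⟨a - i, by omega, by omega⟩,
        by rintro ⟨q, h, rfl⟩; exact ⟨⟨i + q, by omega⟩, by simp, rfl⟩⟩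
  have h2 : (List.range (n - i)).map (fun q => permVal μ (i + q)) =
      ((List.range (n - i)).map fun q => i + q).map (permVal μ) := by rw [List.map_map]; rfl
  rw [h2, ← h1, List.map_map, List.map_map]
  exact List.map_congr_left fun a _ => by
    rw [Function.comp_apply, Function.comp_apply, permVal_val]

lemma exists_shuffleWord_eq {w : List Bool} (hw : w.length = n) :
    ∃ μ ∈ shuffles n (w.count true), shuffleWord (w.count true) μ = w := by
  have hc := count_true_add_count_false w
  let L := positions true 0 w ++ positions false 0 w
  have hL : L.length = n := by
    rw [List.length_append, length_positions, length_positions, hc, hw]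
  have hlt : ∀ p ∈ L, p < n := by
    intro p hp
    have : ∀ c, p ∈ positions c 0 w → p < n := fun c hc => by
      obtain ⟨q, h, rfl⟩ := mem_positions.1 hc
      obtain ⟨h, -⟩ := List.getElem?_eq_some_iff.1 h
      omega
    rcases List.mem_append.1 hp with h | h
    exacts [this _ h, this _ h]
  have hnd : L.Nodup := by
    refine List.nodup_append.2 ⟨(positions_pairwise _ _ _).imp fun h => h.ne,
      (positions_pairwise _ _ _).imp fun h => h.ne, ?_⟩
    rintro a ha b hb rfl
    obtain ⟨q, h, rfl⟩ := mem_positions.1 ha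
    obtain ⟨q', h', e⟩ := mem_positions.1 hb
    obtain rfl : q = q' := by omega
    rw [h] at h'
    simp at h'
  let f : Fin n → Fin n := fun a => ⟨L[a.val]'(by rw [hL]; exact a.2), hlt _ (List.getElem_mem _)⟩
  have hf : Function.Injective f := fun a b h => by
    have := (hnd.getElem_inj_iff).1 (congrArg Fin.val h)
    exact Fin.ext this
  let μ : Equiv.Perm (Fin n) := Equiv.ofBijective f (Finite.injective_iff_bijective.1 hf)
  have hμ1 : ∀ a : Fin n, ∀ h : a.val < w.count true, (μ a).val =
      (positions true 0 w)[a.val]'(by rw [length_positions]; exact h) := fun a h =>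
    List.getElem_append_left _
  have hμ2 : ∀ a : Fin n, ∀ h : w.count true ≤ a.val, (μ a).val =
      (positions false 0 w)[a.val - w.count true]'(by rw [length_positions]; omega) := fun a h => by
    refine (List.getElem_append_right (by rw [length_positions]; exact h)).trans ?_
    simp only [length_positions]
  refine ⟨μ, mem_shuffles.2 ⟨fun a b hab hb => ?_, fun a b hab ha => ?_⟩, ?_⟩
  · have hab' : a.val < b.val := hab
    rw [Fin.lt_def, hμ1 a (by omega), hμ1 b hb]
    exact List.pairwise_iff_getElem.1 (positions_pairwise true 0 w) _ _ _ _ hab'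
  · have hab' : a.val < b.val := hab
    rw [Fin.lt_def, hμ2 a ha, hμ2 b (by omega)]
    exact List.pairwise_iff_getElem.1 (positions_pairwise false 0 w) _ _ _ _ (by omega)
  · refine List.ext_getElem (by rw [shuffleWord, List.length_ofFn, hw]) fun p h h' => ?_
    simp only [shuffleWord, List.getElem_ofFn]
    have hp : p < n := by omega
    obtain ⟨a, ha⟩ := μ.surjective ⟨p, hp⟩
    have hap : (μ a).val = p := congrArg Fin.val ha
    rw [show (⟨p, _⟩ : Fin n) = μ a from ha.symm, Equiv.symm_apply_apply]
    by_cases hat : a.val < w.count true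
    · have e := hμ1 a hat
      have hm : p ∈ positions true 0 w := by rw [← hap, e]; exact List.getElem_mem _
      obtain ⟨q, hq, hpq⟩ := mem_positions.1 hm
      obtain rfl : p = q := by omega
      rw [(List.getElem?_eq_some_iff.1 hq).2, decide_eq_true hat]
    · have e := hμ2 a (by omega)
      have hm : p ∈ positions false 0 w := by rw [← hap, e]; exact List.getElem_mem _
      obtain ⟨q, hq, hpq⟩ := mem_positions.1 hm
      obtain rfl : p = q := by omega
      rw [(List.getElem?_eq_some_iff.1 hq).2, decide_eq_false hat]

lemma sum_shuffles {V : Type*} [AddCommMonoid V] (g : List Bool → V) :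
    ∑ i ∈ Finset.range (n + 1), ∑ μ ∈ shuffles n i, g (shuffleWord i μ) = ∑ w ∈ words n, g w := by
  rw [Finset.sum_sigma']
  refine Finset.sum_bij (fun x _ => shuffleWord x.1 x.2) ?_ ?_ ?_ fun _ _ => rfl
  · intro x _
    exact mem_words.2 (by rw [shuffleWord, List.length_ofFn])
  · rintro ⟨i, μ⟩ hμ ⟨j, ν⟩ hν e
    simp only [Finset.mem_sigma, Finset.mem_range] at hμ hν
    have h1 := (count_shuffleWord (by omega) hμ.2).1
    have h2 := (count_shuffleWord (by omega) hν.2).1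
    obtain rfl : i = j := by rw [← h1, ← h2]; exact congrArg _ e
    have e : shuffleWord i μ = shuffleWord i ν := e
    have h3 := positions_shuffleWord_true (by omega) hμ.2
    rw [e, positions_shuffleWord_true (by omega) hν.2] at h3
    have h4 := positions_shuffleWord_false hμ.2
    rw [e, positions_shuffleWord_false hν.2] at h4
    refine Sigma.ext rfl (heq_of_eq (Equiv.ext fun a => Fin.ext ?_))
    rw [← permVal_val, ← permVal_val]
    by_cases ha : a.val < i
    · exact (List.map_inj_left.1 h3 a.val (List.mem_range.2 ha)).symm
    · have := List.map_inj_left.1 h4 (a.val - i) (List.mem_range.2 (by omega))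
      rw [show i + (a.val - i) = a.val by omega] at this
      exact this.symm
  · intro w hw
    have hw := mem_words.1 hw
    obtain ⟨μ, hμ, e⟩ := exists_shuffleWord_eq hw
    exact ⟨⟨w.count true, μ⟩, Finset.mem_sigma.2 ⟨Finset.mem_range.2 (by
      change w.count true < n + 1
      have := count_true_add_count_false w
      omega), hμ⟩, e⟩

end Shuffle

section ShuffleMaps

variable (C D : CocyclicData.{u, w} k) (n : ℕ)

lemma shTerm_eq_wordSh : shTerm C D n = C.wordSh D n := by
  rw [wordSh, ← sum_shuffles, shTerm]
  refine Finset.sum_congr rfl fun i hi => Finset.sum_congr rfl fun μ hμ => ?_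
  have hi : i ≤ n := by have := Finset.mem_range.1 hi; omega
  rw [sign_eq_sg hi hμ, degenLast_eq C hμ, degenFirst_eq D hi hμ, pw]

lemma cshTerm_eq_wordCsh : cshTerm C D n = C.wordCsh D n := by
  rw [wordCsh, ← sum_shuffles, cshTerm]
  refine Finset.sum_congr rfl fun i hi => Finset.sum_congr rfl fun μ hμ => ?_
  have hi : i ≤ n := by have := Finset.mem_range.1 hi; omega
  obtain ⟨h1, h2⟩ := count_shuffleWord hi hμ
  have e := sum_fin_split hi (fun a c => if permVal μ a < permVal μ c then
    ((-1 : k) ^ (i - 1) * (-1 : k) ^ (a * (i - 1)) *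
            (-1 : k) ^ ((c - i) * (n - i - 1)) * ((Equiv.Perm.sign μ : ℤ) : k)) •
          TensorProduct.map
            (C.s (i - a - 1) * C.t ^ (a + 1) * C.degenLast i μ)
            (D.s (n - i - (c - i) - 1) * D.t ^ (c - i + 1) * D.degenFirst i μ)
      else 0)
  refine Eq.trans ?_ (e.trans ?_)
  · refine Finset.sum_congr rfl fun a _ => Finset.sum_congr rfl fun c _ => ?_
    rw [permVal_val, permVal_val, ← ite_and]
    refine if_congr ?_ rfl rfl
    rw [Fin.lt_def, and_assoc]
  · rw [cyc, h1, h2, Finset.sum_mul, Finset.smul_sum]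
    refine Finset.sum_congr rfl fun p hp => ?_
    rw [Finset.sum_mul, Finset.smul_sum]
    refine Finset.sum_congr rfl fun q hq => ?_
    rw [precedes_shuffleWord hi hμ (Finset.mem_range.1 hp) (Finset.mem_range.1 hq), pw,
      smul_mul_assoc, ← TensorProduct.map_mul, degenLast_eq C hμ, degenFirst_eq D hi hμ,
      sign_eq_sg hi hμ, Nat.add_sub_cancel_left, smul_smul, cycCoeff, extra, extra]
    split_ifs
    · rw [mul_one, mul_comm (sg k _)]
    · rw [mul_zero, mul_zero, zero_smul]

end ShuffleMaps

end CocyclicData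

end HopfCyclic

namespace HopfCyclic

universe u v w

namespace CocyclicData

variable {k : Type u} [Field k]

/-! ### The diagonal -/

section Diagonal

variable {C D : CocyclicData.{u, w} k}

lemma IsCocyclic.diag (hC : C.IsCocyclic) (hD : D.IsCocyclic) : (C.diag D).IsCocyclic where
  δ_δ n i j h h' := by
    simp only [← TensorProduct.map_comp, hC.δ_δ n i j h h', hD.δ_δ n i j h h']
  σ_σ n i j h h' := by
    simp only [← TensorProduct.map_comp, hC.σ_σ n i j h h', hD.σ_σ n i j h h']
  σ_δ_lt n i j h h' := by
    simp only [← TensorProduct.map_comp, hC.σ_δ_lt n i j h h', hD.σ_δ_lt n i j h h']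
  σ_δ_self n j h := by
    simp only [← TensorProduct.map_comp, hC.σ_δ_self n j h, hD.σ_δ_self n j h,
      TensorProduct.map_id]
  σ_δ_succ n j h := by
    simp only [← TensorProduct.map_comp, hC.σ_δ_succ n j h, hD.σ_δ_succ n j h,
      TensorProduct.map_id]
  σ_δ_gt n i j h h' := by
    simp only [← TensorProduct.map_comp, hC.σ_δ_gt n i j h h', hD.σ_δ_gt n i j h h']
  τ_δ n i h h' := by
    simp only [← TensorProduct.map_comp, hC.τ_δ n i h h', hD.τ_δ n i h h']
  τ_δ_zero n := by
    simp only [← TensorProduct.map_comp, hC.τ_δ_zero n, hD.τ_δ_zero n]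
  τ_σ n i h h' := by
    simp only [← TensorProduct.map_comp, hC.τ_σ n i h h', hD.τ_σ n i h h']
  τ_σ_zero n := by
    simp only [← TensorProduct.map_comp, hC.τ_σ_zero n, hD.τ_σ_zero n]
  τ_pow n := by
    change TensorProduct.map (C.τ n) (D.τ n) ^ (n + 1) = 1
    rw [TensorProduct.map_pow, hC.τ_pow, hD.τ_pow, TensorProduct.map_one]

variable (C D)

/-- The inclusion of `⨁ₙ Cⁿ ⊗ Dⁿ` into the tensor product of the total spaces. -/
def diagIncl : (C.diag D).Tot →ₗ[k] C.Tot ⊗[k] D.Tot :=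
  DirectSum.toModule k ℕ _ fun n =>
    TensorProduct.map (DirectSum.lof k ℕ C.obj n) (DirectSum.lof k ℕ D.obj n)

variable {C D}

lemma diagIncl_lof (n : ℕ) (x : C.obj n ⊗[k] D.obj n) :
    C.diagIncl D (DirectSum.lof k ℕ (C.diag D).obj n x) =
      TensorProduct.map (DirectSum.lof k ℕ C.obj n) (DirectSum.lof k ℕ D.obj n) x := by
  rw [diagIncl, DirectSum.toModule_lof]

lemma diagIncl_mem {n : ℕ} {x : (C.diag D).Tot} (hx : x ∈ (C.diag D).deg n) :
    C.diagIncl D x ∈ C.bideg D n n := by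
  obtain ⟨x, rfl⟩ := hx
  rw [diagIncl_lof]
  exact ⟨x, rfl⟩

lemma diagIncl_s (a : ℕ) (x : (C.diag D).Tot) :
    C.diagIncl D ((C.diag D).s a x) = TensorProduct.map (C.s a) (D.s a) (C.diagIncl D x) := by
  induction x using DirectSum.induction_on with
  | zero => simp
  | add x y hx hy => rw [map_add, map_add, hx, hy, map_add, map_add]
  | of n x =>
    rw [← DirectSum.lof_eq_of k, diagIncl_lof]
    rcases n with _ | n
    · rw [s_lof_zero, map_zero]
      induction x using TensorProduct.induction_on with
      | zero => simp
      | add x y hx hy => rw [map_add, map_add, ← hx, ← hy, add_zero]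
      | tmul x y => rw [TensorProduct.map_tmul, TensorProduct.map_tmul, s_lof_zero,
          TensorProduct.zero_tmul]
    · rw [s_lof, diagIncl_lof]
      induction x using TensorProduct.induction_on with
      | zero => simp
      | add x y hx hy => simp only [map_add, hx, hy]
      | tmul x y => simp only [TensorProduct.map_tmul, s_lof]

lemma diagIncl_cof (a : ℕ) (x : (C.diag D).Tot) :
    C.diagIncl D ((C.diag D).cof a x) = TensorProduct.map (C.cof a) (D.cof a) (C.diagIncl D x) := by
  induction x using DirectSum.induction_on with
  | zero => simp
  | add x y hx hy => rw [map_add, map_add, hx, hy, map_add, map_add]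
  | of n x =>
    rw [← DirectSum.lof_eq_of k, diagIncl_lof, cof_lof, diagIncl_lof]
    induction x using TensorProduct.induction_on with
    | zero => simp
    | add x y hx hy => simp only [map_add, hx, hy]
    | tmul x y => simp only [TensorProduct.map_tmul, cof_lof]

lemma diagIncl_t (x : (C.diag D).Tot) :
    C.diagIncl D ((C.diag D).t x) = TensorProduct.map C.t D.t (C.diagIncl D x) := by
  induction x using DirectSum.induction_on with
  | zero => simp
  | add x y hx hy => rw [map_add, map_add, hx, hy, map_add, map_add]
  | of n x =>
    rw [← DirectSum.lof_eq_of k, diagIncl_lof, t_lof, diagIncl_lof]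
    induction x using TensorProduct.induction_on with
    | zero => simp
    | add x y hx hy => simp only [map_add, hx, hy]
    | tmul x y => simp only [TensorProduct.map_tmul, t_lof]

lemma diagIncl_extra (i p : ℕ) (x : (C.diag D).Tot) :
    C.diagIncl D ((C.diag D).extra i p x) =
      TensorProduct.map (C.extra i p) (D.extra i p) (C.diagIncl D x) := by
  have h : ∀ j, C.diagIncl D (((C.diag D).t ^ j) x) =
      TensorProduct.map (C.t ^ j) (D.t ^ j) (C.diagIncl D x) := fun j => by
    induction j with
    | zero => rw [pow_zero, pow_zero, pow_zero, TensorProduct.map_one]; rfl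
    | succ j ih =>
      rw [pow_succ', Module.End.mul_apply, diagIncl_t, ih, pow_succ', pow_succ',
        TensorProduct.map_mul]
      rfl
  rw [extra_apply, diagIncl_s, h, extra, extra, TensorProduct.map_mul]
  rfl

lemma Sh_apply {n : ℕ} {x : (C.diag D).Tot} (hx : x ∈ (C.diag D).deg n) :
    Sh C D x = C.wordSh D n (C.diagIncl D x) + C.wordCsh D n (C.diagIncl D x) := by
  obtain ⟨x, rfl⟩ := hx
  rw [diagIncl_lof, Sh, DirectSum.toModule_lof, LinearMap.comp_apply, shTerm_eq_wordSh,
    cshTerm_eq_wordCsh]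
  rfl

end Diagonal

/-! ### The shuffle map is a map of supercomplexes -/

namespace IsCocyclic

variable {C D : CocyclicData.{u, w} k} (hC : C.IsCocyclic) (hD : D.IsCocyclic)

include hC hD

lemma wordSh_b {N : ℕ} {z : C.Tot ⊗[k] D.Tot} (hz : z ∈ C.bideg D N N) :
    C.wordSh D (N + 1) (∑ i ∈ Finset.range (N + 2), (-1 : k) ^ i •
      TensorProduct.map (C.cof i) (D.cof i) z) = C.tensorOp D C.b D.b (C.wordSh D N z) := by
  have e := eq_on_bideg (∑ i ∈ Finset.range (N + 2), (-1 : k) ^ i •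
      (C.wordSh D (N + 1) ∘ₗ TensorProduct.map (C.cof i) (D.cof i)))
    (C.tensorOp D C.b D.b ∘ₗ C.wordSh D N) (fun x hx y hy => ?_) hz
  · rw [map_sum]
    simp only [map_smul]
    rw [LinearMap.sum_apply] at e
    exact e
  · rw [LinearMap.sum_apply]
    exact hC.wordSh_coboundary hD hx hy

lemma wordCsh_b {N : ℕ} {z : C.Tot ⊗[k] D.Tot} (hz : z ∈ C.bideg D N N) :
    C.wordCsh D (N + 1) (∑ i ∈ Finset.range (N + 2), (-1 : k) ^ i •
      TensorProduct.map (C.cof i) (D.cof i) z) +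
    C.wordSh D (N - 1) (∑ r ∈ Finset.range N, (-1 : k) ^ (r * (N - 1)) •
      TensorProduct.map (C.extra N r) (D.extra N r) z) =
    ∑ w ∈ words N, sg k w • C.tensorOp D (C.connes (w.count true)) (D.connes (w.count false))
        (C.pw D w z) + C.tensorOp D C.b D.b (C.wordCsh D N z) := by
  have e := eq_on_bideg ((∑ i ∈ Finset.range (N + 2), (-1 : k) ^ i •
      (C.wordCsh D (N + 1) ∘ₗ TensorProduct.map (C.cof i) (D.cof i))) +
      C.wordSh D (N - 1) ∘ₗ (∑ r ∈ Finset.range N, (-1 : k) ^ (r * (N - 1)) •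
      TensorProduct.map (C.extra N r) (D.extra N r)))
    ((∑ w ∈ words N, sg k w • (C.tensorOp D (C.connes (w.count true)) (D.connes (w.count false))
        ∘ₗ C.pw D w)) + C.tensorOp D C.b D.b ∘ₗ C.wordCsh D N) (fun x hx y hy => ?_) hz
  · rw [map_sum]
    simp only [map_smul]
    simp only [LinearMap.add_apply, LinearMap.sum_apply, LinearMap.comp_apply,
      LinearMap.smul_apply] at e
    exact e
  · have e := hC.wordCsh_coboundary hD hx hy
    simp only [LinearMap.add_apply, LinearMap.sum_apply, LinearMap.comp_apply,
      LinearMap.smul_apply]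
    exact e

lemma isMap_Sh_of_deg {N : ℕ} {x : (C.diag D).Tot} (hx : x ∈ (C.diag D).deg N)
    (h : ∀ a < N, (C.diag D).s a x = 0) :
    Sh C D x ∈ (C.periodic.tensor D.periodic).N N ∧
      Sh C D (((C.diag D).b + (C.diag D).B) x) =
        C.tensorOp D (C.b + C.B) (D.b + D.B) (Sh C D x) := by
  have hE := hC.diag hD
  have hz := diagIncl_mem hx
  have hz' : ∀ m < N, TensorProduct.map (C.s m) (D.s m) (C.diagIncl D x) = 0 := fun m hm => by
    rw [← diagIncl_s, h m hm, map_zero]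
  have hb : C.diagIncl D ((C.diag D).b x) = ∑ i ∈ Finset.range (N + 2), (-1 : k) ^ i •
      TensorProduct.map (C.cof i) (D.cof i) (C.diagIncl D x) := by
    rw [b_apply hx, map_sum]
    exact Finset.sum_congr rfl fun i _ => by rw [map_smul, diagIncl_cof]
  have hB : C.diagIncl D ((C.diag D).B x) = ∑ r ∈ Finset.range N, (-1 : k) ^ (r * (N - 1)) •
      TensorProduct.map (C.extra N r) (D.extra N r) (C.diagIncl D x) := by
    rw [hE.B_eq_connes hx h, connes_apply, map_sum]
    exact Finset.sum_congr rfl fun i _ => by rw [map_smul, diagIncl_extra]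
  have hpw := fun w hw => hC.pw_mem_normalizedTensor hD hz hz' (w := w) hw
  have hShB : Sh C D ((C.diag D).B x) = C.wordSh D (N - 1) (C.diagIncl D ((C.diag D).B x)) := by
    rcases Nat.eq_zero_or_pos N with rfl | hN
    · rw [B_of_deg_zero hx, map_zero, map_zero, map_zero]
    · rw [Sh_apply (B_mem hx (m := N - 1) (by omega)), add_eq_left, hB, map_sum]
      exact Finset.sum_eq_zero fun r hr => by
        rw [map_smul, hC.wordCsh_extra hD (Finset.mem_range.1 hr) hz hz', smul_zero]
  have e1 := hC.wordSh_b hD hz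
  have e2 := hC.wordCsh_b hD hz
  rw [← hb] at e1 e2
  rw [← hB, ← hShB] at e2
  have e3 : ∑ w ∈ words N, sg k w • C.tensorOp D (C.connes (w.count true))
      (D.connes (w.count false)) (C.pw D w (C.diagIncl D x)) =
      C.tensorOp D C.B D.B (C.wordSh D N (C.diagIncl D x)) := by
    rw [wordSh, LinearMap.sum_apply, map_sum]
    exact Finset.sum_congr rfl fun w hw => by
      rw [LinearMap.smul_apply, map_smul, hC.tensorOp_B_eq hD (hpw w hw)]
  have e4 : C.tensorOp D C.B D.B (C.wordCsh D N (C.diagIncl D x)) = 0 := by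
    rw [wordCsh, LinearMap.sum_apply, map_sum]
    exact Finset.sum_eq_zero fun w hw => by
      rw [LinearMap.smul_apply, map_smul, Module.End.mul_apply, hC.tensorOp_B_cyc hD w (hpw w hw),
        smul_zero]
  have e5 : C.tensorOp D (C.b + C.B) (D.b + D.B) =
      C.tensorOp D C.b D.b + C.tensorOp D C.B D.B := by
    simp only [tensorOp, TensorProduct.map_add_left, TensorProduct.map_add_right]
    abel
  constructor
  · rw [Sh_apply hx]
    refine Submodule.add_mem _ ?_ ?_
    · rw [wordSh, LinearMap.sum_apply]
      refine Submodule.sum_mem _ fun w hw => Submodule.smul_mem _ _ ?_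
      refine normalizedTensor_le _ _ ?_ (hpw w hw)
      rw [count_true_add_count_false, mem_words.1 hw]
    · rw [wordCsh, LinearMap.sum_apply]
      refine Submodule.sum_mem _ fun w hw => Submodule.smul_mem _ _ ?_
      rw [Module.End.mul_apply]
      by_cases h0 : w.count true = 0 ∨ w.count false = 0
      · have : C.cyc D w = 0 := by
          rcases h0 with h0 | h0 <;> simp [cyc, h0]
        rw [this]
        exact Submodule.zero_mem _
      · refine normalizedTensor_le _ _ ?_ (hC.cyc_mem_normalizedTensor hD w (hpw w hw))
        have hc := count_true_add_count_false w
        rw [mem_words.1 hw] at hc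
        obtain ⟨m, hm⟩ : ∃ m, m = w.count true - 1 + (w.count false - 1) := ⟨_, rfl⟩
        obtain rfl : N = m + 2 := by omega
        rw [← hm, Nat.cast_add]
        exact (add_zero _).symm
  · rw [LinearMap.add_apply, map_add, Sh_apply (b_mem hx), e1, add_assoc, e2, e3, Sh_apply hx, e5]
    simp only [LinearMap.add_apply, map_add, e4]
    abel

theorem isMap_Sh : (C.diag D).periodic.IsMap (C.periodic.tensor D.periodic) (Sh C D) := by
  intro i x hx
  change x ∈ (C.diag D).normalized i at hx
  induction hx using normalized_induction with
  | h0 => simp only [map_zero]; exact ⟨Submodule.zero_mem _, trivial⟩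
  | hadd x y _ _ hx hy =>
    simp only [map_add] at hx hy ⊢
    exact ⟨Submodule.add_mem _ hx.1 hy.1, by rw [hx.2, hy.2]⟩
  | hdeg d hd y h =>
    obtain ⟨h1, h2⟩ := hC.isMap_Sh_of_deg hD (lof_mem_deg (C := C.diag D) d y) h
    exact ⟨by rw [← hd]; exact h1, h2⟩

end IsCocyclic

section TotMap

variable {C D : CocyclicData.{u, w} k} {f : ∀ n, C.obj n →ₗ[k] D.obj n}

lemma totMap_lof (n : ℕ) (x : C.obj n) : totMap f (DirectSum.lof k ℕ C.obj n x) =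
    DirectSum.lof k ℕ D.obj n (f n x) := by
  rw [totMap, DirectSum.toModule_lof, LinearMap.comp_apply]

lemma IsHom.totMap_s (hf : C.IsHom D f) {n a : ℕ} {x : C.Tot} (hx : x ∈ C.deg n) (ha : a < n) :
    totMap f (C.s a x) = D.s a (totMap f x) := by
  obtain ⟨x, rfl⟩ := hx
  obtain ⟨n, rfl⟩ := Nat.exists_eq_add_of_le' (show 1 ≤ n by omega)
  rw [s_lof, totMap_lof, totMap_lof, s_lof]
  exact congrArg _ (LinearMap.congr_fun (hf.σ n a (by omega)) x)

lemma IsHom.totMap_b (hf : C.IsHom D f) {n : ℕ} (x : C.obj n) :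
    totMap f (C.b (DirectSum.lof k ℕ C.obj n x)) = D.b (DirectSum.lof k ℕ D.obj n (f n x)) := by
  rw [b_apply (lof_mem_deg n x), b_apply (lof_mem_deg n _), map_sum]
  refine Finset.sum_congr rfl fun i hi => ?_
  have hi := Finset.mem_range.1 hi
  rw [map_smul, cof_lof, cof_lof, totMap_lof]
  exact congrArg (fun z => (-1 : k) ^ i • DirectSum.lof k ℕ D.obj (n + 1) z)
    (LinearMap.congr_fun (hf.δ n i (by omega)) x)

lemma IsHom.totMap_B (hf : C.IsHom D f) {n : ℕ} (x : C.obj n) :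
    totMap f (C.B (DirectSum.lof k ℕ C.obj n x)) = D.B (DirectSum.lof k ℕ D.obj n (f n x)) := by
  rcases n with _ | n
  · rw [B_of_deg_zero (lof_mem_deg 0 x), B_of_deg_zero (lof_mem_deg 0 _), map_zero]
  · have hτ : ∀ n x, f n (C.τ n x) = D.τ n (f n x) := fun n => LinearMap.congr_fun (hf.τ n)
    have hσ : ∀ x, f n (C.σ n n x) = D.σ n n (f (n + 1) x) :=
      LinearMap.congr_fun (hf.σ n n le_rfl)
    have hp : ∀ (i : ℕ) (x : C.obj n),
        f n ((((-1 : k) ^ n • (C.τ n : Module.End k (C.obj n))) ^ i) x) =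
        (((-1 : k) ^ n • (D.τ n : Module.End k (D.obj n))) ^ i) (f n x) := fun i => by
      induction i with
      | zero => intro x; rfl
      | succ i ih =>
        intro x
        rw [pow_succ, pow_succ, Module.End.mul_apply, Module.End.mul_apply, ih,
          LinearMap.smul_apply, LinearMap.smul_apply, map_smul, hτ]
    rw [B, B, DirectSum.toModule_lof, DirectSum.toModule_lof]
    simp only [LinearMap.comp_apply, totMap_lof, LinearMap.sum_apply, map_sum, hp, hσ, hτ,
      LinearMap.sub_apply, LinearMap.id_apply, LinearMap.smul_apply, map_sub, map_smul]

theorem IsHom.isMap (hf : C.IsHom D f) : C.periodic.IsMap D.periodic (totMap f) := by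
  intro i x hx
  change x ∈ C.normalized i at hx
  change totMap f x ∈ D.normalized i ∧ totMap f ((C.b + C.B) x) = (D.b + D.B) (totMap f x)
  induction hx using normalized_induction with
  | h0 => simp only [map_zero]; exact ⟨Submodule.zero_mem _, trivial⟩
  | hadd x y _ _ hx hy =>
    simp only [map_add] at hx hy ⊢
    exact ⟨Submodule.add_mem _ hx.1 hy.1, by rw [hx.2, hy.2]⟩
  | hdeg d hd y h =>
    refine ⟨mem_normalized (d := d) ?_ (fun a ha => ?_) hd, ?_⟩
    · rw [totMap_lof]; exact lof_mem_deg _ _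
    · rw [← hf.totMap_s (lof_mem_deg d y) ha, h a ha, map_zero]
    · rw [LinearMap.add_apply, map_add, hf.totMap_b, hf.totMap_B, totMap_lof, LinearMap.add_apply]

end TotMap

end CocyclicData

end HopfCyclic

namespace HopfCyclic

universe u v w

/-! ### The algebra structure of the tensor powers -/

section Hopf

variable {k : Type u} [Field k] {H : Type v} [Ring H] [HopfAlgebra k H]

open Coalgebra Bialgebra

/-- The convolution product of two linear maps. -/
def conv {A : Type*} [Ring A] [Algebra k A] (f g : H →ₗ[k] A) : H →ₗ[k] A :=
  LinearMap.mul' k A ∘ₗ TensorProduct.map f g ∘ₗ comul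

lemma conv_apply {A : Type*} [Ring A] [Algebra k A] (f g : H →ₗ[k] A) (h : H) :
    conv f g h = LinearMap.mul' k A (TensorProduct.map f g (comul (R := k) h)) := rfl

lemma conv_assoc {A : Type*} [Ring A] [Algebra k A] (f g l : H →ₗ[k] A) :
    conv (conv f g) l = conv f (conv g l) := by
  refine LinearMap.ext fun h => ?_
  have h1 : ∀ z : H ⊗[k] H, LinearMap.mul' k A (TensorProduct.map (conv f g) l z) =
      LinearMap.mul' k A (TensorProduct.map f (LinearMap.mul' k A ∘ₗ TensorProduct.map g l)
        (TensorProduct.assoc k H H H (comul.rTensor H z))) := fun z => by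
    induction z using TensorProduct.induction_on with
    | zero => simp
    | add x y hx hy => simp only [map_add, hx, hy]
    | tmul a b =>
      rw [TensorProduct.map_tmul, LinearMap.mul'_apply, LinearMap.rTensor_tmul, conv_apply]
      generalize comul (R := k) a = w
      induction w using TensorProduct.induction_on with
      | zero => simp
      | add x y hx hy => simp only [map_add, add_mul, TensorProduct.add_tmul, hx, hy]
      | tmul c d => simp [mul_assoc]
  rw [conv_apply, h1, coassoc_apply, conv_apply, conv, LinearMap.lTensor,
    ← LinearMap.comp_apply (TensorProduct.map _ _) (TensorProduct.map _ _),
    ← TensorProduct.map_comp]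
  rfl

lemma map_conv {A A' : Type*} [Ring A] [Algebra k A] [Ring A'] [Algebra k A'] (φ : A →ₐ[k] A')
    (f g : H →ₗ[k] A) : φ.toLinearMap ∘ₗ conv f g =
      conv (φ.toLinearMap ∘ₗ f) (φ.toLinearMap ∘ₗ g) := by
  refine LinearMap.ext fun h => ?_
  rw [LinearMap.comp_apply, conv_apply, conv_apply]
  generalize comul (R := k) h = z
  induction z using TensorProduct.induction_on with
  | zero => simp
  | add x y hx hy => simp only [map_add, hx, hy]
  | tmul a b => simp

/-- The iterated convolution product `e₀ ⋆ (e₁ ⋆ ⋯ ⋆ eⱼ)`. -/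
def iterConv {A : Type*} [Ring A] [Algebra k A] : ℕ → (ℕ → H →ₗ[k] A) → H →ₗ[k] A
  | 0, e => e 0
  | j + 1, e => conv (e 0) (iterConv j fun i => e (i + 1))

lemma iterConv_succ' {A : Type*} [Ring A] [Algebra k A] (j : ℕ) (e : ℕ → H →ₗ[k] A) :
    iterConv (j + 1) e = conv (iterConv j e) (e (j + 1)) := by
  induction j generalizing e with
  | zero => rfl
  | succ j ih => rw [iterConv, ih, ← conv_assoc]; rfl

lemma map_iterConv {A A' : Type*} [Ring A] [Algebra k A] [Ring A'] [Algebra k A'] (φ : A →ₐ[k] A')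
    (j : ℕ) (e : ℕ → H →ₗ[k] A) : φ.toLinearMap ∘ₗ iterConv j e =
      iterConv j fun i => φ.toLinearMap ∘ₗ e i := by
  induction j generalizing e with
  | zero => rfl
  | succ j ih => rw [iterConv, map_conv, ih]; rfl

lemma iterConv_congr {A : Type*} [Ring A] [Algebra k A] {j : ℕ} {e e' : ℕ → H →ₗ[k] A}
    (h : ∀ i ≤ j, e i = e' i) : iterConv j e = iterConv j e' := by
  induction j generalizing e e' with
  | zero => exact h 0 le_rfl
  | succ j ih => rw [iterConv, iterConv, h 0 (by omega), ih fun i hi => h (i + 1) (by omega)]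

lemma commute_iterConv {A : Type*} [Ring A] [Algebra k A] {j : ℕ} {e : ℕ → H →ₗ[k] A} {c : A}
    (h : ∀ i ≤ j, ∀ a, Commute c (e i a)) (a : H) : Commute c (iterConv j e a) := by
  induction j generalizing e a with
  | zero => exact h 0 le_rfl a
  | succ j ih =>
    rw [iterConv, conv_apply]
    generalize comul (R := k) a = z
    induction z using TensorProduct.induction_on with
    | zero => simp
    | add x y hx hy => rw [map_add, map_add]; exact hx.add_right hy
    | tmul a b =>
      rw [TensorProduct.map_tmul, LinearMap.mul'_apply]
      exact (h 0 (by omega) a).mul_right (ih (fun i hi => h (i + 1) (by omega)) b)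

namespace TPow

variable (k H)

/-- The inclusion `h ↦ 1 ⊗ ⋯ ⊗ h ⊗ ⋯ ⊗ 1` of the `i`-th factor. -/
def incl : ∀ (n : ℕ) (_ : ℕ), H →ₐ[k] TPow k H n
  | 0, _ => one.toAlgHom
  | n + 1, 0 => (cons n).toAlgHom.comp Algebra.TensorProduct.includeLeft
  | n + 1, i + 1 => (cons n).toAlgHom.comp (Algebra.TensorProduct.includeRight.comp (incl n i))

/-- The algebra map `h₀ ⊗ ⋯ ⊗ hₙ ↦ h₁ ⊗ ⋯ ⊗ hₙ ⊗ h₀`. -/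
def rot : ∀ n, TPow k H n →ₐ[k] TPow k H n
  | 0 => AlgHom.id k _
  | n + 1 => (snoc k H n).comp
      ((Algebra.TensorProduct.comm k H (TPow k H n)).toAlgHom.comp (cons n).symm.toAlgHom)

variable {k H}

lemma incl_zero (i : ℕ) (h : H) : incl k H 0 i h = one h := rfl

lemma incl_succ_zero (n : ℕ) (h : H) : incl k H (n + 1) 0 h = cons n (h ⊗ₜ[k] 1) := rfl

lemma incl_succ_succ (n i : ℕ) (h : H) :
    incl k H (n + 1) (i + 1) h = cons n (1 ⊗ₜ[k] incl k H n i h) := rfl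

lemma one_eq_cons (n : ℕ) : (1 : TPow k H (n + 1)) = cons n (1 ⊗ₜ[k] 1) := rfl

lemma algHom_ext {A : Type*} [Semiring A] [Algebra k A] {n : ℕ} {f g : TPow k H n →ₐ[k] A}
    (h : ∀ i ≤ n, ∀ a, f (incl k H n i a) = g (incl k H n i a)) : f = g := by
  induction n with
  | zero =>
    refine AlgHom.ext fun x => ?_
    obtain ⟨y, rfl⟩ := (one (k := k) (H := H)).surjective x
    exact h 0 le_rfl y
  | succ n ih =>
    refine AlgHom.ext fun x => ?_
    induction x using ind with
    | h0 => rw [map_zero, map_zero]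
    | hadd x y hx hy => rw [map_add, map_add, hx, hy]
    | ht a y =>
      have e : cons n (a ⊗ₜ[k] y) = incl k H (n + 1) 0 a * cons n (1 ⊗ₜ[k] y) := by
        rw [incl_succ_zero, ← map_mul, Algebra.TensorProduct.tmul_mul_tmul, mul_one, one_mul]
      have e' := ih (f := f.comp ((cons n).toAlgHom.comp Algebra.TensorProduct.includeRight))
        (g := g.comp ((cons n).toAlgHom.comp Algebra.TensorProduct.includeRight))
        fun i hi a => h (i + 1) (by omega) a
      rw [e, map_mul, map_mul, h 0 (by omega)]
      exact congrArg _ (AlgHom.congr_fun e' y)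

lemma commute_incl {n i j : ℕ} (hi : i ≤ n) (hj : j ≤ n) (h : i ≠ j) (a b : H) :
    Commute (incl k H n i a) (incl k H n j b) := by
  induction n generalizing i j with
  | zero => omega
  | succ n ih =>
    rcases i with _ | i <;> rcases j with _ | j
    · omega
    · rw [commute_iff_eq, incl_succ_zero, incl_succ_succ, ← map_mul, ← map_mul,
        Algebra.TensorProduct.tmul_mul_tmul, Algebra.TensorProduct.tmul_mul_tmul]
      simp
    · rw [commute_iff_eq, incl_succ_zero, incl_succ_succ, ← map_mul, ← map_mul,
        Algebra.TensorProduct.tmul_mul_tmul, Algebra.TensorProduct.tmul_mul_tmul]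
      simp
    · have := ih (i := i) (j := j) (by omega) (by omega) (by omega)
      rw [commute_iff_eq, incl_succ_succ, incl_succ_succ, ← map_mul, ← map_mul,
        Algebra.TensorProduct.tmul_mul_tmul, Algebra.TensorProduct.tmul_mul_tmul, this.eq]

lemma comulAt_incl_lt {n i l : ℕ} (hl : l < i) (hi : i ≤ n) (a : H) :
    comulAt k H n i (incl k H n l a) = incl k H (n + 1) l a := by
  induction n generalizing i l with
  | zero => omega
  | succ n ih =>
    obtain ⟨i, rfl⟩ := Nat.exists_eq_add_of_le' (show 1 ≤ i by omega)
    rcases l with _ | l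
    · change cons (n + 1) (a ⊗ₜ[k] comulAt k H n i 1) = _
      rw [map_one]
      rfl
    · change cons (n + 1) (1 ⊗ₜ[k] comulAt k H n i (incl k H n l a)) = _
      rw [ih (by omega) (by omega)]
      rfl

lemma comulAt_incl_gt {n i l : ℕ} (hl : i < l) (hi : l ≤ n) (a : H) :
    comulAt k H n i (incl k H n l a) = incl k H (n + 1) (l + 1) a := by
  induction n generalizing i l with
  | zero => omega
  | succ n ih =>
    obtain ⟨l, rfl⟩ := Nat.exists_eq_add_of_le' (show 1 ≤ l by omega)
    rcases i with _ | i
    · change cons (n + 1) (TensorProduct.map LinearMap.id (cons n).toLinearMap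
        (TensorProduct.assoc k H H (TPow k H n) (comul (R := k) 1 ⊗ₜ[k] incl k H n l a))) = _
      rw [Bialgebra.comul_one]
      rfl
    · change cons (n + 1) (1 ⊗ₜ[k] comulAt k H n i (incl k H n l a)) = _
      rw [ih (by omega) (by omega)]
      rfl

lemma comulAt_incl_self {n i : ℕ} (hi : i ≤ n) (a : H) :
    comulAt k H n i (incl k H n i a) =
      conv (incl k H (n + 1) i).toLinearMap (incl k H (n + 1) (i + 1)).toLinearMap a := by
  rw [conv_apply]
  induction n generalizing i with
  | zero =>
    obtain rfl : i = 0 := by omega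
    change cons 0 (TensorProduct.map LinearMap.id (one (k := k) (H := H)).toLinearMap
      (comul (R := k) a)) = _
    generalize comul (R := k) a = z
    induction z using TensorProduct.induction_on with
    | zero => simp
    | add x y hx hy => simp only [map_add, hx, hy]
    | tmul a b =>
      rw [TensorProduct.map_tmul, TensorProduct.map_tmul, LinearMap.mul'_apply]
      simp only [AlgHom.toLinearMap_apply, incl_succ_zero, incl_succ_succ, incl_zero]
      rw [← map_mul, Algebra.TensorProduct.tmul_mul_tmul, mul_one, one_mul]
      rfl
  | succ n ih =>
    rcases i with _ | i
    · change cons (n + 1) (TensorProduct.map LinearMap.id (cons n).toLinearMap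
        (TensorProduct.assoc k H H (TPow k H n) (comul (R := k) a ⊗ₜ[k] 1))) = _
      generalize comul (R := k) a = z
      induction z using TensorProduct.induction_on with
      | zero => simp
      | add x y hx hy => simp only [map_add, TensorProduct.add_tmul, hx, hy]
      | tmul a b =>
        rw [TensorProduct.map_tmul, LinearMap.mul'_apply]
        simp only [AlgHom.toLinearMap_apply, incl_succ_zero, incl_succ_succ]
        rw [← map_mul, Algebra.TensorProduct.tmul_mul_tmul, mul_one, one_mul]
        rfl
    · change cons (n + 1) (1 ⊗ₜ[k] comulAt k H n i (incl k H n i a)) = _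
      rw [ih (by omega)]
      generalize comul (R := k) a = z
      induction z using TensorProduct.induction_on with
      | zero => simp
      | add x y hx hy => simp only [map_add, TensorProduct.tmul_add, hx, hy]
      | tmul a b =>
        simp only [TensorProduct.map_tmul, LinearMap.mul'_apply, AlgHom.toLinearMap_apply,
          incl_succ_succ (n + 1)]
        rw [← map_mul, Algebra.TensorProduct.tmul_mul_tmul, one_mul]

lemma counitAt_incl_lt {n i l : ℕ} (hl : l < i) (hi : i ≤ n + 1) (a : H) :
    counitAt k H n i (incl k H (n + 1) l a) = incl k H n l a := by
  induction n generalizing i l with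
  | zero =>
    obtain rfl : i = 1 := by omega
    obtain rfl : l = 0 := by omega
    change one (counit (R := k) (1 : H) • a) = _
    rw [Bialgebra.counit_one, one_smul]
    rfl
  | succ n ih =>
    obtain ⟨i, rfl⟩ := Nat.exists_eq_add_of_le' (show 1 ≤ i by omega)
    rcases l with _ | l
    · change cons n (a ⊗ₜ[k] counitAt k H n i 1) = _
      rw [map_one]
      rfl
    · change cons n (1 ⊗ₜ[k] counitAt k H n i (incl k H (n + 1) l a)) = _
      rw [ih (by omega) (by omega)]
      rfl

lemma counitAt_incl_self {n i : ℕ} (hi : i ≤ n + 1) (a : H) :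
    counitAt k H n i (incl k H (n + 1) i a) = counit (R := k) a • 1 := by
  induction n generalizing i with
  | zero =>
    rcases i with _ | i
    · rfl
    · obtain rfl : i = 0 := by omega
      change one (counit (R := k) a • (1 : H)) = _
      rw [map_smul, map_one]
  | succ n ih =>
    rcases i with _ | i
    · rfl
    · change cons n (1 ⊗ₜ[k] counitAt k H n i (incl k H (n + 1) i a)) = _
      rw [ih (by omega), TensorProduct.tmul_smul, map_smul]
      rfl

lemma counitAt_incl_gt {n i l : ℕ} (hl : i ≤ l) (hi : l ≤ n) (a : H) :
    counitAt k H n i (incl k H (n + 1) (l + 1) a) = incl k H n l a := by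
  induction n generalizing i l with
  | zero =>
    obtain rfl : l = 0 := by omega
    obtain rfl : i = 0 := by omega
    change counit (R := k) (1 : H) • one (k := k) a = _
    rw [Bialgebra.counit_one, one_smul]
    rfl
  | succ n ih =>
    rcases i with _ | i
    · change counit (R := k) (1 : H) • incl k H (n + 1) l a = _
      rw [Bialgebra.counit_one, one_smul]
    · obtain ⟨l, rfl⟩ := Nat.exists_eq_add_of_le' (show 1 ≤ l by omega)
      change cons n (1 ⊗ₜ[k] counitAt k H n i (incl k H (n + 1) (l + 1) a)) = _
      rw [ih (by omega) (by omega)]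
      rfl

lemma snoc_incl {n i : ℕ} (hi : i ≤ n) (a : H) :
    snoc k H n (incl k H n i a ⊗ₜ[k] 1) = incl k H (n + 1) i a := by
  induction n generalizing i with
  | zero => obtain rfl : i = 0 := by omega
            rfl
  | succ n ih =>
    rcases i with _ | i
    · rw [incl_succ_zero, snoc_cons, ← Algebra.TensorProduct.one_def, map_one]
      rfl
    · rw [incl_succ_succ, snoc_cons, ih (by omega)]
      rfl

lemma snoc_one_tmul (n : ℕ) (a : H) :
    snoc k H n (1 ⊗ₜ[k] a) = incl k H (n + 1) (n + 1) a := by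
  induction n with
  | zero => rfl
  | succ n ih => rw [one_eq_cons, snoc_cons, ih]; rfl

lemma rot_incl_succ {n l : ℕ} (hl : l + 1 ≤ n) (a : H) :
    rot k H n (incl k H n (l + 1) a) = incl k H n l a := by
  obtain ⟨n, rfl⟩ := Nat.exists_eq_add_of_le' (show 1 ≤ n by omega)
  exact snoc_incl (by omega) a

lemma rot_incl_zero (n : ℕ) (a : H) : rot k H n (incl k H n 0 a) = incl k H n n a := by
  rcases n with _ | n
  · rfl
  · exact snoc_one_tmul n a

lemma twist_eq (n : ℕ) (g : H) (x : TPow k H n) :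
    twist k H n (g ⊗ₜ[k] x) = incl k H n n g * rot k H n x := by
  rcases n with _ | n
  · obtain ⟨y, rfl⟩ := (one (k := k) (H := H)).surjective x
    rfl
  · induction x using ind with
    | h0 => rw [TensorProduct.tmul_zero, map_zero, map_zero, mul_zero]
    | hadd x y hx hy => rw [TensorProduct.tmul_add, map_add, map_add, mul_add, hx, hy]
    | ht h y =>
      rw [twist_succ, ← snoc_one_tmul (k := k)]
      change _ = _ * snoc k H n (y ⊗ₜ[k] h)
      rw [← map_mul, Algebra.TensorProduct.tmul_mul_tmul, one_mul]

lemma diagonal_eq_iterConv (n : ℕ) : (diagonal k H n).toLinearMap =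
    iterConv n fun i => (incl k H n i).toLinearMap := by
  induction n with
  | zero => rfl
  | succ n ih =>
    have h1 : (iterConv n fun i => (incl k H (n + 1) (i + 1)).toLinearMap) =
        ((cons n).toAlgHom.comp Algebra.TensorProduct.includeRight).toLinearMap ∘ₗ
          iterConv n fun i => (incl k H n i).toLinearMap := by
      rw [map_iterConv]
      rfl
    refine LinearMap.ext fun h => ?_
    rw [iterConv, h1, ← ih, conv_apply, AlgHom.toLinearMap_apply, diagonal_succ]
    generalize comul (R := k) h = z
    induction z using TensorProduct.induction_on with
    | zero => simp
    | add x y hx hy => simp only [map_add, hx, hy]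
    | tmul a b =>
      rw [TensorProduct.map_tmul, TensorProduct.map_tmul, LinearMap.mul'_apply]
      change _ = cons n (a ⊗ₜ[k] 1) * cons n (1 ⊗ₜ[k] diagonal k H n b)
      rw [← map_mul, Algebra.TensorProduct.tmul_mul_tmul, mul_one, one_mul]
      rfl

end TPow

end Hopf

end HopfCyclic

namespace HopfCyclic

universe u v w

section Hopf

variable {k : Type u} [Field k] {H : Type v} [Ring H] [HopfAlgebra k H]

open Coalgebra Bialgebra

/-! ### Cosimplicial and cyclic identities for tensor powers -/

/-- The unit of the convolution product. -/
def convUnit {A : Type*} [Ring A] [Algebra k A] : H →ₗ[k] A :=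
  Algebra.linearMap k A ∘ₗ counit

lemma conv_convUnit {A : Type*} [Ring A] [Algebra k A] (f : H →ₗ[k] A) :
    conv f convUnit = f := by
  refine LinearMap.ext fun h => ?_
  have h1 : ∀ z : H ⊗[k] H, LinearMap.mul' k A (TensorProduct.map f convUnit z) =
      f (TensorProduct.rid k H (counit.lTensor H z)) := fun z => by
    induction z using TensorProduct.induction_on with
    | zero => simp
    | add x y hx hy => simp only [map_add, hx, hy]
    | tmul a b =>
      simp [convUnit, ← Algebra.commutes, Algebra.smul_def]
      rw [← Algebra.smul_def, ← Algebra.smul_def, map_smul]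
  rw [conv_apply, h1, lTensor_counit_comul, TensorProduct.rid_tmul, one_smul]

lemma convUnit_conv {A : Type*} [Ring A] [Algebra k A] (f : H →ₗ[k] A) :
    conv convUnit f = f := by
  refine LinearMap.ext fun h => ?_
  have h1 : ∀ z : H ⊗[k] H, LinearMap.mul' k A (TensorProduct.map convUnit f z) =
      f (TensorProduct.lid k H (counit.rTensor H z)) := fun z => by
    induction z using TensorProduct.induction_on with
    | zero => simp
    | add x y hx hy => simp only [map_add, hx, hy]
    | tmul a b =>
      simp [convUnit, Algebra.smul_def]
      rw [← Algebra.smul_def, ← Algebra.smul_def, map_smul]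
  rw [conv_apply, h1, rTensor_counit_comul, TensorProduct.lid_tmul, one_smul]

namespace TPow

variable (k H) in
/-- `TPow.incl` as a linear map. -/
abbrev inclL (n i : ℕ) : H →ₗ[k] TPow k H n := (incl k H n i).toLinearMap

section Rules

variable {n i l : ℕ}

lemma comulAt_inclL_lt (hl : l < i) (hi : i ≤ n) :
    (comulAt k H n i).toLinearMap ∘ₗ inclL k H n l = inclL k H (n + 1) l :=
  LinearMap.ext (comulAt_incl_lt hl hi)

lemma comulAt_inclL_gt (hl : i < l) (hi : l ≤ n) :
    (comulAt k H n i).toLinearMap ∘ₗ inclL k H n l = inclL k H (n + 1) (l + 1) :=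
  LinearMap.ext (comulAt_incl_gt hl hi)

lemma comulAt_inclL_self (hi : i ≤ n) : (comulAt k H n i).toLinearMap ∘ₗ inclL k H n i =
    conv (inclL k H (n + 1) i) (inclL k H (n + 1) (i + 1)) :=
  LinearMap.ext (comulAt_incl_self hi)

lemma counitAt_inclL_lt (hl : l < i) (hi : i ≤ n + 1) :
    (counitAt k H n i).toLinearMap ∘ₗ inclL k H (n + 1) l = inclL k H n l :=
  LinearMap.ext (counitAt_incl_lt hl hi)

lemma counitAt_inclL_self (hi : i ≤ n + 1) :
    (counitAt k H n i).toLinearMap ∘ₗ inclL k H (n + 1) i = convUnit :=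
  LinearMap.ext fun a => (counitAt_incl_self hi a).trans (Algebra.algebraMap_eq_smul_one _).symm

lemma counitAt_inclL_gt (hl : i < l) (hi : l ≤ n + 1) :
    (counitAt k H n i).toLinearMap ∘ₗ inclL k H (n + 1) l = inclL k H n (l - 1) := by
  obtain ⟨l, rfl⟩ := Nat.exists_eq_add_of_le' (show 1 ≤ l by omega)
  exact LinearMap.ext (counitAt_incl_gt (by omega) (by omega))

lemma rot_inclL_pos (hl : 1 ≤ l) (hi : l ≤ n) :
    (rot k H n).toLinearMap ∘ₗ inclL k H n l = inclL k H n (l - 1) := by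
  obtain ⟨l, rfl⟩ := Nat.exists_eq_add_of_le' hl
  exact LinearMap.ext (rot_incl_succ hi)

lemma rot_inclL_zero : (rot k H n).toLinearMap ∘ₗ inclL k H n 0 = inclL k H n n :=
  LinearMap.ext (rot_incl_zero n)

lemma algHom_ext' {A : Type*} [Semiring A] [Algebra k A] {f g : TPow k H n →ₐ[k] A}
    (h : ∀ i ≤ n, f.toLinearMap ∘ₗ inclL k H n i = g.toLinearMap ∘ₗ inclL k H n i) : f = g :=
  algHom_ext fun i hi a => LinearMap.congr_fun (h i hi) a

end Rules

lemma comp_toLinearMap {n n' n'' : ℕ} (φ : TPow k H n' →ₐ[k] TPow k H n'')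
    (φ' : TPow k H n →ₐ[k] TPow k H n') (f : H →ₗ[k] TPow k H n) :
    (φ.comp φ').toLinearMap ∘ₗ f = φ.toLinearMap ∘ₗ φ'.toLinearMap ∘ₗ f := rfl

lemma comulAt_comp_comulAt {n i j : ℕ} (hij : i < j) (hj : j ≤ n + 1) :
    (comulAt k H (n + 1) j).comp (comulAt k H n i) =
      (comulAt k H (n + 1) i).comp (comulAt k H n (j - 1)) := by
  obtain ⟨j, rfl⟩ := Nat.exists_eq_add_of_le' (show 1 ≤ j by omega)
  rw [Nat.add_sub_cancel]
  refine algHom_ext' fun l hl => ?_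
  rw [comp_toLinearMap, comp_toLinearMap]
  rcases lt_trichotomy l i with h | rfl | h
  · rw [comulAt_inclL_lt h (by omega), comulAt_inclL_lt (by omega) (by omega),
      comulAt_inclL_lt (i := j) (by omega) (by omega), comulAt_inclL_lt h (by omega)]
  · rw [comulAt_inclL_self hl, map_conv, comulAt_inclL_lt (by omega) (by omega)]
    rcases Nat.lt_or_ge l j with h | h
    · rw [comulAt_inclL_lt (by omega) (by omega), comulAt_inclL_lt (i := j) (by omega) (by omega),
        comulAt_inclL_self (by omega)]
    · obtain rfl : j = l := by omega
      rw [comulAt_inclL_self (by omega), comulAt_inclL_self hl, map_conv,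
        comulAt_inclL_self (by omega), comulAt_inclL_gt (by omega) (by omega), conv_assoc]
  · rw [comulAt_inclL_gt h hl]
    rcases lt_trichotomy l j with h' | rfl | h'
    · rw [comulAt_inclL_lt (by omega) (by omega), comulAt_inclL_lt (i := j) (by omega) (by omega),
        comulAt_inclL_gt h (by omega)]
    · rw [comulAt_inclL_self (by omega), comulAt_inclL_self hl, map_conv,
        comulAt_inclL_gt (by omega) (by omega), comulAt_inclL_gt (by omega) (by omega)]
    · rw [comulAt_inclL_gt (by omega) (by omega), comulAt_inclL_gt (i := j) (by omega) (by omega),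
        comulAt_inclL_gt (by omega) (by omega)]

lemma counitAt_comp_counitAt {n i j : ℕ} (hij : i ≤ j) (hj : j ≤ n + 1) :
    (counitAt k H n j).comp (counitAt k H (n + 1) i) =
      (counitAt k H n i).comp (counitAt k H (n + 1) (j + 1)) := by
  have hu : ∀ {n n' : ℕ} (φ : TPow k H n →ₐ[k] TPow k H n'),
      φ.toLinearMap ∘ₗ (convUnit : H →ₗ[k] TPow k H n) = convUnit := fun φ =>
    LinearMap.ext fun a => φ.commutes _
  refine algHom_ext' fun l hl => ?_
  rw [comp_toLinearMap, comp_toLinearMap]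
  rcases lt_trichotomy l i with h | rfl | h
  · rw [counitAt_inclL_lt h (by omega), counitAt_inclL_lt (by omega) (by omega),
      counitAt_inclL_lt (by omega) (by omega), counitAt_inclL_lt h (by omega)]
  · rw [counitAt_inclL_self (by omega), hu, counitAt_inclL_lt (by omega) (by omega),
      counitAt_inclL_self (by omega)]
  · rw [counitAt_inclL_gt h hl]
    rcases lt_trichotomy l (j + 1) with h' | rfl | h'
    · rw [counitAt_inclL_lt (by omega) (by omega),
        counitAt_inclL_lt (i := j + 1) (by omega) (by omega), counitAt_inclL_gt h (by omega)]
    · rw [Nat.add_sub_cancel, counitAt_inclL_self (by omega), counitAt_inclL_self (by omega), hu]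
    · rw [counitAt_inclL_gt (by omega) (by omega),
        counitAt_inclL_gt (i := j + 1) (by omega) (by omega),
        counitAt_inclL_gt (by omega) (by omega)]

lemma counitAt_comp_comulAt_lt {n i p : ℕ} (h : i + 1 < p) (hp : p ≤ n + 2) :
    (counitAt k H (n + 1) p).comp (comulAt k H (n + 1) i) =
      (comulAt k H n i).comp (counitAt k H n (p - 1)) := by
  have hu : ∀ {n n' : ℕ} (φ : TPow k H n →ₐ[k] TPow k H n'),
      φ.toLinearMap ∘ₗ (convUnit : H →ₗ[k] TPow k H n) = convUnit := fun φ =>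
    LinearMap.ext fun a => φ.commutes _
  obtain ⟨p, rfl⟩ := Nat.exists_eq_add_of_le' (show 1 ≤ p by omega)
  rw [Nat.add_sub_cancel]
  refine algHom_ext' fun l hl => ?_
  rw [comp_toLinearMap, comp_toLinearMap]
  rcases lt_trichotomy l i with h' | rfl | h'
  · rw [comulAt_inclL_lt h' (by omega), counitAt_inclL_lt (by omega) (by omega),
      counitAt_inclL_lt (by omega) (by omega), comulAt_inclL_lt h' (by omega)]
  · rw [comulAt_inclL_self (by omega), map_conv, counitAt_inclL_lt (by omega) (by omega),
      counitAt_inclL_lt (by omega) (by omega), counitAt_inclL_lt (by omega) (by omega),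
      comulAt_inclL_self (by omega)]
  · rw [comulAt_inclL_gt h' hl]
    rcases lt_trichotomy l p with h'' | rfl | h''
    · rw [counitAt_inclL_lt (by omega) (by omega), counitAt_inclL_lt (i := p) (by omega) (by omega),
        comulAt_inclL_gt h' (by omega)]
    · rw [counitAt_inclL_self (by omega), counitAt_inclL_self (by omega), hu]
    · rw [counitAt_inclL_gt (by omega) (by omega), counitAt_inclL_gt (i := p) (by omega) (by omega),
        comulAt_inclL_gt (by omega) (by omega), Nat.add_sub_cancel, Nat.sub_add_cancel (by omega)]

lemma counitAt_comp_comulAt_self {n i : ℕ} (h : i ≤ n) :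
    (counitAt k H n i).comp (comulAt k H n i) = AlgHom.id k _ := by
  refine algHom_ext' fun l hl => ?_
  rw [comp_toLinearMap, AlgHom.toLinearMap_id, LinearMap.id_comp]
  rcases lt_trichotomy l i with h' | rfl | h'
  · rw [comulAt_inclL_lt h' (by omega), counitAt_inclL_lt (by omega) (by omega)]
  · rw [comulAt_inclL_self hl, map_conv, counitAt_inclL_self (by omega),
      counitAt_inclL_gt (by omega) (by omega), convUnit_conv, Nat.add_sub_cancel]
  · rw [comulAt_inclL_gt h' hl, counitAt_inclL_gt (by omega) (by omega), Nat.add_sub_cancel]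

lemma counitAt_succ_comp_comulAt {n i : ℕ} (h : i ≤ n) :
    (counitAt k H n (i + 1)).comp (comulAt k H n i) = AlgHom.id k _ := by
  refine algHom_ext' fun l hl => ?_
  rw [comp_toLinearMap, AlgHom.toLinearMap_id, LinearMap.id_comp]
  rcases lt_trichotomy l i with h' | rfl | h'
  · rw [comulAt_inclL_lt h' (by omega), counitAt_inclL_lt (by omega) (by omega)]
  · rw [comulAt_inclL_self hl, map_conv, counitAt_inclL_self (by omega),
      counitAt_inclL_lt (by omega) (by omega), conv_convUnit]
  · rw [comulAt_inclL_gt h' hl, counitAt_inclL_gt (by omega) (by omega), Nat.add_sub_cancel]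

lemma counitAt_comp_comulAt_gt {n i p : ℕ} (h : p < i) (hi : i ≤ n + 1) :
    (counitAt k H (n + 1) p).comp (comulAt k H (n + 1) i) =
      (comulAt k H n (i - 1)).comp (counitAt k H n p) := by
  have hu : ∀ {n n' : ℕ} (φ : TPow k H n →ₐ[k] TPow k H n'),
      φ.toLinearMap ∘ₗ (convUnit : H →ₗ[k] TPow k H n) = convUnit := fun φ =>
    LinearMap.ext fun a => φ.commutes _
  obtain ⟨i, rfl⟩ := Nat.exists_eq_add_of_le' (show 1 ≤ i by omega)
  rw [Nat.add_sub_cancel]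
  refine algHom_ext' fun l hl => ?_
  rw [comp_toLinearMap, comp_toLinearMap]
  rcases lt_trichotomy l p with h' | rfl | h'
  · rw [comulAt_inclL_lt (by omega) (by omega), counitAt_inclL_lt (by omega) (by omega),
      counitAt_inclL_lt (by omega) (by omega), comulAt_inclL_lt (by omega) (by omega)]
  · rw [comulAt_inclL_lt (by omega) (by omega), counitAt_inclL_self (by omega),
      counitAt_inclL_self (by omega), hu]
  · rw [counitAt_inclL_gt h' hl]
    obtain ⟨l, rfl⟩ := Nat.exists_eq_add_of_le' (show 1 ≤ l by omega)
    rw [Nat.add_sub_cancel]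
    rcases lt_trichotomy l i with h'' | rfl | h''
    · rw [comulAt_inclL_lt (by omega) (by omega), counitAt_inclL_gt (by omega) (by omega),
        comulAt_inclL_lt (by omega) (by omega), Nat.add_sub_cancel]
    · rw [comulAt_inclL_self (by omega), comulAt_inclL_self (by omega), map_conv,
        counitAt_inclL_gt (by omega) (by omega), counitAt_inclL_gt (by omega) (by omega),
        Nat.add_sub_cancel, Nat.add_sub_cancel]
    · rw [comulAt_inclL_gt (by omega) (by omega), counitAt_inclL_gt (by omega) (by omega),
        comulAt_inclL_gt (by omega) (by omega), Nat.add_sub_cancel]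

lemma rot_comp_comulAt {n i : ℕ} (hi : 1 ≤ i) (hi' : i ≤ n) :
    (rot k H (n + 1)).comp (comulAt k H n i) = (comulAt k H n (i - 1)).comp (rot k H n) := by
  obtain ⟨i, rfl⟩ := Nat.exists_eq_add_of_le' hi
  rw [Nat.add_sub_cancel]
  refine algHom_ext' fun l hl => ?_
  rw [comp_toLinearMap, comp_toLinearMap]
  rcases l with _ | l
  · rw [comulAt_inclL_lt (by omega) (by omega), rot_inclL_zero, rot_inclL_zero,
      comulAt_inclL_gt (by omega) (by omega)]
  · rw [rot_inclL_pos (by omega) (by omega), Nat.add_sub_cancel]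
    rcases lt_trichotomy l i with h | rfl | h
    · rw [comulAt_inclL_lt (by omega) (by omega), rot_inclL_pos (by omega) (by omega),
        comulAt_inclL_lt (by omega) (by omega), Nat.add_sub_cancel]
    · rw [comulAt_inclL_self (by omega), comulAt_inclL_self (by omega), map_conv,
        rot_inclL_pos (by omega) (by omega), rot_inclL_pos (by omega) (by omega),
        Nat.add_sub_cancel, Nat.add_sub_cancel]
    · rw [comulAt_inclL_gt (by omega) (by omega), rot_inclL_pos (by omega) (by omega),
        comulAt_inclL_gt (by omega) (by omega), Nat.add_sub_cancel]

lemma rot_comp_rot_comp_comulAt_zero (n : ℕ) :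
    (rot k H (n + 1)).comp ((rot k H (n + 1)).comp (comulAt k H n 0)) =
      (comulAt k H n n).comp (rot k H n) := by
  refine algHom_ext' fun l hl => ?_
  rw [comp_toLinearMap, comp_toLinearMap, comp_toLinearMap]
  rcases l with _ | l
  · rw [comulAt_inclL_self (by omega), map_conv, rot_inclL_zero,
      rot_inclL_pos (by omega) (by omega), map_conv, rot_inclL_pos (by omega) (by omega),
      Nat.add_sub_cancel, Nat.add_sub_cancel, rot_inclL_zero, rot_inclL_zero,
      comulAt_inclL_self le_rfl]
  · rw [comulAt_inclL_gt (by omega) hl, rot_inclL_pos (by omega) (by omega),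
      rot_inclL_pos (by omega) (by omega), rot_inclL_pos (by omega) (by omega),
      comulAt_inclL_lt (by omega) le_rfl, Nat.add_sub_cancel, Nat.add_sub_cancel]

lemma rot_comp_counitAt {n i : ℕ} (hi : i ≤ n) :
    (rot k H n).comp (counitAt k H n (i + 1)) = (counitAt k H n i).comp (rot k H (n + 1)) := by
  have hu : ∀ {n n' : ℕ} (φ : TPow k H n →ₐ[k] TPow k H n'),
      φ.toLinearMap ∘ₗ (convUnit : H →ₗ[k] TPow k H n) = convUnit := fun φ =>
    LinearMap.ext fun a => φ.commutes _
  refine algHom_ext' fun l hl => ?_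
  rw [comp_toLinearMap, comp_toLinearMap]
  rcases l with _ | l
  · rw [counitAt_inclL_lt (by omega) (by omega), rot_inclL_zero, rot_inclL_zero,
      counitAt_inclL_gt (by omega) (by omega), Nat.add_sub_cancel]
  · rw [rot_inclL_pos (by omega) hl, Nat.add_sub_cancel]
    rcases lt_trichotomy l i with h | rfl | h
    · rw [counitAt_inclL_lt (by omega) (by omega), rot_inclL_pos (by omega) (by omega),
        counitAt_inclL_lt (by omega) (by omega), Nat.add_sub_cancel]
    · rw [counitAt_inclL_self (by omega), counitAt_inclL_self (by omega), hu]
    · rw [counitAt_inclL_gt (by omega) (by omega), rot_inclL_pos (by omega) (by omega),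
        counitAt_inclL_gt (by omega) (by omega), Nat.add_sub_cancel]

lemma rot_comp_counitAt_one (n : ℕ) : (rot k H n).comp (counitAt k H n 1) =
    (counitAt k H n (n + 1)).comp ((rot k H (n + 1)).comp (rot k H (n + 1))) := by
  have hu : ∀ {n n' : ℕ} (φ : TPow k H n →ₐ[k] TPow k H n'),
      φ.toLinearMap ∘ₗ (convUnit : H →ₗ[k] TPow k H n) = convUnit := fun φ =>
    LinearMap.ext fun a => φ.commutes _
  refine algHom_ext' fun l hl => ?_
  rw [comp_toLinearMap, comp_toLinearMap, comp_toLinearMap]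
  rcases l with _ | _ | l
  · rw [counitAt_inclL_lt (by omega) (by omega), rot_inclL_zero, rot_inclL_zero,
      rot_inclL_pos (by omega) (by omega), counitAt_inclL_lt (by omega) (by omega),
      Nat.add_sub_cancel]
  · rw [counitAt_inclL_self (by omega), hu, rot_inclL_pos (by omega) (by omega),
      Nat.add_sub_cancel, rot_inclL_zero, counitAt_inclL_self (by omega)]
  · rw [counitAt_inclL_gt (by omega) (by omega), rot_inclL_pos (by omega) (by omega),
      rot_inclL_pos (by omega) (by omega), rot_inclL_pos (by omega) (by omega),
      counitAt_inclL_lt (by omega) (by omega), Nat.add_sub_cancel]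

lemma counitAt_comp_rot_comp_comulAt (n : ℕ) :
    (counitAt k H n (n + 1)).comp ((rot k H (n + 1)).comp (comulAt k H n 0)) =
      AlgHom.id k _ := by
  refine algHom_ext' fun l hl => ?_
  rw [comp_toLinearMap, comp_toLinearMap, AlgHom.toLinearMap_id, LinearMap.id_comp]
  rcases l with _ | l
  · rw [comulAt_inclL_self (by omega), map_conv, rot_inclL_zero,
      rot_inclL_pos (by omega) (by omega), map_conv, counitAt_inclL_self le_rfl, convUnit_conv,
      Nat.add_sub_cancel, counitAt_inclL_lt (by omega) (by omega)]
  · rw [comulAt_inclL_gt (by omega) hl, rot_inclL_pos (by omega) (by omega), Nat.add_sub_cancel,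
      counitAt_inclL_lt (by omega) (by omega)]

lemma rot_pow_inclL {n j l : ℕ} (hl : l ≤ n) (hj : j ≤ n + 1) (a : H) :
    (rot k H n)^[j] (incl k H n l a) =
      if j ≤ l then incl k H n (l - j) a else incl k H n (l + n + 1 - j) a := by
  induction j with
  | zero => simp
  | succ j ih =>
    rw [Function.iterate_succ_apply', ih (by omega)]
    rcases lt_trichotomy j l with h | rfl | h
    · rw [if_pos h.le, if_pos (by omega), show l - j = l - (j + 1) + 1 by omega,
        rot_incl_succ (by omega)]
    · rw [if_pos le_rfl, if_neg (by omega), Nat.sub_self, rot_incl_zero]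
      congr 2; omega
    · rw [if_neg (by omega), if_neg (by omega),
        show l + n + 1 - j = l + n + 1 - (j + 1) + 1 by omega, rot_incl_succ (by omega)]

lemma rot_iterate (n : ℕ) (x : TPow k H n) : (rot k H n)^[n + 1] x = x := by
  have h : ∀ j, ∃ φ : TPow k H n →ₐ[k] TPow k H n, ∀ x, φ x = (rot k H n)^[j] x := fun j => by
    induction j with
    | zero => exact ⟨AlgHom.id k _, fun x => rfl⟩
    | succ j ih =>
      obtain ⟨φ, hφ⟩ := ih
      exact ⟨φ.comp (rot k H n), fun x => hφ _⟩
  obtain ⟨φ, hφ⟩ := h (n + 1)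
  have e : φ = AlgHom.id k _ := algHom_ext fun l hl a => by
    rw [hφ, rot_pow_inclL hl le_rfl, if_neg (by omega), AlgHom.id_apply]
    congr 2; omega
  rw [← hφ, e]
  rfl

end TPow

end Hopf

end HopfCyclic

namespace HopfCyclic

universe u v w

section Hopf

variable {k : Type u} [Field k] {H : Type v} [Ring H] [HopfAlgebra k H]
  {M : Type w} [AddCommGroup M] [Module k M] [Module Hᵐᵒᵖ M] [IsScalarTower k Hᵐᵒᵖ M]

open Coalgebra Bialgebra

/-! ### The Hopf cocyclic module -/

lemma Cochain.hom_ext {n : ℕ} {V : Type*} [AddCommGroup V] [Module k V]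
    {f g : Cochain k H M n →ₗ[k] V}
    (h : ∀ m x, f ((balance k H M n).mkQ (m ⊗ₜ[k] x)) = g ((balance k H M n).mkQ (m ⊗ₜ[k] x))) :
    f = g :=
  Submodule.linearMap_qext _ (TensorProduct.ext' h)

lemma Cochain.map_mk {n n' : ℕ} (f : TPow k H n →ₐ[k] TPow k H n')
    (hf : ∀ h, f (TPow.diagonal k H n h) = TPow.diagonal k H n' h) (m : M) (x : TPow k H n) :
    Cochain.map f hf ((balance k H M n).mkQ (m ⊗ₜ[k] x)) =
      (balance k H M n').mkQ (m ⊗ₜ[k] f x) := rfl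

/-- The map `g ⊗ m ↦ m ⊗_H F(g)`. -/
def push {n : ℕ} (F : H →ₗ[k] TPow k H n) : H ⊗[k] M →ₗ[k] Cochain k H M n :=
  (balance k H M n).mkQ ∘ₗ TensorProduct.map LinearMap.id F ∘ₗ (TensorProduct.comm k H M).toLinearMap

lemma push_tmul {n : ℕ} (F : H →ₗ[k] TPow k H n) (g : H) (m : M) :
    push F (g ⊗ₜ[k] m) = (balance k H M n).mkQ (m ⊗ₜ[k] F g) := rfl

lemma map_push {n n' : ℕ} (f : TPow k H n →ₐ[k] TPow k H n')
    (hf : ∀ h, f (TPow.diagonal k H n h) = TPow.diagonal k H n' h) (F : H →ₗ[k] TPow k H n)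
    (p : H ⊗[k] M) : Cochain.map f hf (push F p) = push (f.toLinearMap ∘ₗ F) p := by
  induction p using TensorProduct.induction_on with
  | zero => simp
  | add x y hx hy => simp only [map_add, hx, hy]
  | tmul g m => rfl

/-- The right multiple of a linear map `H → H^{⊗ (n + 1)}` by `x`. -/
def mulR {n : ℕ} (F : H →ₗ[k] TPow k H n) (x : TPow k H n) : H →ₗ[k] TPow k H n :=
  LinearMap.mulRight k x ∘ₗ F

lemma mulR_apply {n : ℕ} (F : H →ₗ[k] TPow k H n) (x : TPow k H n) (g : H) :
    mulR F x g = F g * x := rfl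

lemma map_mulR {n n' : ℕ} (f : TPow k H n →ₐ[k] TPow k H n') (F : H →ₗ[k] TPow k H n)
    (x : TPow k H n) : f.toLinearMap ∘ₗ mulR F x = mulR (f.toLinearMap ∘ₗ F) (f x) :=
  LinearMap.ext fun _ => map_mul f _ _

variable [SAYDModule k H M]

lemma tau_mk {n : ℕ} (m : M) (x : TPow k H n) :
    tau n ((balance k H M n).mkQ (m ⊗ₜ[k] x)) =
      push (mulR (TPow.inclL k H n n) (TPow.rot k H n x)) (SAYDModule.coact (k := k) (H := H) m) := by
  refine (mk_tauPre n x m).trans ?_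
  generalize SAYDModule.coact (k := k) (H := H) m = p
  induction p using TensorProduct.induction_on with
  | zero => simp
  | add x y hx hy => simp only [map_add, hx, hy]
  | tmul g m =>
    rw [tauAux_tmul, TPow.twist_eq]
    rfl

lemma mk_eq_push {n : ℕ} (m : M) (x : TPow k H n) : (balance k H M n).mkQ (m ⊗ₜ[k] x) =
    push (mulR convUnit x) (SAYDModule.coact (k := k) (H := H) m) := by
  have h : ∀ p : H ⊗[k] M, push (mulR convUnit x) p =
      (balance k H M n).mkQ (TensorProduct.lid k M (counit.rTensor M p) ⊗ₜ[k] x) := fun p => by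
    induction p using TensorProduct.induction_on with
    | zero => simp
    | add x y hx hy => simp only [map_add, TensorProduct.add_tmul, hx, hy]
    | tmul g m =>
      rw [push_tmul, mulR_apply, convUnit, LinearMap.comp_apply, Algebra.linearMap_apply,
        ← Algebra.smul_def, LinearMap.rTensor_tmul, TensorProduct.lid_tmul, TensorProduct.smul_tmul]
  rw [h, SAYDModule.counit]

lemma tau_push {n : ℕ} (F : H →ₗ[k] TPow k H n) (x : TPow k H n)
    (hF : ∀ a b, Commute (TPow.incl k H n n a) (TPow.rot k H n (F b))) (m : M) :
    tau n (push (mulR F x) (SAYDModule.coact (k := k) (H := H) m)) =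
      push (mulR (conv ((TPow.rot k H n).toLinearMap ∘ₗ F) (TPow.inclL k H n n))
        (TPow.rot k H n x)) (SAYDModule.coact (k := k) (H := H) m) := by
  let G : H ⊗[k] H ⊗[k] M →ₗ[k] Cochain k H M n :=
    (balance k H M n).mkQ ∘ₗ (TensorProduct.comm k (TPow k H n) M).toLinearMap ∘ₗ
      TensorProduct.map (LinearMap.mulRight k (TPow.rot k H n x) ∘ₗ LinearMap.mul' k (TPow k H n) ∘ₗ
        TensorProduct.map ((TPow.rot k H n).toLinearMap ∘ₗ F) (TPow.inclL k H n n)) LinearMap.id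
  have h1 : ∀ p : H ⊗[k] M, tau n (push (mulR F x) p) =
      G ((TensorProduct.assoc k H H M).symm (SAYDModule.coact.lTensor H p)) := fun p => by
    induction p using TensorProduct.induction_on with
    | zero => simp
    | add x y hx hy => simp only [map_add, hx, hy]
    | tmul g m =>
      rw [push_tmul, tau_mk, LinearMap.lTensor_tmul]
      generalize SAYDModule.coact (k := k) (H := H) m = p
      induction p using TensorProduct.induction_on with
      | zero => simp
      | add x y hx hy => simp only [map_add, TensorProduct.tmul_add, hx, hy]
      | tmul a m =>
        rw [push_tmul, mulR_apply, mulR_apply, map_mul, ← mul_assoc]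
        change (balance k H M n).mkQ (m ⊗ₜ[k] (TPow.incl k H n n a * _ * _)) =
          (balance k H M n).mkQ (m ⊗ₜ[k] (_ * TPow.incl k H n n a * _))
        rw [(hF a g).eq]
        rfl
  have h2 : ∀ p : H ⊗[k] M, push (mulR (conv ((TPow.rot k H n).toLinearMap ∘ₗ F)
      (TPow.inclL k H n n)) (TPow.rot k H n x)) p = G (comul.rTensor M p) := fun p => by
    induction p using TensorProduct.induction_on with
    | zero => simp
    | add x y hx hy => simp only [map_add, hx, hy]
    | tmul g m => rfl
  rw [h1, h2, ← SAYDModule.coassoc, LinearEquiv.symm_apply_apply]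

lemma tau_tau_mk {n : ℕ} (m : M) (x : TPow k H (n + 1)) :
    tau (n + 1) (tau (n + 1) ((balance k H M (n + 1)).mkQ (m ⊗ₜ[k] x))) =
      push (mulR (conv (TPow.inclL k H (n + 1) n) (TPow.inclL k H (n + 1) (n + 1)))
        (TPow.rot k H (n + 1) (TPow.rot k H (n + 1) x)))
        (SAYDModule.coact (k := k) (H := H) m) := by
  rw [tau_mk, tau_push, TPow.rot_inclL_pos (by omega) le_rfl, Nat.add_sub_cancel]
  intro a b
  rw [AlgHom.toLinearMap_apply, TPow.rot_incl_succ le_rfl]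
  exact TPow.commute_incl le_rfl (by omega) (by omega) a b

variable (k H M)

/-- The coface that doubles the `i`-th factor. -/
abbrev coface (n i : ℕ) : Cochain k H M n →ₗ[k] Cochain k H M (n + 1) :=
  Cochain.map (TPow.comulAt k H n i) (TPow.comulAt_diagonal n i)

/-- The map that applies the counit to the `i`-th factor. -/
abbrev codegen (n i : ℕ) : Cochain k H M (n + 1) →ₗ[k] Cochain k H M n :=
  Cochain.map (TPow.counitAt k H n i) (TPow.counitAt_diagonal n i)

variable {k H M}

lemma coface_coface {n i j : ℕ} (hij : i < j) (hj : j ≤ n + 1) :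
    coface k H M (n + 1) j ∘ₗ coface k H M n i =
      coface k H M (n + 1) i ∘ₗ coface k H M n (j - 1) :=
  Cochain.hom_ext fun m x => congrArg (fun y => (balance k H M _).mkQ (m ⊗ₜ[k] y))
    (AlgHom.congr_fun (TPow.comulAt_comp_comulAt hij hj) x)

lemma codegen_codegen {n i j : ℕ} (hij : i ≤ j) (hj : j ≤ n + 1) :
    codegen k H M n j ∘ₗ codegen k H M (n + 1) i =
      codegen k H M n i ∘ₗ codegen k H M (n + 1) (j + 1) :=
  Cochain.hom_ext fun m x => congrArg (fun y => (balance k H M _).mkQ (m ⊗ₜ[k] y))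
    (AlgHom.congr_fun (TPow.counitAt_comp_counitAt hij hj) x)

lemma codegen_coface_lt {n i p : ℕ} (h : i + 1 < p) (hp : p ≤ n + 2) :
    codegen k H M (n + 1) p ∘ₗ coface k H M (n + 1) i =
      coface k H M n i ∘ₗ codegen k H M n (p - 1) :=
  Cochain.hom_ext fun m x => congrArg (fun y => (balance k H M _).mkQ (m ⊗ₜ[k] y))
    (AlgHom.congr_fun (TPow.counitAt_comp_comulAt_lt h hp) x)

lemma codegen_coface_self {n i : ℕ} (h : i ≤ n) :
    codegen k H M n i ∘ₗ coface k H M n i = LinearMap.id :=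
  Cochain.hom_ext fun m x => congrArg (fun y => (balance k H M _).mkQ (m ⊗ₜ[k] y))
    (AlgHom.congr_fun (TPow.counitAt_comp_comulAt_self h) x)

lemma codegen_succ_coface {n i : ℕ} (h : i ≤ n) :
    codegen k H M n (i + 1) ∘ₗ coface k H M n i = LinearMap.id :=
  Cochain.hom_ext fun m x => congrArg (fun y => (balance k H M _).mkQ (m ⊗ₜ[k] y))
    (AlgHom.congr_fun (TPow.counitAt_succ_comp_comulAt h) x)

lemma codegen_coface_gt {n i p : ℕ} (h : p < i) (hi : i ≤ n + 1) :
    codegen k H M (n + 1) p ∘ₗ coface k H M (n + 1) i =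
      coface k H M n (i - 1) ∘ₗ codegen k H M n p :=
  Cochain.hom_ext fun m x => congrArg (fun y => (balance k H M _).mkQ (m ⊗ₜ[k] y))
    (AlgHom.congr_fun (TPow.counitAt_comp_comulAt_gt h hi) x)

lemma tau_coface {n i : ℕ} (hi : 1 ≤ i) (hi' : i ≤ n) :
    tau (n + 1) ∘ₗ coface k H M n i = coface k H M n (i - 1) ∘ₗ tau n := by
  refine Cochain.hom_ext fun m x => ?_
  rw [LinearMap.comp_apply, LinearMap.comp_apply, Cochain.map_mk, tau_mk, tau_mk, map_push,
    map_mulR, TPow.comulAt_inclL_gt (by omega) le_rfl]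
  congr 2
  exact congrArg (mulR _) (AlgHom.congr_fun (TPow.rot_comp_comulAt hi hi') x)

lemma tau_tau_coface (n : ℕ) :
    tau (n + 1) ∘ₗ tau (n + 1) ∘ₗ coface k H M n 0 = coface k H M n n ∘ₗ tau n := by
  refine Cochain.hom_ext fun m x => ?_
  simp only [LinearMap.comp_apply]
  rw [Cochain.map_mk, tau_tau_mk, tau_mk, map_push, map_mulR, TPow.comulAt_inclL_self le_rfl]
  congr 2
  exact congrArg (mulR _) (AlgHom.congr_fun (TPow.rot_comp_rot_comp_comulAt_zero n) x)

lemma tau_codegen {n i : ℕ} (hi' : i ≤ n) :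
    tau n ∘ₗ codegen k H M n (i + 1) = codegen k H M n i ∘ₗ tau (n + 1) := by
  refine Cochain.hom_ext fun m x => ?_
  rw [LinearMap.comp_apply, LinearMap.comp_apply, Cochain.map_mk, tau_mk, tau_mk, map_push,
    map_mulR, TPow.counitAt_inclL_gt (by omega) le_rfl, Nat.add_sub_cancel]
  congr 2
  exact congrArg (mulR _) (AlgHom.congr_fun (TPow.rot_comp_counitAt hi') x)

lemma tau_codegen_one (n : ℕ) : tau n ∘ₗ codegen k H M n 1 =
    codegen k H M n (n + 1) ∘ₗ tau (n + 1) ∘ₗ tau (n + 1) := by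
  refine Cochain.hom_ext fun m x => ?_
  simp only [LinearMap.comp_apply]
  rw [Cochain.map_mk, tau_mk, tau_tau_mk, map_push, map_mulR, map_conv,
    TPow.counitAt_inclL_self le_rfl, TPow.counitAt_inclL_lt (by omega) le_rfl, conv_convUnit]
  congr 2
  exact congrArg (mulR _) (AlgHom.congr_fun (TPow.rot_comp_counitAt_one n) x)

lemma codegen_tau_coface (n : ℕ) :
    codegen k H M n (n + 1) ∘ₗ tau (n + 1) ∘ₗ coface k H M n 0 = LinearMap.id := by
  refine Cochain.hom_ext fun m x => ?_
  simp only [LinearMap.comp_apply]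
  rw [Cochain.map_mk, tau_mk, map_push, map_mulR, TPow.counitAt_inclL_self le_rfl,
    LinearMap.id_apply, mk_eq_push]
  congr 2
  exact congrArg (mulR _) (AlgHom.congr_fun (TPow.counitAt_comp_rot_comp_comulAt n) x)

lemma tau_iterate {n j : ℕ} (hj : j ≤ n) (m : M) (x : TPow k H n) :
    (tau n)^[j + 1] ((balance k H M n).mkQ (m ⊗ₜ[k] x)) =
      push (mulR (iterConv j fun i => TPow.inclL k H n (n - j + i)) ((TPow.rot k H n)^[j + 1] x))
        (SAYDModule.coact (k := k) (H := H) m) := by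
  induction j with
  | zero => exact tau_mk m x
  | succ j ih =>
    have h : (TPow.rot k H n).toLinearMap ∘ₗ (iterConv j fun i => TPow.inclL k H n (n - j + i)) =
        iterConv j fun i => TPow.inclL k H n (n - (j + 1) + i) := by
      rw [map_iterConv]
      refine iterConv_congr fun i hi => ?_
      rw [TPow.rot_inclL_pos (by omega) (by omega)]
      congr 1; omega
    rw [Function.iterate_succ_apply', ih (by omega), tau_push, h, iterConv_succ',
      Function.iterate_succ_apply' (TPow.rot k H n) (j + 1)]
    · simp only [show n - (j + 1) + (j + 1) = n by omega]
    · intro a b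
      change Commute _ (((TPow.rot k H n).toLinearMap ∘ₗ
        (iterConv j fun i => TPow.inclL k H n (n - j + i))) b)
      rw [h]
      exact commute_iterConv (fun i hi c =>
        TPow.commute_incl le_rfl (by omega) (by omega) a c) b

lemma push_diagonal {n : ℕ} (m : M) (x : TPow k H n) :
    push (mulR (TPow.diagonal k H n).toLinearMap x) (SAYDModule.coact (k := k) (H := H) m) =
      (balance k H M n).mkQ (m ⊗ₜ[k] x) := by
  have h : ∀ p : H ⊗[k] M, push (mulR (TPow.diagonal k H n).toLinearMap x) p =
      (balance k H M n).mkQ (TensorProduct.lift (ract k H M) p ⊗ₜ[k] x) := fun p => by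
    induction p using TensorProduct.induction_on with
    | zero => simp
    | add x y hx hy => simp only [map_add, TensorProduct.add_tmul, hx, hy]
    | tmul g m =>
      rw [TensorProduct.lift.tmul, ract_apply, mk_balance]
      rfl
  rw [h, SAYDModule.stable]

lemma tau_pow (n : ℕ) : (tau n : Module.End k (Cochain k H M n)) ^ (n + 1) = 1 := by
  refine Cochain.hom_ext fun m x => ?_
  rw [Module.End.pow_apply, tau_iterate le_rfl, TPow.rot_iterate, Module.End.one_apply]
  simp only [Nat.sub_self, Nat.zero_add]
  rw [← TPow.diagonal_eq_iterConv, push_diagonal]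

lemma hopfCocyclic_δ {n i : ℕ} (hi : i ≤ n) : (hopfCocyclic k H M).δ n i = coface k H M n i :=
  if_pos hi

lemma hopfCocyclic_δ_last (n : ℕ) :
    (hopfCocyclic k H M).δ n (n + 1) = tau (n + 1) ∘ₗ coface k H M n 0 :=
  if_neg (by omega)

variable (k H M)

theorem hopfCocyclic_isCocyclic : (hopfCocyclic k H M).IsCocyclic where
  δ_δ n i j hij hj := by
    rcases Nat.lt_or_ge j (n + 2) with h | h
    · rw [hopfCocyclic_δ (show j ≤ n + 1 by omega), hopfCocyclic_δ (show i ≤ n by omega),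
        hopfCocyclic_δ (show i ≤ n + 1 by omega), hopfCocyclic_δ (show j - 1 ≤ n by omega),
        coface_coface hij (by omega)]
    · obtain rfl : j = n + 2 := by omega
      rw [hopfCocyclic_δ_last (n + 1), hopfCocyclic_δ (show i ≤ n + 1 by omega),
        show n + 2 - 1 = n + 1 by omega, hopfCocyclic_δ_last n]
      have h1 : ∀ i ≤ n, coface k H M (n + 1) (i + 1) ∘ₗ coface k H M n 0 =
          coface k H M (n + 1) 0 ∘ₗ coface k H M n i := fun i hi =>
        coface_coface (by omega) (by omega)
      have h2 : ∀ i ≤ n, tau (n + 1 + 1) ∘ₗ coface k H M (n + 1) (i + 1) =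
          coface k H M (n + 1) i ∘ₗ tau (n + 1) := fun i hi =>
        tau_coface (by omega) (by omega)
      rcases Nat.lt_or_ge i (n + 1) with h' | h'
      · rw [hopfCocyclic_δ (show i ≤ n by omega), LinearMap.comp_assoc, ← h1 i (by omega),
          ← LinearMap.comp_assoc, h2 i (by omega), LinearMap.comp_assoc]
      · obtain rfl : i = n + 1 := by omega
        rw [hopfCocyclic_δ_last n]
        have h3 := congrArg (· ∘ₗ coface k H M n 0) (tau_tau_coface (k := k) (H := H) (M := M) (n + 1))
        have h4 := congrArg (· ∘ₗ coface k H M n 0) (h2 0 (by omega))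
        simp only [LinearMap.comp_assoc] at h3 h4
        rw [LinearMap.comp_assoc, ← h3, ← h1 0 (by omega), h4]
  σ_σ n i j hij hj := codegen_codegen (by omega) (by omega)
  σ_δ_lt n i j hij hj := by
    rw [hopfCocyclic_δ (show i ≤ n + 1 by omega), hopfCocyclic_δ (show i ≤ n by omega)]
    refine (codegen_coface_lt (by omega) (by omega)).trans ?_
    rw [show j + 1 - 1 = j - 1 + 1 by omega]
  σ_δ_self n j hj := by
    rw [hopfCocyclic_δ hj]
    exact codegen_succ_coface hj
  σ_δ_succ n j hj := by
    rcases Nat.lt_or_ge j n with h | h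
    · rw [hopfCocyclic_δ (show j + 1 ≤ n by omega)]
      exact codegen_coface_self (by omega)
    · obtain rfl : j = n := by omega
      rw [hopfCocyclic_δ_last]
      exact codegen_tau_coface j
  σ_δ_gt n i j hij hi := by
    rcases Nat.lt_or_ge i (n + 2) with h | h
    · rw [hopfCocyclic_δ (show i ≤ n + 1 by omega), hopfCocyclic_δ (show i - 1 ≤ n by omega)]
      exact codegen_coface_gt (by omega) (by omega)
    · obtain rfl : i = n + 2 := by omega
      rw [hopfCocyclic_δ_last (n + 1), show n + 2 - 1 = n + 1 by omega, hopfCocyclic_δ_last n]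
      have h1 : tau (n + 1) ∘ₗ codegen k H M (n + 1) (j + 2) =
          codegen k H M (n + 1) (j + 1) ∘ₗ tau (n + 2) := tau_codegen (by omega)
      have h2 : codegen k H M (n + 1) (j + 2) ∘ₗ coface k H M (n + 1) 0 =
          coface k H M n 0 ∘ₗ codegen k H M n (j + 1) := codegen_coface_lt (by omega) (by omega)
      change codegen k H M (n + 1) (j + 1) ∘ₗ tau (n + 2) ∘ₗ coface k H M (n + 1) 0 =
        tau (n + 1) ∘ₗ coface k H M n 0 ∘ₗ codegen k H M n (j + 1)
      rw [← h2, ← LinearMap.comp_assoc, ← h1, LinearMap.comp_assoc]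
  τ_δ n i hi hi' := by
    rcases Nat.lt_or_ge i (n + 1) with h | h
    · rw [hopfCocyclic_δ (show i ≤ n by omega), hopfCocyclic_δ (show i - 1 ≤ n by omega)]
      exact tau_coface hi (by omega)
    · obtain rfl : i = n + 1 := by omega
      rw [hopfCocyclic_δ_last, Nat.add_sub_cancel, hopfCocyclic_δ le_rfl]
      exact tau_tau_coface n
  τ_δ_zero n := by
    rw [hopfCocyclic_δ (Nat.zero_le n), hopfCocyclic_δ_last]
  τ_σ n i hi hi' := by
    refine (tau_codegen hi').trans ?_
    change _ = codegen k H M n (i - 1 + 1) ∘ₗ tau (n + 1)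
    rw [Nat.sub_add_cancel hi]
  τ_σ_zero n := tau_codegen_one n
  τ_pow n := tau_pow n

end Hopf

end HopfCyclic

namespace HopfCyclic

universe u v w

section Hopf

variable {k : Type u} [Field k] {H : Type v} [Ring H] [HopfAlgebra k H]

open Coalgebra Bialgebra

/-! ### `ρ` is a map of cocyclic modules -/

namespace TPow

lemma comul_eq_of_bialgHom {A B : Type*} [Semiring A] [Bialgebra k A] [Semiring B] [Bialgebra k B]
    {f : A →ₐ[k] B} (hf : ∃ g : A →ₐc[k] B, ∀ x, g x = f x) (x : A) :
    comul (R := k) (f x) = TensorProduct.map f.toLinearMap f.toLinearMap (comul (R := k) x) := by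
  obtain ⟨g, hg⟩ := hf
  have e : f.toLinearMap = (g : A →ₗ[k] B) := LinearMap.ext fun x => (hg x).symm
  rw [← hg, e]
  exact (CoalgHomClass.map_comp_comul_apply g x).symm

lemma map_bialgHom_apply {A A' B B' : Type*} [Ring A] [Bialgebra k A] [Ring B] [Bialgebra k B]
    [Ring A'] [Bialgebra k A'] [Ring B'] [Bialgebra k B'] (f : A →ₐc[k] A') (f' : A →ₐ[k] A')
    (g : B →ₐc[k] B') (g' : B →ₐ[k] B') (hf : ∀ x, f x = f' x) (hg : ∀ x, g x = g' x)
    (z : A ⊗[k] B) :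
    Bialgebra.TensorProduct.map f g z = Algebra.TensorProduct.map f' g' z := by
  induction z using TensorProduct.induction_on with
  | zero => simp
  | add x y hx hy => rw [map_add, map_add, hx, hy]
  | tmul a b =>
    rw [Bialgebra.TensorProduct.map_tmul, Algebra.TensorProduct.map_tmul, hf, hg]

/-- `cons` as an isomorphism of bialgebras. -/
def consBialgHom (n : ℕ) : H ⊗[k] TPow k H n →ₐc[k] TPow k H (n + 1) :=
  BialgHom.id k (H ⊗[k] TPow k H n)

/-- The inverse of `cons` as a map of bialgebras. -/
def consSymmBialgHom (n : ℕ) : TPow k H (n + 1) →ₐc[k] H ⊗[k] TPow k H n :=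
  BialgHom.id k (H ⊗[k] TPow k H n)

/-- `one` as a map of bialgebras. -/
def oneBialgHom : H →ₐc[k] TPow k H 0 := BialgHom.id k H

/-- The inverse of `one` as a map of bialgebras. -/
def oneSymmBialgHom : TPow k H 0 →ₐc[k] H := BialgHom.id k H

lemma exists_bialgHom_comul_assoc [IsCocomm k H] (B : Type*) [Ring B] [Bialgebra k B] :
    ∃ g : H ⊗[k] B →ₐc[k] H ⊗[k] (H ⊗[k] B), ∀ z, g z =
      Algebra.TensorProduct.assoc k k k H H B
        (Algebra.TensorProduct.map (comulAlgHom k H) (AlgHom.id k B) z) :=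
  ⟨(Bialgebra.TensorProduct.assoc k k H H B).toBialgHom.comp
    (Bialgebra.TensorProduct.map (comulBialgHom k H) (BialgHom.id k B)), fun z =>
    congrArg (Algebra.TensorProduct.assoc k k k H H B)
      (map_bialgHom_apply (comulBialgHom k H) (comulAlgHom k H) (BialgHom.id k B) (AlgHom.id k B)
        (fun _ => rfl) (fun _ => rfl) z)⟩

lemma exists_bialgHom_comulAt [IsCocomm k H] {n i : ℕ} :
    ∃ g : TPow k H n →ₐc[k] TPow k H (n + 1), ∀ x, g x = comulAt k H n i x := by
  induction n generalizing i with
  | zero =>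
    exact ⟨(consBialgHom 0).comp ((Bialgebra.TensorProduct.map (BialgHom.id k H) oneBialgHom).comp
      ((comulBialgHom k H).comp oneSymmBialgHom)), fun x => rfl⟩
  | succ n ih =>
    rcases i with _ | i
    · obtain ⟨f, hf⟩ := exists_bialgHom_comul_assoc (k := k) (H := H) (TPow k H n)
      let g := Bialgebra.TensorProduct.map (BialgHom.id k H) (consBialgHom (k := k) (H := H) n)
      have hg (z) : g z = Algebra.TensorProduct.map (AlgHom.id k H) (cons n).toAlgHom z :=
        map_bialgHom_apply _ _ _ _ (fun _ => rfl) (fun _ => rfl) z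
      refine ⟨(consBialgHom (n + 1)).comp (g.comp (f.comp (consSymmBialgHom n))), fun x => ?_⟩
      exact (hg _).trans (congrArg (Algebra.TensorProduct.map (AlgHom.id k H) (cons n).toAlgHom)
        (hf ((cons n).symm x)))
    · obtain ⟨g, hg⟩ := ih (i := i)
      exact ⟨(consBialgHom (n + 1)).comp
        ((Bialgebra.TensorProduct.map (BialgHom.id k H) g).comp (consSymmBialgHom n)),
        fun x => map_bialgHom_apply _ (AlgHom.id k H) _ _ (fun _ => rfl) hg
          ((cons n).symm x)⟩

lemma exists_bialgHom_counitAt {n i : ℕ} :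
    ∃ g : TPow k H (n + 1) →ₐc[k] TPow k H n, ∀ x, g x = counitAt k H n i x := by
  induction n generalizing i with
  | zero =>
    rcases i with _ | i
    · exact ⟨(Bialgebra.TensorProduct.lid k (TPow k H 0)).toBialgHom.comp
        ((Bialgebra.TensorProduct.map (counitBialgHom k H) (BialgHom.id k (TPow k H 0))).comp
          (consSymmBialgHom 0)), fun x => rfl⟩
    · exact ⟨oneBialgHom.comp ((Bialgebra.TensorProduct.rid k k H).toBialgHom.comp
        ((Bialgebra.TensorProduct.map (BialgHom.id k H)
          ((counitBialgHom k H).comp oneSymmBialgHom)).comp (consSymmBialgHom 0))), fun x => rfl⟩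
  | succ n ih =>
    rcases i with _ | i
    · exact ⟨(Bialgebra.TensorProduct.lid k (TPow k H (n + 1))).toBialgHom.comp
        ((Bialgebra.TensorProduct.map (counitBialgHom k H)
          (BialgHom.id k (TPow k H (n + 1)))).comp (consSymmBialgHom (n + 1))), fun x => rfl⟩
    · obtain ⟨g, hg⟩ := ih (i := i)
      exact ⟨(consBialgHom n).comp
        ((Bialgebra.TensorProduct.map (BialgHom.id k H) g).comp (consSymmBialgHom (n + 1))),
        fun x => map_bialgHom_apply _ (AlgHom.id k H) _ _ (fun _ => rfl) hg
          ((cons (n + 1)).symm x)⟩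

lemma exists_bialgHom_snoc (n : ℕ) :
    ∃ g : TPow k H n ⊗[k] H →ₐc[k] TPow k H (n + 1), ∀ x, g x = snoc k H n x := by
  induction n with
  | zero =>
    exact ⟨(consBialgHom 0).comp (Bialgebra.TensorProduct.map oneSymmBialgHom oneBialgHom),
      fun x => rfl⟩
  | succ n ih =>
    obtain ⟨g, hg⟩ := ih
    exact ⟨(consBialgHom (n + 1)).comp
      ((Bialgebra.TensorProduct.map (BialgHom.id k H) g).comp
      ((Bialgebra.TensorProduct.assoc k k H (TPow k H n) H).toBialgHom.comp
        (Bialgebra.TensorProduct.map (consSymmBialgHom n) (BialgHom.id k H)))),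
      fun x => map_bialgHom_apply _ (AlgHom.id k H) _ _ (fun _ => rfl) hg _⟩

lemma exists_bialgHom_rot (n : ℕ) :
    ∃ g : TPow k H n →ₐc[k] TPow k H n, ∀ x, g x = rot k H n x := by
  rcases n with _ | n
  · exact ⟨BialgHom.id k _, fun x => rfl⟩
  · obtain ⟨g, hg⟩ := exists_bialgHom_snoc (k := k) (H := H) n
    exact ⟨g.comp ((Bialgebra.TensorProduct.comm k H (TPow k H n)).toBialgHom.comp
      (consSymmBialgHom n)), fun x => hg _⟩

lemma exists_bialgHom_incl (n i : ℕ) :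
    ∃ g : H →ₐc[k] TPow k H n, ∀ x, g x = incl k H n i x := by
  induction n generalizing i with
  | zero => exact ⟨oneBialgHom, fun x => rfl⟩
  | succ n ih =>
    rcases i with _ | i
    · refine ⟨(consBialgHom n).comp
        ((Bialgebra.TensorProduct.map (BialgHom.id k H) (unitBialgHom k (TPow k H n))).comp
          (Bialgebra.TensorProduct.rid k k H).symm.toBialgHom), fun x => ?_⟩
      change cons n (x ⊗ₜ[k] algebraMap k (TPow k H n) 1) = cons n (x ⊗ₜ[k] 1)
      rw [map_one]
    · obtain ⟨g, hg⟩ := ih i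
      refine ⟨(consBialgHom n).comp
        ((Bialgebra.TensorProduct.map (unitBialgHom k H) g).comp
          (Bialgebra.TensorProduct.lid k H).symm.toBialgHom), fun x => ?_⟩
      change cons n (algebraMap k H 1 ⊗ₜ[k] g x) = cons n (1 ⊗ₜ[k] incl k H n i x)
      rw [map_one, hg]

lemma comul_twist (n : ℕ) (g : H) (x : TPow k H n) :
    comul (R := k) (twist k H n (g ⊗ₜ[k] x)) =
      TensorProduct.map (twist k H n) (twist k H n)
        (TensorProduct.tensorTensorTensorComm k H H (TPow k H n) (TPow k H n)
          (comul (R := k) g ⊗ₜ[k] comul (R := k) x)) := by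
  rw [twist_eq, Bialgebra.comul_mul, comul_eq_of_bialgHom (exists_bialgHom_incl n n),
    comul_eq_of_bialgHom (exists_bialgHom_rot n)]
  generalize comul (R := k) g = z
  generalize comul (R := k) x = w
  induction z using TensorProduct.induction_on with
  | zero => simp
  | add x y hx hy => simp only [map_add, add_mul, TensorProduct.add_tmul, hx, hy]
  | tmul a b =>
    induction w using TensorProduct.induction_on with
    | zero => simp
    | add x y hx hy => simp only [map_add, mul_add, TensorProduct.tmul_add, hx, hy]
    | tmul x y =>
      rw [TensorProduct.tensorTensorTensorComm_tmul, TensorProduct.map_tmul,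
        TensorProduct.map_tmul, TensorProduct.map_tmul, Algebra.TensorProduct.tmul_mul_tmul,
        twist_eq, twist_eq]
      rfl

end TPow

variable {M : Type w} [AddCommGroup M] [Module k M] [Module Hᵐᵒᵖ M] [IsScalarTower k Hᵐᵒᵖ M]
  [IsCocomm k H]

lemma rho_mk (ψ : M →ₗ[k] M ⊗[k] M) (hψ : ActCompatible k H ψ) (n : ℕ) (m : M) (x : TPow k H n) :
    rho ψ hψ n ((balance k H M n).mkQ (m ⊗ₜ[k] x)) =
      TensorProduct.map (balance k H M n).mkQ (balance k H M n).mkQ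
        (TensorProduct.tensorTensorTensorComm k M M (TPow k H n) (TPow k H n)
          (ψ m ⊗ₜ[k] comul (R := k) x)) := rfl

lemma rho_comp_map (ψ : M →ₗ[k] M ⊗[k] M) (hψ : ActCompatible k H ψ) {n n' : ℕ}
    (f : TPow k H n →ₐ[k] TPow k H n')
    (hf : ∀ h, f (TPow.diagonal k H n h) = TPow.diagonal k H n' h)
    (hf' : ∃ g : TPow k H n →ₐc[k] TPow k H n', ∀ x, g x = f x) :
    rho ψ hψ n' ∘ₗ Cochain.map f hf =
      TensorProduct.map (Cochain.map f hf) (Cochain.map f hf) ∘ₗ rho ψ hψ n := by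
  refine Cochain.hom_ext fun m x => ?_
  rw [LinearMap.comp_apply, LinearMap.comp_apply, Cochain.map_mk, rho_mk, rho_mk,
    TPow.comul_eq_of_bialgHom hf']
  generalize comul (R := k) x = z
  generalize ψ m = p
  induction z using TensorProduct.induction_on with
  | zero => simp
  | add x y hx hy => simp only [map_add, TensorProduct.tmul_add, hx, hy]
  | tmul a b =>
    induction p using TensorProduct.induction_on with
    | zero => simp
    | add x y hx hy => simp only [map_add, TensorProduct.add_tmul, hx, hy]
    | tmul x y => rfl

variable [SAYDModule k H M]

/-- The map `x ⊗ (g ⊗ m) ↦ m ⊗_H (h₁ ⊗ ⋯ ⊗ hₙ ⊗ g h₀)`, where `x = h₀ ⊗ ⋯ ⊗ hₙ`. -/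
def twistMk (n : ℕ) : TPow k H n ⊗[k] (H ⊗[k] M) →ₗ[k] Cochain k H M n :=
  (balance k H M n).mkQ ∘ₗ TensorProduct.map LinearMap.id (TPow.twist k H n) ∘ₗ
    (TensorProduct.assoc k M H (TPow k H n)).toLinearMap ∘ₗ
    TensorProduct.map (TensorProduct.comm k H M).toLinearMap LinearMap.id ∘ₗ
    (TensorProduct.comm k (TPow k H n) (H ⊗[k] M)).toLinearMap

lemma rho_tauAux (ψ : M →ₗ[k] M ⊗[k] M) (hψ : ActCompatible k H ψ) (n : ℕ) (x : TPow k H n)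
    (p : H ⊗[k] M) : rho ψ hψ n (tauAux n x p) =
      TensorProduct.map (twistMk n) (twistMk n)
        (TensorProduct.tensorTensorTensorComm k (TPow k H n) (TPow k H n) (H ⊗[k] M) (H ⊗[k] M)
          (comul (R := k) x ⊗ₜ[k] TensorProduct.tensorTensorTensorComm k H H M M
            (TensorProduct.map comul ψ p))) := by
  induction p using TensorProduct.induction_on with
  | zero => simp
  | add x y hx hy => simp only [map_add, TensorProduct.tmul_add, hx, hy]
  | tmul g m =>
    rw [tauAux_tmul, rho_mk, TPow.comul_twist, TensorProduct.map_tmul]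
    generalize comul (R := k) x = z
    generalize ψ m = p
    generalize comul (R := k) g = w
    induction z using TensorProduct.induction_on with
    | zero => simp
    | add x y hx hy => simp only [map_add, TensorProduct.tmul_add, TensorProduct.add_tmul, hx, hy]
    | tmul a b =>
      induction p using TensorProduct.induction_on with
      | zero => simp
      | add x y hx hy => simp only [map_add, TensorProduct.tmul_add, TensorProduct.add_tmul, hx, hy]
      | tmul x y =>
        induction w using TensorProduct.induction_on with
        | zero => simp
        | add x y hx hy =>
          simp only [map_add, TensorProduct.tmul_add, TensorProduct.add_tmul, hx, hy]
        | tmul c d => rfl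

lemma map_tau_mk (n : ℕ) (q : M ⊗[k] M) (z : TPow k H n ⊗[k] TPow k H n) :
    TensorProduct.map (tau n) (tau n)
      (TensorProduct.map (balance k H M n).mkQ (balance k H M n).mkQ
        (TensorProduct.tensorTensorTensorComm k M M (TPow k H n) (TPow k H n) (q ⊗ₜ[k] z))) =
      TensorProduct.map (twistMk n) (twistMk n)
        (TensorProduct.tensorTensorTensorComm k (TPow k H n) (TPow k H n) (H ⊗[k] M) (H ⊗[k] M)
          (z ⊗ₜ[k] TensorProduct.map SAYDModule.coact SAYDModule.coact q)) := by
  induction z using TensorProduct.induction_on with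
  | zero => simp
  | add x y hx hy => simp only [map_add, TensorProduct.tmul_add, TensorProduct.add_tmul, hx, hy]
  | tmul a b =>
    induction q using TensorProduct.induction_on with
    | zero => simp
    | add x y hx hy => simp only [map_add, TensorProduct.tmul_add, TensorProduct.add_tmul, hx, hy]
    | tmul x y => rfl

lemma rho_comp_tau (ψ : M →ₗ[k] M ⊗[k] M) (hψ : CoactCompatible (k := k) (H := H) ψ)
    (hψ' : ActCompatible k H ψ) (n : ℕ) :
    rho ψ hψ' n ∘ₗ tau n = TensorProduct.map (tau n) (tau n) ∘ₗ rho ψ hψ' n := by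
  refine Cochain.hom_ext fun m x => ?_
  have h : TensorProduct.tensorTensorTensorComm k H H M M
      (TensorProduct.map comul ψ (SAYDModule.coact (k := k) (H := H) m)) =
      TensorProduct.map SAYDModule.coact SAYDModule.coact (ψ m) := by
    have e := LinearMap.congr_fun hψ m
    rw [LinearMap.comp_apply] at e
    rw [e]
    exact (TensorProduct.tensorTensorTensorComm k H M H M).symm_apply_apply _
  rw [LinearMap.comp_apply, LinearMap.comp_apply, rho_mk, map_tau_mk, ← h]
  exact rho_tauAux ψ hψ' n x _

theorem isHom_rho (ψ : M →ₗ[k] M ⊗[k] M) (hψ : CoactCompatible (k := k) (H := H) ψ)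
    (hψ' : ActCompatible k H ψ) :
    (hopfCocyclic k H M).IsHom ((hopfCocyclic k H M).diag (hopfCocyclic k H M)) (rho ψ hψ') where
  δ n i hi := by
    have h (i : ℕ) := rho_comp_map ψ hψ' (TPow.comulAt k H n i) (TPow.comulAt_diagonal n i)
      TPow.exists_bialgHom_comulAt
    change _ = TensorProduct.map ((hopfCocyclic k H M).δ n i) ((hopfCocyclic k H M).δ n i) ∘ₗ _
    rcases Nat.lt_or_ge n i with h' | h'
    · obtain rfl : i = n + 1 := by omega
      rw [hopfCocyclic_δ_last, TensorProduct.map_comp, LinearMap.comp_assoc, ← h 0,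
        ← LinearMap.comp_assoc, ← LinearMap.comp_assoc, rho_comp_tau ψ hψ hψ']
    · rw [hopfCocyclic_δ h']
      exact h i
  σ n i _ := rho_comp_map ψ hψ' _ (TPow.counitAt_diagonal n (i + 1)) TPow.exists_bialgHom_counitAt
  τ n := rho_comp_tau ψ hψ hψ' n

end Hopf

end HopfCyclic

open HopfCyclic in
theorem mainTheorem2 {k : Type*} [Field k] [CharZero k] {H : Type*} [Ring H] [HopfAlgebra k H]
    [Coalgebra.IsCocomm k H] {M : Type*} [AddCommGroup M] [Module k M] [Module Hᵐᵒᵖ M]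
    [IsScalarTower k Hᵐᵒᵖ M] [SAYDModule k H M]
    (ψ : M →ₗ[k] M ⊗[k] M) (hψ : CoactCompatible (k := k) (H := H) ψ)
    (hψ' : ActCompatible k H ψ) :
    let C := hopfCocyclic k H M
    -- `C(H, M)` is a cocyclic module, `ρ` is a map of cocyclic modules, and the cohomologies below
    -- are those of genuine supercomplexes
    C.IsCocyclic ∧ C.IsHom (C.diag C) (rho ψ hψ') ∧
    C.periodic.IsSupercomplex ∧ (C.diag C).periodic.IsSupercomplex ∧
    (C.periodic.tensor C.periodic).IsSupercomplex ∧
    -- `ρ` and `S̃h` are maps of supercomplexes, so that `(S̃h ρ)^*` is defined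
    ∃ (hρ : C.periodic.IsMap (C.diag C).periodic (CocyclicData.totMap (rho ψ hψ')))
      (hSh : (C.diag C).periodic.IsMap (C.periodic.tensor C.periodic) (CocyclicData.Sh C C)),
      -- the Künneth map `∇` is an isomorphism
      (∀ n : ZMod 2, Function.Bijective (C.periodic.nabla C.periodic n)) ∧
      -- there is exactly one coproduct `⊔ = ∇⁻¹ (S̃h ρ)^*`
      ∃! cop : ∀ n : ZMod 2, C.HP n →ₗ[k]
          ⨁ p : {p : ZMod 2 × ZMod 2 // p.1 + p.2 = n}, C.HP p.1.1 ⊗[k] C.HP p.1.2,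
        ∀ (n : ZMod 2) (x : C.HP n),
          C.periodic.nabla C.periodic n (cop n x) = (hSh.comp hρ).cohMap n x := by
  intro C
  have hC : C.IsCocyclic := hopfCocyclic_isCocyclic k H M
  have hρ := isHom_rho ψ hψ hψ'
  have hK := hC.isSupercomplex_periodic
  have hb := SuperData.nabla_bijective hK hK
  refine ⟨hC, hρ, hK, (hC.diag hC).isSupercomplex_periodic, hK.tensor hK, hρ.isMap,
    hC.isMap_Sh hC, hb, fun n => (LinearEquiv.ofBijective _ (hb n)).symm.toLinearMap ∘ₗ
      ((hC.isMap_Sh hC).comp hρ.isMap).cohMap n, fun n x => ?_, fun cop h => ?_⟩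
  · exact (LinearEquiv.ofBijective _ (hb n)).apply_symm_apply _
  · refine funext fun n => LinearMap.ext fun x => (hb n).1 ((h n x).trans ?_)
    exact ((LinearEquiv.ofBijective _ (hb n)).apply_symm_apply _).symm
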